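/- **Theorem.** For $1\le p\le\infty$ let $\|\cdot\|_p$ be the norm of $\ell^p(\mathbb Z)$, with $\|g\|_p=\infty$ if $g\notin\ell^p(\mathbb Z)$, and let $\mu=\sum_{n\in\mathbb Z}\frac1{1+|n|}\delta_n$. For $F:(0,\infty)\times\mathbb Z\to\mathbb R$ put $$\|F\|_{p,q}=\Big(\int_0^\infty\|F(t,\cdot)\|_p^q\,\frac{dt}{t}\Big)^{1/q}\ (1\le q<\infty),\qquad \|F\|_{p,\infty}=\operatorname*{ess\,sup}_{t>0}\|F(t,\cdot)\|_p .$$ For $f:\mathbb Z\to\mathbb R$, let $$e^{t\Delta_d}f(n)=\sum_{j\in\mathbb Z}e^{-2t}I_{n-j}(2t)\,f(j)\quad(t>0),\qquad e^{-y\sqrt{-\Delta_d}}f(n)=\frac{y}{2\sqrt\pi}\int_0^\infty\frac{e^{-y^2/(4t)}}{t^{3/2}}\,e^{t\Delta_d}f(n)\,dt\quad(y>0),$$ where $I_n$ is the modified Bessel function of the first kind, $I_n(t)=\sum_{m\ge0}\frac{1}{m!\,\Gamma(m+|n|+1)}\left(\frac t2\right)^{2m+|n|}$ for $n\in\mathbb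 Z$. For $\alpha>0$ and $1\le p,q\le\infty$ define $$\Lambda_H^{\alpha,p,q}=\Big\{f:\mathbb Z\to\mathbb R:\ \tfrac{f}{1+|\cdot|^\alpha}\in\ell^q(\mathbb Z,\mu),\ \big\|t^{k-\alpha/2}\,\partial_t^k e^{t\Delta_d}f\big\|_{p,q}<\infty\Big\},\qquad k=[\alpha/2]+1,$$ $$\Lambda_P^{\alpha,p,q}=\Big\{f:\mathbb Z\to\mathbb R:\ \sum_{n\in\mathbb Z}\tfrac{|f(n)|}{1+|n|^2}<\infty,\ \big\|y^{l-\alpha}\,\partial_y^l e^{-y\sqrt{-\Delta_d}}f\big\|_{p,q}<\infty\Big\},\qquad l=[\alpha]+1,$$ where $[x]$ denotes the integer part of $x$. Let $0<\alpha<2$, $1\le p,q\le\infty$, and let $f:\mathbb Z\to\mathbb R$ satisfy $\frac{f}{1+|\cdot|^\alpha}\in\ell^q(\mathbb Z,\mu)$ and $\sum_{j\in\mathbb Z}\frac{|f(j)|}{1+|j|^2}<\infty$. Then the following are equivalent: 1. $f\in\Lambda_H^{\alpha,p,q}$; 2. $f\in\Lambda_P^{\alpha,p,q}$; 3. $$\sum_{j\neq0}\Big\|\frac{f(\cdot-j)-2f(\cdot)+f(\cdot+j)}{|j|^\alpha}\Big\|_p^q\frac1{|j|}<\infty\quad\text{if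 }1\le q<\infty,\qquad \sup_{j\ne0}\Big\|\frac{f(\cdot-j)-2f(\cdot)+f(\cdot+j)}{|j|^\alpha}\Big\|_p<\infty\quad\text{if }q=\infty.$$ -/

import Mathlib

open MeasureTheory
open scoped ENNReal

noncomputable section

namespace DiscreteBesov

/-- The `ℓ^p(ℤ)` norm of `f`, as an extended nonnegative real (`∞` if `f ∉ ℓ^p(ℤ)`). -/
def ellNorm (p : ℝ≥0∞) (f : ℤ → ℝ) : ℝ≥0∞ :=
  eLpNorm f p Measure.count

/-- The weight `μ = ∑_{n ∈ ℤ} (1 + |n|)⁻¹ δ_n` on `ℤ`. -/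
def weight : Measure ℤ :=
  Measure.sum fun n : ℤ => ENNReal.ofReal (1 / (1 + |(n : ℝ)|)) • Measure.dirac n

/-- The size condition `f / (1 + |·|^α) ∈ ℓ^q(ℤ, μ)`. -/
def SizeCondition (α : ℝ) (q : ℝ≥0∞) (f : ℤ → ℝ) : Prop :=
  MemLp (fun n : ℤ => f n / (1 + |(n : ℝ)| ^ α)) q weight

/-- The summability condition `∑_{n ∈ ℤ} |f(n)| / (1 + |n|²) < ∞`. -/
def SummabilityCondition (f : ℤ → ℝ) : Prop :=
  Summable fun n : ℤ => |f n| / (1 + |(n : ℝ)| ^ 2)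

/-- The measure `dt / t` on `(0, ∞)`. -/
def haarPos : Measure ℝ :=
  (volume.restrict (Set.Ioi (0 : ℝ))).withDensity fun t => ENNReal.ofReal (1 / t)

/-- The mixed norm `‖F‖_{p,q}` of `L^q((0, ∞), dt/t; ℓ^p(ℤ))`, as an extended nonnegative real:
`(∫_0^∞ ‖F(t)‖_p^q dt/t)^{1/q}` for `q < ∞`, and the essential supremum over `t > 0`
of `‖F(t)‖_p` for `q = ∞`. -/
def mixedNorm (p q : ℝ≥0∞) (F : ℝ → ℤ → ℝ) : ℝ≥0∞ :=
  eLpNorm (fun t : ℝ => ellNorm p (F t)) q haarPos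

/-- The modified Bessel function of the first kind `I_n` of integer order at a real argument,
with `I_{-n} = I_n`. Here `Γ(m + |n| + 1)` is written as the factorial `(m + |n|)!`. -/
def besselI (n : ℤ) (t : ℝ) : ℝ :=
  ∑' m : ℕ, 1 / ((m.factorial : ℝ) * ((m + n.natAbs).factorial : ℝ)) *
    (t / 2) ^ (2 * m + n.natAbs)

/-- The discrete heat kernel `G(t, n) = e^{-2t} I_n(2t)`. -/
def heatKernel (t : ℝ) (n : ℤ) : ℝ :=
  Real.exp (-(2 * t)) * besselI n (2 * t)

/-- The heat semigroup `e^{tΔ_d} f(n) = ∑_{j ∈ ℤ} G(t, n - j) f(j)`. -/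
def heatSemigroup (t : ℝ) (f : ℤ → ℝ) (n : ℤ) : ℝ :=
  ∑' j : ℤ, heatKernel t (n - j) * f j

/-- The Poisson semigroup, by subordination:
`e^{-y√(-Δ_d)} f(n) = y / (2√π) ∫_0^∞ e^{-y²/(4t)} t^{-3/2} e^{tΔ_d} f(n) dt`. -/
def poissonSemigroup (y : ℝ) (f : ℤ → ℝ) (n : ℤ) : ℝ :=
  y / (2 * Real.sqrt Real.pi) *
    ∫ t in Set.Ioi (0 : ℝ),
      Real.exp (-(y ^ 2 / (4 * t))) / t ^ (3 / 2 : ℝ) * heatSemigroup t f n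

/-- The discrete heat Besov space `Λ_H^{α,p,q}`: the size condition together with
`‖t^{k - α/2} ∂_t^k e^{tΔ_d} f‖_{p,q} < ∞`, where `k = [α/2] + 1`. -/
def heatBesov (α : ℝ) (p q : ℝ≥0∞) : Set (ℤ → ℝ) :=
  {f | SizeCondition α q f ∧
    mixedNorm p q (fun t n =>
      t ^ (((⌊α / 2⌋₊ + 1 : ℕ) : ℝ) - α / 2) *
        iteratedDeriv (⌊α / 2⌋₊ + 1) (fun s => heatSemigroup s f n) t) < ∞}

/-- The discrete Poisson Besov space `Λ_P^{α,p,q}`: the summability condition together with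
`‖y^{l - α} ∂_y^l e^{-y√(-Δ_d)} f‖_{p,q} < ∞`, where `l = [α] + 1`. -/
def poissonBesov (α : ℝ) (p q : ℝ≥0∞) : Set (ℤ → ℝ) :=
  {f | SummabilityCondition f ∧
    mixedNorm p q (fun y n =>
      y ^ (((⌊α⌋₊ + 1 : ℕ) : ℝ) - α) *
        iteratedDeriv (⌊α⌋₊ + 1) (fun s => poissonSemigroup s f n) y) < ∞}

/-- `‖(f(· - j) - 2 f(·) + f(· + j)) / |j|^α‖_p`. -/
def secondDiffNorm (α : ℝ) (p : ℝ≥0∞) (f : ℤ → ℝ) (j : ℤ) : ℝ≥0∞ :=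
  ellNorm p fun n => (f (n - j) - 2 * f n + f (n + j)) / |(j : ℝ)| ^ α

/-- Finiteness of the sum (for `q < ∞`), respectively of the supremum (for `q = ∞`),
of the second differences over `j ≠ 0`. -/
def SecondDiffCondition (α : ℝ) (p q : ℝ≥0∞) (f : ℤ → ℝ) : Prop :=
  (q ≠ ∞ →
    (∑' j : {j : ℤ // j ≠ 0},
      secondDiffNorm α p f j ^ q.toReal * ENNReal.ofReal (1 / |((j : ℤ) : ℝ)|)) < ∞) ∧
  (q = ∞ → (⨆ j : {j : ℤ // j ≠ 0}, secondDiffNorm α p f j) < ∞)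

end DiscreteBesov

end

/-! On the Fourier side `-Δ_d` is multiplication by `2 - 2 cos θ = λ²` with `λ = 2 sin (θ / 2) ∈ [0,
2]` for `θ ∈ [0, 2π]`. Hence the heat semigroup has symbol `e^{-tλ²}` (generating function of the
Bessel functions), the Poisson semigroup has symbol `e^{-yλ}` (subordination), and the Laplacian has
symbol `-λ²`. A symbol that is `C²` in `λ` has a kernel of size `O(1 / (1 + j²))`, so it may be
convolved with any `f` for which `∑ |f(j)| / (1 + j²)` converges, and products of symbols become
compositions of operators.

Let `N(J)` be the `ℓ^p` norm of the second difference of `f` with step `J`, and let `a(y)` be the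
`ℓ^p` norm of `λ² e^{-y²λ²} f` (heat at time `y²`) or of `λ² e^{-yλ} f` (Poisson). Both semigroups
have nonnegative kernels of total mass one, so `a` is decreasing. Two inequalities, the same for
both semigroups, relate `a` and `N`.

(i) `a(y) ≲ J⁻² N(J) + y⁻² J⁻¹ ∑_{i<J} N(i)`. Write `f` as a Steklov average at scale `J` plus a
remainder. The Laplacian of the average is `J⁻²` times a second difference; the remainder is a mean
of second differences with steps below `J`, on which `λ² e^{-y²λ²}` or `λ² e^{-yλ}` acts with `ℓ¹`
norm `O(y⁻²)`.

(ii) `N(J) ≲ ∫_0^{2J} s a(s) ds`. Write `f = (f - g) + g` with `g = T_{J²} f` for heat and `g = 2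
P_J f - P_{2J} f` for Poisson. Then `f - g` is an integral of `λ²`-derivatives, and the second
difference of `g` is at most `J²` times its Laplacian.

With `J = ⌊y⌋` (`J = 1` for `y < 1`) and Schur's test for `dy / y` against `∑ 1 / n`, these become
Hardy inequalities, valid for `0 < α < 2`, which identify condition 3 with finiteness of the norm of
`y^{2-α} a(y)` in `L^q(dy / y)` (`secondDiffCondition_iff_eLpNorm`). For heat, `t = y²` turns this
norm into the defining one. For Poisson it is the defining norm if `α ≥ 1`; if `α < 1` the
definition has one derivative, and `eLpNorm_pois_first_iff` compares one derivative with two. -/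

noncomputable section

namespace DiscreteBesov

open Real intervalIntegral

/-! ### Kernels of functions of `√(-Δ_d)` -/

/-- The spectral parameter `2 sin (θ / 2)` of `√(-Δ_d)`. -/
def lam (θ : ℝ) : ℝ := 2 * sin (θ / 2)

/-- The convolution kernel of `σ(√(-Δ_d))`. -/
def kern (σ : ℝ → ℝ) (j : ℤ) : ℝ :=
  (2 * π)⁻¹ * ∫ θ in (0 : ℝ)..(2 * π), σ (lam θ) * cos (j * θ)

lemma continuous_lam : Continuous lam := by unfold lam; fun_prop

lemma lam_mem {θ : ℝ} (h : θ ∈ Set.Icc (0 : ℝ) (2 * π)) : lam θ ∈ Set.Icc (0 : ℝ) 2 := by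
  constructor
  · have := sin_nonneg_of_nonneg_of_le_pi (x := θ / 2) (by linarith [h.1]) (by linarith [h.2])
    unfold lam; linarith
  · unfold lam; linarith [sin_le_one (θ / 2)]

lemma lam_sq (θ : ℝ) : lam θ ^ 2 = 2 - 2 * cos θ := by
  have h := cos_two_mul (θ / 2)
  have h' := sin_sq_add_cos_sq (θ / 2)
  rw [show 2 * (θ / 2) = θ by ring] at h
  unfold lam; nlinarith

lemma kern_neg_index (σ : ℝ → ℝ) (j : ℤ) : kern σ (-j) = kern σ j := by
  simp [kern, cos_neg]

lemma kern_const_mul (c : ℝ) (σ : ℝ → ℝ) (j : ℤ) :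
    kern (fun x => c * σ x) j = c * kern σ j := by
  unfold kern
  simp only [mul_assoc c, intervalIntegral.integral_const_mul]
  ring

lemma abs_kern_le {σ : ℝ → ℝ} {b : ℝ} (j : ℤ)
    (h : ∫ θ in (0 : ℝ)..(2 * π), |σ (lam θ)| ≤ b) (hσ : Continuous σ) :
    |kern σ j| ≤ (2 * π)⁻¹ * b := by
  unfold kern
  rw [abs_mul, abs_of_pos (by positivity : 0 < (2 * π)⁻¹)]
  gcongr
  have hl := continuous_lam
  refine (abs_integral_le_integral_abs (by positivity)).trans (le_trans ?_ h)
  refine integral_mono_on (by positivity) ?_ ?_ fun θ _ => ?_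
  · exact Continuous.intervalIntegrable (by fun_prop) _ _
  · exact Continuous.intervalIntegrable (by fun_prop) _ _
  · rw [abs_mul]
    exact mul_le_of_le_one_right (abs_nonneg _) (abs_cos_le_one _)

lemma abs_kern_le_of_bound {σ : ℝ → ℝ} {M : ℝ} (hσ : Continuous σ)
    (h : ∀ x ∈ Set.Icc (0 : ℝ) 2, |σ x| ≤ M) (j : ℤ) : |kern σ j| ≤ M := by
  have := abs_kern_le (σ := σ) (b := 2 * π * M) j ?_ hσ
  · rwa [inv_mul_cancel_left₀ (by positivity)] at this
  · have hl := continuous_lam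
    have : ∫ θ in (0 : ℝ)..(2 * π), |σ (lam θ)| ≤ ∫ θ in (0 : ℝ)..(2 * π), M := by
      refine integral_mono_on (by positivity) ?_ ?_ fun θ hθ => h _ (lam_mem hθ)
      · exact Continuous.intervalIntegrable (by fun_prop) _ _
      · exact Continuous.intervalIntegrable (by fun_prop) _ _
    simpa using this

/-- Both integrations by parts are contained in the single primitive `φ · j sin (jθ) + φ' cos (jθ)`.
Periodicity of `φ'` is not assumed: for `φ = σ ∘ lam` the boundary term is `-2 σ' 0`, which reflects
the kink of `|lam|` at multiples of `2π`. -/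
lemma sq_mul_integral_mul_cos {φ φ' φ'' : ℝ → ℝ} (h1 : ∀ θ, HasDerivAt φ (φ' θ) θ)
    (h2 : ∀ θ, HasDerivAt φ' (φ'' θ) θ) (h3 : Continuous φ'') (j : ℤ) :
    (j : ℝ) ^ 2 * ∫ θ in (0 : ℝ)..(2 * π), φ θ * cos (j * θ) =
      φ' (2 * π) - φ' 0 - ∫ θ in (0 : ℝ)..(2 * π), φ'' θ * cos (j * θ) := by
  have c1 : Continuous φ := continuous_iff_continuousAt.2 fun θ => (h1 θ).continuousAt
  have c2 : Continuous φ' := continuous_iff_continuousAt.2 fun θ => (h2 θ).continuousAt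
  have hd (θ : ℝ) : HasDerivAt (fun θ => φ θ * (j * sin (j * θ)) + φ' θ * cos (j * θ))
      ((j : ℝ) ^ 2 * (φ θ * cos (j * θ)) + φ'' θ * cos (j * θ)) θ := by
    have e : HasDerivAt (fun θ : ℝ => (j : ℝ) * θ) j θ := by
      simpa using (hasDerivAt_id θ).const_mul (j : ℝ)
    exact HasDerivAt.congr_deriv (((h1 θ).mul ((e.sin).const_mul (j : ℝ))).add ((h2 θ).mul e.cos))
      (by ring)
  have key := integral_eq_sub_of_hasDerivAt (a := 0) (b := 2 * π) (fun θ _ => hd θ)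
    (Continuous.intervalIntegrable (by fun_prop) _ _)
  rw [integral_add (Continuous.intervalIntegrable (by fun_prop) _ _)
    (Continuous.intervalIntegrable (by fun_prop) _ _), intervalIntegral.integral_const_mul] at key
  have hs : sin ((j : ℝ) * (2 * π)) = 0 := by
    rw [show (j : ℝ) * (2 * π) = ((2 * j : ℤ) : ℝ) * π by push_cast; ring]; exact sin_int_mul_pi _
  have hc : cos ((j : ℝ) * (2 * π)) = 1 := cos_int_mul_two_pi j
  rw [hs, hc] at key
  simp only [mul_zero, sin_zero, cos_zero, mul_one, zero_add] at key
  linarith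

lemma hasDerivAt_lam (θ : ℝ) : HasDerivAt lam (cos (θ / 2)) θ := by
  have := (((hasDerivAt_id θ).div_const 2).sin).const_mul 2
  simp only [id] at this
  exact HasDerivAt.congr_deriv this (by ring)

/-- Two integrations by parts bound the kernel at infinity. -/
lemma sq_mul_abs_kern_le {σ σ' σ'' : ℝ → ℝ} (h1 : ∀ x, HasDerivAt σ (σ' x) x)
    (h2 : ∀ x, HasDerivAt σ' (σ'' x) x) (h3 : Continuous σ'') (j : ℤ) :
    (j : ℝ) ^ 2 * |kern σ j| ≤ (2 * π)⁻¹ * (2 * |σ' 0| +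
      ∫ θ in (0 : ℝ)..(2 * π), (|σ'' (lam θ)| + |σ' (lam θ)| * lam θ)) := by
  have c2 : Continuous σ' := continuous_iff_continuousAt.2 fun θ => (h2 θ).continuousAt
  have cl := continuous_lam
  set ψ : ℝ → ℝ := fun θ => σ'' (lam θ) * cos (θ / 2) * cos (θ / 2) +
    σ' (lam θ) * (-sin (θ / 2) * (1 / 2)) with hψ
  have cψ : Continuous ψ := by fun_prop
  have key := sq_mul_integral_mul_cos (φ := fun θ => σ (lam θ))
    (φ' := fun θ => σ' (lam θ) * cos (θ / 2)) (φ'' := ψ)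
    (fun θ => (h1 _).comp θ (hasDerivAt_lam θ))
    (fun θ => ((h2 _).comp θ (hasDerivAt_lam θ)).mul (((hasDerivAt_id θ).div_const 2).cos))
    cψ j
  have e0 : lam 0 = 0 := by simp [lam]
  have e1 : lam (2 * π) = 0 := by simp [lam]
  have e2 : cos (2 * π / 2) = -1 := by rw [mul_div_cancel_left₀ _ two_ne_zero, cos_pi]
  simp only [e0, e1, e2, zero_div, cos_zero] at key
  unfold kern
  rw [abs_mul, abs_of_pos (by positivity : 0 < (2 * π)⁻¹), mul_left_comm]
  gcongr
  rw [← abs_of_nonneg (sq_nonneg (j : ℝ)), ← abs_mul, key]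
  have hI : |∫ θ in (0 : ℝ)..(2 * π), ψ θ * cos (j * θ)| ≤
      ∫ θ in (0 : ℝ)..(2 * π), (|σ'' (lam θ)| + |σ' (lam θ)| * lam θ) := by
    refine (abs_integral_le_integral_abs (by positivity)).trans ?_
    refine integral_mono_on (by positivity) ?_ ?_ fun θ hθ => ?_
    · exact Continuous.intervalIntegrable (by fun_prop) _ _
    · exact Continuous.intervalIntegrable (by fun_prop) _ _
    rw [abs_mul]
    refine (mul_le_of_le_one_right (abs_nonneg _) (abs_cos_le_one _)).trans ?_
    refine (abs_add_le _ _).trans (add_le_add ?_ ?_)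
    · rw [abs_mul, abs_mul, mul_assoc]
      refine mul_le_of_le_one_right (abs_nonneg _) ?_
      exact mul_le_one₀ (abs_cos_le_one _) (abs_nonneg _) (abs_cos_le_one _)
    -- The second derivative of `lam` is `-lam / 4`. The factor `lam θ` is kept because, for a
    -- dilated symbol, `r |χ' (r λ)| λ` is then controlled by `x |χ' x|` alone.
    · rw [abs_mul]
      gcongr
      have h0 := (lam_mem hθ).1
      rw [show -sin (θ / 2) * (1 / 2) = -(lam θ / 4) by unfold lam; ring, abs_neg,
        abs_of_nonneg (by positivity)]
      linarith
  calc |σ' 0 * -1 - σ' 0 * 1 - ∫ θ in (0 : ℝ)..(2 * π), ψ θ * cos (j * θ)|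
      ≤ |σ' 0 * -1 - σ' 0 * 1| + |∫ θ in (0 : ℝ)..(2 * π), ψ θ * cos (j * θ)| := abs_sub _ _
    _ ≤ _ := by
        gcongr
        rw [show σ' 0 * -1 - σ' 0 * 1 = -(2 * σ' 0) by ring, abs_neg, abs_mul, abs_two]

/-- The kernel itself is at most `M`, and `j²` times it is at most `M / π + 3 M ≤ 4 M`, using `lam ≤
2`; the sum gives the constant 5. -/
lemma abs_kern_le_div {σ σ' σ'' : ℝ → ℝ} {M : ℝ} (h1 : ∀ x, HasDerivAt σ (σ' x) x)
    (h2 : ∀ x, HasDerivAt σ' (σ'' x) x) (h3 : Continuous σ'')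
    (b0 : ∀ x ∈ Set.Icc (0 : ℝ) 2, |σ x| ≤ M) (b1 : ∀ x ∈ Set.Icc (0 : ℝ) 2, |σ' x| ≤ M)
    (b2 : ∀ x ∈ Set.Icc (0 : ℝ) 2, |σ'' x| ≤ M) (j : ℤ) :
    |kern σ j| ≤ 5 * M / (1 + (j : ℝ) ^ 2) := by
  have c0 : Continuous σ := continuous_iff_continuousAt.2 fun θ => (h1 θ).continuousAt
  have c2 : Continuous σ' := continuous_iff_continuousAt.2 fun θ => (h2 θ).continuousAt
  have cl := continuous_lam
  have k0 := abs_kern_le_of_bound c0 b0 j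
  have k2 := sq_mul_abs_kern_le h1 h2 h3 j
  have hM : 0 ≤ M := (abs_nonneg _).trans (b0 0 (by simp))
  have hI : ∫ θ in (0 : ℝ)..(2 * π), (|σ'' (lam θ)| + |σ' (lam θ)| * lam θ) ≤
      ∫ θ in (0 : ℝ)..(2 * π), 3 * M := by
    refine integral_mono_on (by positivity) ?_ ?_ fun θ hθ => ?_
    · exact Continuous.intervalIntegrable (by fun_prop) _ _
    · exact Continuous.intervalIntegrable (by fun_prop) _ _
    · have hl := lam_mem hθ
      have := mul_le_mul (b1 _ hl) hl.2 hl.1 hM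
      linarith [b2 _ hl]
  simp only [intervalIntegral.integral_const, sub_zero, smul_eq_mul] at hI
  have hb := b1 0 (by simp)
  have hp : 3 < π := pi_gt_three
  have : (2 * π)⁻¹ * (2 * |σ' 0| + ∫ θ in (0 : ℝ)..(2 * π), (|σ'' (lam θ)| + |σ' (lam θ)| * lam θ))
      ≤ 4 * M := by
    rw [inv_mul_le_iff₀ (by positivity)]
    nlinarith
  rw [le_div_iff₀ (by positivity)]
  nlinarith

end DiscreteBesov

end

/-! ### Fourier inversion and products of symbols. -/

noncomputable section

namespace DiscreteBesov

open Real intervalIntegral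

/-- Kernels with quadratic decay. -/
def HasDecay (k : ℤ → ℝ) : Prop := ∃ C, 0 ≤ C ∧ ∀ j, |k j| ≤ C / (1 + (j : ℝ) ^ 2)

lemma summable_inv_one_add_sq : Summable fun j : ℤ => (1 + (j : ℝ) ^ 2)⁻¹ := by
  have h : Summable fun j : ℤ => 1 / (j : ℝ) ^ 2 :=
    Real.summable_one_div_int_pow.2 (by norm_num)
  have h' : Summable fun j : ℤ => (if j = 0 then (1 : ℝ) else 0) + 1 / (j : ℝ) ^ 2 := by
    refine Summable.add ?_ h
    exact summable_of_ne_finset_zero (s := {0}) (by intro b hb; simpa using hb)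
  refine h'.of_nonneg_of_le (fun j => by positivity) fun j => ?_
  by_cases hj : j = 0
  · simp [hj]
  · have : (j : ℝ) ≠ 0 := by exact_mod_cast hj
    simp only [hj, if_false, zero_add, one_div]
    exact inv_anti₀ (by positivity) (by linarith)

lemma HasDecay.summable {k : ℤ → ℝ} (h : HasDecay k) : Summable k := by
  obtain ⟨C, -, hC⟩ := h
  refine Summable.of_norm_bounded (summable_inv_one_add_sq.mul_left C) fun j => ?_
  exact hC j

/-- The reflection `θ ↦ 2π - θ` fixes `lam` and changes the sign of `sin (jθ)`; hence cosine
coefficients are the full Fourier coefficients. -/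
lemma integral_mul_sin_eq_zero (τ : ℝ → ℝ) (j : ℤ) :
    ∫ θ in (0 : ℝ)..(2 * π), τ (lam θ) * sin (j * θ) = 0 := by
  have h := intervalIntegral.integral_comp_sub_left (a := 0) (b := 2 * π)
    (fun θ => τ (lam θ) * sin (j * θ)) (2 * π)
  have e : ∀ θ, τ (lam (2 * π - θ)) * sin (j * (2 * π - θ)) = -(τ (lam θ) * sin (j * θ)) := by
    intro θ
    have e1 : lam (2 * π - θ) = lam θ := by
      unfold lam
      rw [show (2 * π - θ) / 2 = π - θ / 2 by ring, sin_pi_sub]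
    have e2 : sin (j * (2 * π - θ)) = -sin (j * θ) := by
      rw [show (j : ℝ) * (2 * π - θ) = j * (2 * π) - j * θ by ring, sin_int_mul_two_pi_sub]
    rw [e1, e2]; ring
  simp only [e, intervalIntegral.integral_neg, sub_self, sub_zero] at h
  linarith

/-- Fourier inversion for the kernels. -/
lemma hasSum_kern_mul_cos {τ : ℝ → ℝ} (hτ : Continuous τ) (hk : HasDecay (kern τ)) {θ : ℝ}
    (hθ : θ ∈ Set.Icc (0 : ℝ) (2 * π)) :
    HasSum (fun j : ℤ => kern τ j * cos (j * θ)) (τ (lam θ)) := by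
  have : Fact (0 < 2 * π) := ⟨by positivity⟩
  -- `lam` changes sign under translation by `2π`, but its absolute value is periodic and agrees
  -- with `lam` on `[0, 2π]`, so `τ |lam|` descends to the circle.
  have hper : Function.Periodic (fun x : ℝ => ((τ |lam x| : ℝ) : ℂ)) (2 * π) := by
    intro x
    have : lam (x + 2 * π) = -lam x := by
      unfold lam
      rw [show (x + 2 * π) / 2 = x / 2 + π by ring, sin_add_pi]; ring
    simp only [this, abs_neg]
  have hcont : Continuous hper.lift := by
    apply continuous_coinduced_dom.2
    have := continuous_lam
    change Continuous (fun x : ℝ => ((τ |lam x| : ℝ) : ℂ))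
    fun_prop
  let g : C(AddCircle (2 * π), ℂ) := ⟨hper.lift, hcont⟩
  have hg : ∀ x : ℝ, g (x : AddCircle (2 * π)) = ((τ |lam x| : ℝ) : ℂ) := fun x => hper.lift_coe x
  have hf : ∀ (n : ℤ) (x : ℝ), (fourier n (x : AddCircle (2 * π)) : ℂ) =
      (cos (n * x) : ℝ) + (sin (n * x) : ℝ) * Complex.I := by
    intro n x
    rw [fourier_coe_apply, show (2 * π * Complex.I * n * x / ((2 * π : ℝ) : ℂ) : ℂ) =
      ((n * x : ℝ) : ℂ) * Complex.I by
        push_cast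
        have : (π : ℂ) ≠ 0 := by exact_mod_cast pi_ne_zero
        field_simp, Complex.exp_mul_I]
    push_cast; ring
  have hcoef : ∀ n : ℤ, fourierCoeff g n = (kern τ n : ℂ) := by
    intro n
    rw [fourierCoeff_eq_intervalIntegral g n 0]
    have e : ∫ x in (0 : ℝ)..0 + 2 * π, (fourier (-n) (x : AddCircle (2 * π))) • g x =
        ∫ x in (0 : ℝ)..2 * π, (((τ (lam x) * cos (n * x) : ℝ) : ℂ) -
          ((τ (lam x) * sin (n * x) : ℝ) : ℂ) * Complex.I) := by
      rw [zero_add]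
      refine integral_congr fun x hx => ?_
      rw [Set.uIcc_of_le (by positivity)] at hx
      simp only [hf, hg, abs_of_nonneg (lam_mem hx).1, smul_eq_mul]
      push_cast
      simp only [neg_mul, Complex.cos_neg, Complex.sin_neg]
      ring
    have hl := continuous_lam
    rw [e, intervalIntegral.integral_sub (Continuous.intervalIntegrable (by fun_prop) _ _)
      (Continuous.intervalIntegrable (by fun_prop) _ _), intervalIntegral.integral_mul_const,
      intervalIntegral.integral_ofReal, intervalIntegral.integral_ofReal,
      integral_mul_sin_eq_zero]
    simp only [Complex.ofReal_zero, zero_mul, sub_zero, kern, one_div, Complex.real_smul]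
    push_cast; rfl
  have hs : Summable (fourierCoeff g) := by
    have : (fourierCoeff g) = fun n => ((kern τ n : ℝ) : ℂ) := funext hcoef
    rw [this]
    exact_mod_cast hk.summable
  have key := has_pointwise_sum_fourier_series_of_summable hs (θ : AddCircle (2 * π))
  have key2 := Complex.hasSum_re key
  simp only [hcoef, hf, hg, abs_of_nonneg (lam_mem hθ).1] at key2
  simpa only [smul_eq_mul, Complex.re_ofReal_mul, Complex.add_re, Complex.ofReal_re,
    Complex.mul_re, Complex.ofReal_im, Complex.I_re, Complex.I_im, mul_zero, zero_mul, sub_zero,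
    add_zero] using key2

lemma abs_mul_cos_le (a x : ℝ) : |a * cos x| ≤ |a| := by
  rw [abs_mul]; exact mul_le_of_le_one_right (abs_nonneg _) (abs_cos_le_one _)

/-- Products of symbols correspond to convolutions of kernels. -/
lemma hasSum_kern_mul {σ τ : ℝ → ℝ} (hσ : Continuous σ) (hτ : Continuous τ)
    (hk : HasDecay (kern τ)) (n : ℤ) :
    HasSum (fun j : ℤ => kern σ (n - j) * kern τ j) (kern (fun x => σ x * τ x) n) := by
  have hl := continuous_lam
  obtain ⟨M, hM⟩ := isCompact_Icc.exists_bound_of_continuousOn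
    (s := Set.Icc (0 : ℝ) (2 * π)) (f := fun θ => σ (lam θ)) (by fun_prop)
  have hsum : HasSum (fun j : ℤ => ∫ θ in (0 : ℝ)..(2 * π),
      σ (lam θ) * cos (n * θ) * (kern τ j * cos (j * θ)))
      (∫ θ in (0 : ℝ)..(2 * π), σ (lam θ) * cos (n * θ) * τ (lam θ)) := by
    refine intervalIntegral.hasSum_integral_of_dominated_convergence
      (fun j _ => M * |kern τ j|) ?_ ?_ ?_ ?_ ?_
    · intro j
      exact Continuous.aestronglyMeasurable (by fun_prop)
    · intro j
      refine Filter.Eventually.of_forall fun θ hθ => ?_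
      rw [Set.uIoc_of_le (by positivity)] at hθ
      have := hM θ ⟨hθ.1.le, hθ.2⟩
      rw [norm_mul]
      refine mul_le_mul ((abs_mul_cos_le _ _).trans this) (abs_mul_cos_le _ _) (norm_nonneg _)
        ((norm_nonneg _).trans this)
    · exact Filter.Eventually.of_forall fun θ _ => (hk.summable.abs).mul_left M
    · exact _root_.intervalIntegrable_const
    · refine Filter.Eventually.of_forall fun θ hθ => ?_
      rw [Set.uIoc_of_le (by positivity)] at hθ
      exact (hasSum_kern_mul_cos hτ hk ⟨hθ.1.le, hθ.2⟩).mul_left _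
  have hsum2 := hsum.mul_left (2 * π)⁻¹
  have e1 : (2 * π)⁻¹ * ∫ θ in (0 : ℝ)..(2 * π), σ (lam θ) * cos (n * θ) * τ (lam θ) =
      kern (fun x => σ x * τ x) n := by
    unfold kern
    congr 1
    exact integral_congr fun θ _ => by ring
  -- The product-to-sum formula yields the mean of the terms at `n - j` and `n + j`; as `kern τ` is
  -- even, both have the same sum over `j`.
  have e2 : ∀ j : ℤ, (2 * π)⁻¹ * ∫ θ in (0 : ℝ)..(2 * π),
      σ (lam θ) * cos (n * θ) * (kern τ j * cos (j * θ)) =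
      (kern σ (n - j) * kern τ j) / 2 + (kern σ (n + j) * kern τ j) / 2 := by
    intro j
    have : ∀ θ : ℝ, σ (lam θ) * cos (n * θ) * (kern τ j * cos (j * θ)) =
        (kern τ j / 2) * (σ (lam θ) * cos ((n - j : ℤ) * θ)) +
        (kern τ j / 2) * (σ (lam θ) * cos ((n + j : ℤ) * θ)) := by
      intro θ
      push_cast
      rw [sub_mul, add_mul, cos_sub, cos_add]; ring
    simp only [this]
    rw [intervalIntegral.integral_add (Continuous.intervalIntegrable (by fun_prop) _ _)
      (Continuous.intervalIntegrable (by fun_prop) _ _),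
      intervalIntegral.integral_const_mul, intervalIntegral.integral_const_mul]
    simp only [kern]
    ring
  rw [e1] at hsum2
  simp only [e2] at hsum2
  have hb : ∀ j : ℤ, |kern σ j| ≤ M := by
    intro j
    -- `M` bounds `σ` only at the values of `lam`. Truncating `σ` to `[-M, M]` does not change the
    -- kernel and gives the bound at every point.
    have e : kern σ j = kern (fun x => max (-M) (min M (σ x))) j := by
      unfold kern
      congr 1
      refine integral_congr fun θ hθ => ?_
      rw [Set.uIcc_of_le (by positivity)] at hθ
      have := abs_le.1 (hM θ hθ)
      simp only [min_eq_right this.2, max_eq_right this.1]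
    rw [e]
    refine abs_kern_le_of_bound (by fun_prop) (fun x _ => ?_) j
    have hM0 : 0 ≤ M := (norm_nonneg _).trans (hM 0 (by simp; positivity))
    exact abs_le.2 ⟨le_max_left _ _, max_le (by linarith) (min_le_left _ _)⟩
  have s1 : ∀ φ : ℤ → ℤ, Summable fun j : ℤ => kern σ (φ j) * kern τ j := by
    intro φ
    refine Summable.of_norm_bounded (hk.summable.abs.mul_left M) fun j => ?_
    rw [norm_mul]
    exact mul_le_mul_of_nonneg_right (hb _) (norm_nonneg _)
  have s2 : ∑' j : ℤ, kern σ (n + j) * kern τ j = ∑' j : ℤ, kern σ (n - j) * kern τ j := by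
    rw [← (Equiv.neg ℤ).tsum_eq fun j : ℤ => kern σ (n + j) * kern τ j]
    refine tsum_congr fun j => ?_
    simp only [Equiv.neg_apply, kern_neg_index, sub_eq_add_neg]
  have hs1 := s1 (fun j => n - j)
  have hs2 := s1 (fun j => n + j)
  have := (hs1.hasSum.div_const 2).add (hs2.hasSum.div_const 2)
  have heq := hsum2.unique this
  rw [s2, add_halves] at heq
  rw [heq]
  exact hs1.hasSum

/-- Fourier inversion at `θ = 0`. It computes the `ℓ¹` norm of a nonnegative kernel, which is how
the semigroups are seen to be contractions. -/
lemma tsum_kern {σ : ℝ → ℝ} (hσ : Continuous σ) (hk : HasDecay (kern σ)) :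
    ∑' j : ℤ, kern σ j = σ 0 := by
  have := hasSum_kern_mul_cos hσ hk (θ := 0) (by simp; positivity)
  simpa [lam] using this.tsum_eq

lemma integral_cos_int_mul (j : ℤ) :
    ∫ θ in (0 : ℝ)..(2 * π), cos (j * θ) = if j = 0 then 2 * π else 0 := by
  split_ifs with h
  · simp [h]
  · have hj : (j : ℝ) ≠ 0 := by exact_mod_cast h
    rw [intervalIntegral.integral_comp_mul_left (fun x => cos x) hj, integral_cos]
    have hs : sin ((j : ℝ) * (2 * π)) = 0 := by
      rw [show (j : ℝ) * (2 * π) = ((2 * j : ℤ) : ℝ) * π by push_cast; ring]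
      exact sin_int_mul_pi _
    simp [hs]

lemma kern_one (j : ℤ) : kern (fun _ => 1) j = if j = 0 then 1 else 0 := by
  unfold kern
  simp only [one_mul, integral_cos_int_mul]
  have hp := pi_ne_zero
  split_ifs
  · field_simp
  · simp

lemma kern_neg_sq (j : ℤ) : kern (fun x => -x ^ 2) j =
    (if j = -1 then 1 else 0) + (if j = 1 then 1 else 0) - 2 * if j = 0 then 1 else 0 := by
  unfold kern
  have : ∀ θ : ℝ, -lam θ ^ 2 * cos (j * θ) =
      cos ((j + 1 : ℤ) * θ) + cos ((j - 1 : ℤ) * θ) - 2 * cos (j * θ) := by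
    intro θ
    rw [lam_sq]
    push_cast
    rw [sub_mul, add_mul, cos_add, cos_sub, one_mul]; ring
  simp only [this]
  rw [intervalIntegral.integral_sub (Continuous.intervalIntegrable (by fun_prop) _ _)
      (Continuous.intervalIntegrable (by fun_prop) _ _),
      intervalIntegral.integral_add (Continuous.intervalIntegrable (by fun_prop) _ _)
      (Continuous.intervalIntegrable (by fun_prop) _ _),
      intervalIntegral.integral_const_mul, integral_cos_int_mul, integral_cos_int_mul,
      integral_cos_int_mul]
  have hp := pi_ne_zero
  have h1 : (j + 1 = 0) ↔ j = -1 := by omega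
  have h2 : (j - 1 = 0) ↔ j = 1 := by omega
  simp only [h1, h2]
  split_ifs <;> first | omega | (field_simp; try ring)

end DiscreteBesov

end

noncomputable section

namespace DiscreteBesov

open Real intervalIntegral Filter Topology

/-! ### The heat and Poisson kernels in terms of the spectral parameter -/

lemma hasSum_mul_of_summable_norm {f g : ℕ → ℂ} {a b : ℂ} (hf : HasSum f a) (hg : HasSum g b)
    (hf' : Summable fun n => ‖f n‖) (hg' : Summable fun n => ‖g n‖) :
    HasSum (fun x : ℕ × ℕ => f x.1 * g x.2) (a * b) := by
  rw [← hf.tsum_eq, ← hg.tsum_eq, tsum_mul_tsum_of_summable_norm hf' hg']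
  exact (summable_mul_of_summable_norm hf' hg').hasSum

lemma hasSum_exp_mul_exp (z w : ℂ) :
    HasSum (fun x : ℕ × ℕ => z ^ x.1 / (x.1.factorial : ℂ) * (w ^ x.2 / (x.2.factorial : ℂ)))
      (Complex.exp z * Complex.exp w) := by
  have h0 (z : ℂ) : Summable fun n : ℕ => ‖z ^ n / (n.factorial : ℂ)‖ :=
    NormedSpace.norm_expSeries_div_summable z
  have h1 (z : ℂ) : HasSum (fun n : ℕ => z ^ n / (n.factorial : ℂ)) (Complex.exp z) := by
    rw [Complex.exp_eq_exp_ℂ]; exact NormedSpace.expSeries_div_hasSum_exp z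
  exact hasSum_mul_of_summable_norm (f := fun n : ℕ => z ^ n / (n.factorial : ℂ))
    (g := fun n : ℕ => w ^ n / (n.factorial : ℂ)) (h1 z) (h1 w) (h0 z) (h0 w)

/-- The real part of the product of the exponential series of `t e^{iθ}` and `t e^{-iθ}`: the
generating function of the Bessel functions before collecting diagonals. -/
lemma hasSum_pow_div_factorial_mul_cos (t θ : ℝ) :
    HasSum (fun x : ℕ × ℕ => t ^ x.1 / (x.1.factorial : ℝ) * (t ^ x.2 / (x.2.factorial : ℝ)) *
      cos (((x.1 : ℤ) - (x.2 : ℤ) : ℤ) * θ)) (exp (2 * t * cos θ)) := by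
  set z := (t : ℂ) * Complex.exp (θ * Complex.I) with hz
  set w := (t : ℂ) * Complex.exp (-(θ * Complex.I)) with hw
  have h2 := hasSum_exp_mul_exp z w
  have e1 : Complex.exp z * Complex.exp w = ((exp (2 * t * cos θ) : ℝ) : ℂ) := by
    rw [← Complex.exp_add, hz, hw, ← mul_add]
    push_cast
    rw [Complex.cos]
    congr 1
    ring_nf
  have e2 : ∀ x : ℕ × ℕ, z ^ x.1 / (x.1.factorial : ℂ) * (w ^ x.2 / (x.2.factorial : ℂ)) =
      ((t ^ x.1 / (x.1.factorial : ℝ) * (t ^ x.2 / (x.2.factorial : ℝ)) : ℝ) : ℂ) *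
      Complex.exp ((((x.1 : ℤ) - (x.2 : ℤ) : ℤ) * θ : ℝ) * Complex.I) := by
    intro x
    rw [hz, hw, mul_pow, mul_pow, ← Complex.exp_nat_mul, ← Complex.exp_nat_mul]
    have : Complex.exp ((((x.1 : ℤ) - (x.2 : ℤ) : ℤ) * θ : ℝ) * Complex.I) =
        Complex.exp (x.1 * (θ * Complex.I)) * Complex.exp (x.2 * -(θ * Complex.I)) := by
      rw [← Complex.exp_add]; congr 1; push_cast; ring
    rw [this]
    push_cast; ring
  rw [e1] at h2
  have h3 := Complex.hasSum_re h2
  rw [Complex.ofReal_re] at h3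
  refine h3.congr_fun fun x => ?_
  rw [e2, Complex.re_ofReal_mul, Complex.exp_ofReal_mul_I_re]

/-- The diagonal `a - b = n` is parametrised by `(m + n, m)`, and its terms are those of the Bessel
series. -/
lemma hasSum_bessel_diag (n : ℕ) (t s : ℝ)
    (h : HasSum (fun x : ℕ × ℕ => t ^ x.1 / (x.1.factorial : ℝ) * (t ^ x.2 / (x.2.factorial : ℝ)) *
      (if (x.1 : ℤ) - (x.2 : ℤ) = n then 1 else 0)) s) : besselI n (2 * t) = s := by
  have hinj : Function.Injective fun m : ℕ => (m + n, m) := by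
    intro a b hab; simpa using congrArg Prod.snd hab
  rw [← hinj.hasSum_iff] at h
  · rw [← h.tsum_eq]
    unfold besselI
    refine tsum_congr fun m => ?_
    simp only [Function.comp, Nat.cast_add, add_sub_cancel_left, if_true, Int.natAbs_natCast]
    rw [mul_div_cancel_left₀ _ two_ne_zero]
    field_simp
    ring
  · rintro ⟨a, b⟩ hab
    rw [if_neg, mul_zero]
    intro hc
    refine hab ⟨b, ?_⟩
    simp only [Prod.mk.injEq, and_true]
    simp only at hc
    omega

lemma besselI_neg (n : ℤ) (t : ℝ) : besselI (-n) t = besselI n t := by simp [besselI]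

lemma integral_cos_mul_cos (k : ℤ) (n : ℕ) :
    (2 * π)⁻¹ * ∫ θ in (0 : ℝ)..(2 * π), cos (k * θ) * cos ((n : ℤ) * θ) =
      ((if k = n then 1 else 0) + (if -k = n then 1 else 0)) / 2 := by
  have : ∀ θ : ℝ, cos (k * θ) * cos ((n : ℤ) * θ) =
      2⁻¹ * cos ((k - n : ℤ) * θ) + 2⁻¹ * cos ((k + n : ℤ) * θ) := by
    intro θ
    push_cast
    rw [sub_mul, add_mul, cos_sub, cos_add]; ring
  simp only [this]
  rw [intervalIntegral.integral_add (Continuous.intervalIntegrable (by fun_prop) _ _)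
    (Continuous.intervalIntegrable (by fun_prop) _ _), intervalIntegral.integral_const_mul,
    intervalIntegral.integral_const_mul, integral_cos_int_mul, integral_cos_int_mul]
  have hp := pi_ne_zero
  have h1 : k - n = 0 ↔ k = n := by omega
  have h2 : k + n = 0 ↔ -k = n := by omega
  simp only [h1, h2]
  split_ifs <;> field_simp <;> norm_num

/-- Integrating the double series against `cos (nθ)` leaves, by orthogonality, the diagonals `a - b
= n` and `b - a = n`, each with weight one half. Swapping the coordinates shows that they contribute
equally, also when `n = 0` and they coincide. -/
lemma besselI_eq_integral (n : ℕ) (t : ℝ) :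
    besselI n (2 * t) = (2 * π)⁻¹ * ∫ θ in (0 : ℝ)..(2 * π),
      exp (2 * t * cos θ) * cos ((n : ℤ) * θ) := by
  set c : ℕ × ℕ → ℝ := fun x => t ^ x.1 / (x.1.factorial : ℝ) * (t ^ x.2 / (x.2.factorial : ℝ))
    with hc
  have hcs : Summable fun x => |c x| := by
    have h1 : Summable fun n : ℕ => ‖t ^ n / (n.factorial : ℝ)‖ :=
      NormedSpace.norm_expSeries_div_summable t
    have := h1.mul_of_nonneg h1 (fun _ => norm_nonneg _) (fun _ => norm_nonneg _)
    refine this.congr fun x => ?_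
    rw [hc, ← norm_mul, Real.norm_eq_abs]
  have hs : HasSum (fun x : ℕ × ℕ => ∫ θ in (0 : ℝ)..(2 * π),
      c x * cos (((x.1 : ℤ) - (x.2 : ℤ) : ℤ) * θ) * cos ((n : ℤ) * θ))
      (∫ θ in (0 : ℝ)..(2 * π), exp (2 * t * cos θ) * cos ((n : ℤ) * θ)) := by
    refine intervalIntegral.hasSum_integral_of_dominated_convergence (fun x _ => |c x|) ?_ ?_ ?_ ?_ ?_
    · intro x
      exact Continuous.aestronglyMeasurable (by fun_prop)
    · intro x
      refine Eventually.of_forall fun θ _ => ?_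
      rw [Real.norm_eq_abs]
      exact (abs_mul_cos_le _ _).trans (abs_mul_cos_le _ _)
    · exact Eventually.of_forall fun θ _ => hcs
    · exact _root_.intervalIntegrable_const
    · exact Eventually.of_forall fun θ _ => (hasSum_pow_div_factorial_mul_cos t θ).mul_right _
  have hs2 := hs.mul_left (2 * π)⁻¹
  have e : ∀ x : ℕ × ℕ, (2 * π)⁻¹ * ∫ θ in (0 : ℝ)..(2 * π),
      c x * cos (((x.1 : ℤ) - (x.2 : ℤ) : ℤ) * θ) * cos ((n : ℤ) * θ) =
      (c x * (if (x.1 : ℤ) - (x.2 : ℤ) = n then 1 else 0) +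
      c x * (if (x.2 : ℤ) - (x.1 : ℤ) = n then 1 else 0)) / 2 := by
    intro x
    simp only [mul_assoc (c x), intervalIntegral.integral_const_mul]
    rw [mul_left_comm, integral_cos_mul_cos, neg_sub]
    ring
  simp only [e] at hs2
  have hsum : Summable fun x : ℕ × ℕ => c x * (if (x.1 : ℤ) - (x.2 : ℤ) = n then 1 else 0) := by
    refine Summable.of_norm_bounded hcs fun x => ?_
    rw [norm_mul]
    refine mul_le_of_le_one_right (norm_nonneg _) ?_
    split_ifs <;> simp
  have hb := hasSum_bessel_diag n t _ hsum.hasSum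
  have h1 := hsum.hasSum
  rw [← hb] at h1
  have h2 := (Equiv.prodComm ℕ ℕ).hasSum_iff.2 h1
  have h3 : HasSum (fun x : ℕ × ℕ => c x * (if (x.2 : ℤ) - (x.1 : ℤ) = n then 1 else 0))
      (besselI n (2 * t)) := by
    refine h2.congr_fun fun x => ?_
    simp only [Function.comp, Equiv.prodComm_apply, Prod.fst_swap, Prod.snd_swap, hc]
    congr 1
    ring
  have h4 := (h1.add h3).div_const 2
  rw [add_self_div_two] at h4
  exact h4.unique hs2

lemma heatKernel_eq_kern (t : ℝ) (j : ℤ) :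
    heatKernel t j = kern (fun x => exp (-(t * x ^ 2))) j := by
  have key (n : ℕ) : heatKernel t n = kern (fun x => exp (-(t * x ^ 2))) n := by
    unfold heatKernel kern
    rw [besselI_eq_integral, mul_left_comm, ← intervalIntegral.integral_const_mul]
    congr 1
    refine integral_congr fun θ _ => ?_
    simp only [lam_sq]
    rw [← mul_assoc, ← exp_add]
    congr 2
    ring
  obtain ⟨n, rfl | rfl⟩ := j.eq_nat_or_neg
  · exact key n
  · rw [kern_neg_index, ← key, heatKernel, besselI_neg, heatKernel]

lemma besselI_nonneg (n : ℤ) {t : ℝ} (ht : 0 ≤ t) : 0 ≤ besselI n t :=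
  tsum_nonneg fun m => by positivity

/-- Positivity is read off from the Bessel series; it is not visible in the Fourier integral. The
contraction property of both semigroups rests on it. -/
lemma heatKernel_nonneg {t : ℝ} (ht : 0 ≤ t) (j : ℤ) : 0 ≤ heatKernel t j :=
  mul_nonneg (exp_pos _).le (besselI_nonneg _ (by linarith))

/-- The subordination density of the Poisson semigroup. -/
def subDensity (y t : ℝ) : ℝ :=
  y / (2 * √π) * (exp (-(y ^ 2 / (4 * t))) / t ^ (3 / 2 : ℝ))

lemma subDensity_nonneg {y t : ℝ} (hy : 0 ≤ y) (ht : 0 ≤ t) : 0 ≤ subDensity y t := by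
  unfold subDensity; positivity

/-- The primitive of the Gaussian. -/
def gaussPrim (x : ℝ) : ℝ := ∫ u in (0 : ℝ)..x, exp (-u ^ 2)

lemma hasDerivAt_gaussPrim (x : ℝ) : HasDerivAt gaussPrim (exp (-x ^ 2)) x :=
  integral_hasDerivAt_right (Continuous.intervalIntegrable (by fun_prop) _ _)
    (Continuous.stronglyMeasurableAtFilter (by fun_prop) _ _)
    (Continuous.continuousAt (by fun_prop))

lemma gaussPrim_neg (x : ℝ) : gaussPrim (-x) = -gaussPrim x := by
  unfold gaussPrim
  have := intervalIntegral.integral_comp_neg (a := 0) (b := x) (fun u => exp (-u ^ 2))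
  simp only [even_two, Even.neg_pow, neg_zero] at this
  rw [this, intervalIntegral.integral_symm]

lemma tendsto_gaussPrim_atTop : Tendsto gaussPrim atTop (𝓝 (√π / 2)) := by
  have h1 := integral_gaussian_Ioi 1
  have h2 : IntegrableOn (fun x : ℝ => exp (-x ^ 2)) (Set.Ioi 0) := by
    simpa using (integrable_exp_neg_mul_sq (b := 1) one_pos).integrableOn (s := Set.Ioi 0)
  have := intervalIntegral_tendsto_integral_Ioi 0 h2 tendsto_id
  simp only [neg_mul, one_mul, div_one] at h1
  rwa [h1] at this

lemma tendsto_gaussPrim_atBot : Tendsto gaussPrim atBot (𝓝 (-(√π / 2))) := by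
  have := (tendsto_gaussPrim_atTop.comp tendsto_neg_atBot_atTop).neg
  refine this.congr fun x => ?_
  simp [gaussPrim_neg]

end DiscreteBesov

end

/-! ### Subordination: the Laplace transform of the density. -/

noncomputable section

namespace DiscreteBesov

open Real intervalIntegral Filter Topology

lemma rpow_three_halves {t : ℝ} (ht : 0 < t) : t ^ (3 / 2 : ℝ) = t * √t := by
  rw [show (3 / 2 : ℝ) = 1 + 1 / 2 by norm_num, rpow_add ht, rpow_one, sqrt_eq_rpow]

/-- Completing the square, `y² / (4t) + t l² = (l√t ∓ y / (2√t))² ± l y`. With the factor `e^{2ly}`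
both terms have the same Gaussian in their derivative, so the parts `l / (2√t)` of the inner
derivatives cancel and only the multiple of `t^{-3/2}` survives. -/
lemma hasDerivAt_gaussPrim_sub {y l t : ℝ} (ht : 0 < t) :
    HasDerivAt (fun t => gaussPrim (l * √t - y / 2 * (√t)⁻¹) -
      exp (2 * l * y) * gaussPrim (l * √t + y / 2 * (√t)⁻¹))
      (√π * exp (y * l) * (subDensity y t * exp (-(t * l ^ 2)))) t := by
  have hs : 0 < √t := sqrt_pos.2 ht
  have hd : HasDerivAt (fun t => √t) (1 / (2 * √t)) t := hasDerivAt_sqrt ht.ne'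
  have hi := hd.inv hs.ne'
  have h1 := (hasDerivAt_gaussPrim (l * √t - y / 2 * (√t)⁻¹)).comp t
    ((hd.const_mul l).sub (hi.const_mul (y / 2)))
  have h2 := (hasDerivAt_gaussPrim (l * √t + y / 2 * (√t)⁻¹)).comp t
    ((hd.const_mul l).add (hi.const_mul (y / 2)))
  refine HasDerivAt.congr_deriv (h1.sub (h2.const_mul (exp (2 * l * y)))) ?_
  have e2 : exp (2 * l * y) * exp (-(l * √t + y / 2 * (√t)⁻¹) ^ 2) =
      exp (-(l * √t - y / 2 * (√t)⁻¹) ^ 2) := by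
    rw [← exp_add]; congr 1; field_simp; ring
  have e1 : exp (-(l * √t - y / 2 * (√t)⁻¹) ^ 2) =
      exp (y * l) * (exp (-(y ^ 2 / (4 * t))) * exp (-(t * l ^ 2))) := by
    rw [← exp_add, ← exp_add]
    congr 1
    conv_rhs => rw [← sq_sqrt ht.le]
    field_simp
    ring
  rw [← mul_assoc (exp (2 * l * y)), e2, e1, subDensity, rpow_three_halves ht]
  have hp : 0 < √π := sqrt_pos.2 pi_pos
  have ht' : t = √t ^ 2 := (sq_sqrt ht.le).symm
  set s := √t
  simp only [ht']
  field_simp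
  ring

lemma tendsto_gaussPrim_sub_atTop {y l : ℝ} (hl : 0 ≤ l) :
    Tendsto (fun t => gaussPrim (l * √t - y / 2 * (√t)⁻¹) -
      exp (2 * l * y) * gaussPrim (l * √t + y / 2 * (√t)⁻¹)) atTop
      (𝓝 (√π / 2 - exp (2 * l * y) * (√π / 2))) := by
  have hinv : Tendsto (fun t => y / 2 * (√t)⁻¹) atTop (𝓝 0) := by
    simpa using (tendsto_inv_atTop_zero.comp tendsto_sqrt_atTop).const_mul (y / 2)
  -- For `l = 0` the arguments tend to `0` instead of infinity, but the asserted limit is then `0`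
  -- as well.
  rcases hl.eq_or_lt with rfl | hl
  · have hc : Continuous gaussPrim :=
      continuous_iff_continuousAt.2 fun x => (hasDerivAt_gaussPrim x).continuousAt
    have e0 : gaussPrim 0 = 0 := by simp [gaussPrim]
    have h1 := (hc.tendsto (-0)).comp hinv.neg
    have h2 := (hc.tendsto 0).comp hinv
    simpa [Function.comp_def, e0] using h1.sub h2
  · have hm : Tendsto (fun t => l * √t) atTop atTop := tendsto_sqrt_atTop.const_mul_atTop hl
    have h1 := tendsto_gaussPrim_atTop.comp (hm.atTop_add hinv.neg)
    have h2 := tendsto_gaussPrim_atTop.comp (hm.atTop_add hinv)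
    simpa [Function.comp_def, sub_eq_add_neg] using h1.sub (h2.const_mul (exp (2 * l * y)))

lemma tendsto_gaussPrim_sub_zero {y l : ℝ} (hy : 0 < y) :
    Tendsto (fun t => gaussPrim (l * √t - y / 2 * (√t)⁻¹) -
      exp (2 * l * y) * gaussPrim (l * √t + y / 2 * (√t)⁻¹)) (𝓝[>] 0)
      (𝓝 (-(√π / 2) - exp (2 * l * y) * (√π / 2))) := by
  have h0 : Tendsto (fun t => √t) (𝓝[>] (0 : ℝ)) (𝓝[>] 0) := by
    refine tendsto_nhdsWithin_iff.2 ⟨?_, ?_⟩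
    · have := (continuous_sqrt.tendsto 0).mono_left (nhdsWithin_le_nhds (s := Set.Ioi 0))
      simpa using this
    · filter_upwards [self_mem_nhdsWithin] with t ht using sqrt_pos.2 ht
  have hinv : Tendsto (fun t => y / 2 * (√t)⁻¹) (𝓝[>] 0) atTop :=
    (tendsto_inv_nhdsGT_zero.comp h0).const_mul_atTop (by positivity)
  have hm : Tendsto (fun t => l * √t) (𝓝[>] 0) (𝓝 0) := by
    simpa using (tendsto_nhdsWithin_iff.1 h0).1.const_mul l
  have h1 := tendsto_gaussPrim_atBot.comp (hm.add_atBot (tendsto_neg_atTop_atBot.comp hinv))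
  have h2 := tendsto_gaussPrim_atTop.comp (hm.add_atTop hinv)
  simpa [Function.comp_def, sub_eq_add_neg] using h1.sub (h2.const_mul (exp (2 * l * y)))

/-- The Laplace transform of the subordination density. -/
lemma integral_subDensity_mul_exp {y l : ℝ} (hy : 0 < y) (hl : 0 ≤ l) :
    IntegrableOn (fun t => subDensity y t * exp (-(t * l ^ 2))) (Set.Ioi 0) ∧
    ∫ t in Set.Ioi (0 : ℝ), subDensity y t * exp (-(t * l ^ 2)) = exp (-(y * l)) := by
  set g : ℝ → ℝ := fun t => gaussPrim (l * √t - y / 2 * (√t)⁻¹) -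
      exp (2 * l * y) * gaussPrim (l * √t + y / 2 * (√t)⁻¹) with hg
  -- The primitive is given its right limit at `0`, since the fundamental theorem on `(0, ∞)` needs
  -- continuity at the left endpoint. The two limits differ by `√π`, whatever `l` is.
  set G := Function.update g 0 (-(√π / 2) - exp (2 * l * y) * (√π / 2)) with hG
  have hc : ContinuousWithinAt G (Set.Ici 0) 0 := by
    rw [hG, continuousWithinAt_update_same, Set.Ici_sdiff_left]
    exact tendsto_gaussPrim_sub_zero hy
  have hGg : ∀ t ∈ Set.Ioi (0 : ℝ), G =ᶠ[𝓝 t] g := by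
    intro t ht
    filter_upwards [Ioi_mem_nhds ht] with s hs
    exact Function.update_of_ne (ne_of_gt hs) _ _
  have hd : ∀ t ∈ Set.Ioi (0 : ℝ), HasDerivAt G
      (√π * exp (y * l) * (subDensity y t * exp (-(t * l ^ 2)))) t := fun t ht =>
    (hasDerivAt_gaussPrim_sub ht).congr_of_eventuallyEq (hGg t ht)
  have hpos : ∀ t ∈ Set.Ioi (0 : ℝ),
      0 ≤ √π * exp (y * l) * (subDensity y t * exp (-(t * l ^ 2))) := fun t ht => by
    have := subDensity_nonneg hy.le (le_of_lt ht)
    positivity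
  have hlim : Tendsto G atTop (𝓝 (√π / 2 - exp (2 * l * y) * (√π / 2))) := by
    refine (tendsto_gaussPrim_sub_atTop hl).congr' ?_
    filter_upwards [eventually_gt_atTop 0] with s hs
    exact (Function.update_of_ne (f := g) (ne_of_gt hs) _).symm
  have hint := integrableOn_Ioi_deriv_of_nonneg hc hd hpos hlim
  have hval := integral_Ioi_of_hasDerivAt_of_nonneg hc hd hpos hlim
  have hp : 0 < √π := sqrt_pos.2 pi_pos
  have hne : √π * exp (y * l) ≠ 0 := by positivity
  constructor
  · have := hint.const_mul (√π * exp (y * l))⁻¹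
    refine this.congr ?_
    exact Eventually.of_forall fun t => by simp only [inv_mul_cancel_left₀ hne]
  · rw [MeasureTheory.integral_const_mul] at hval
    have e : G 0 = -(√π / 2) - exp (2 * l * y) * (√π / 2) := Function.update_self _ _ _
    rw [e] at hval
    apply mul_left_cancel₀ hne
    rw [hval, mul_assoc (√π), ← exp_add (y * l), add_neg_cancel, exp_zero]
    ring

lemma integrableOn_subDensity {y : ℝ} (hy : 0 < y) : IntegrableOn (subDensity y) (Set.Ioi 0) := by
  simpa using (integral_subDensity_mul_exp hy le_rfl).1

lemma measurable_subDensity (y : ℝ) : Measurable (subDensity y) := by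
  unfold subDensity; fun_prop

/-- Subordination at the level of kernels. -/
lemma integral_subDensity_mul_heatKernel {y : ℝ} (hy : 0 < y) (j : ℤ) :
    ∫ t in Set.Ioi (0 : ℝ), subDensity y t * heatKernel t j = kern (fun x => exp (-(y * x))) j := by
  have hl := continuous_lam
  have hm := measurable_subDensity y
  simp only [heatKernel_eq_kern]
  unfold kern
  simp only [mul_left_comm _ (2 * π)⁻¹, MeasureTheory.integral_const_mul]
  congr 1
  simp only [intervalIntegral.integral_of_le two_pi_pos.le, ← MeasureTheory.integral_const_mul]
  rw [integral_integral_swap]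
  · refine setIntegral_congr_fun measurableSet_Ioc fun θ hθ => ?_
    simp only [← mul_assoc, MeasureTheory.integral_mul_const]
    rw [(integral_subDensity_mul_exp hy (lam_mem ⟨hθ.1.le, hθ.2⟩).1).2]
  · have hb : Integrable (fun z : ℝ × ℝ => subDensity y z.1 * (1 : ℝ))
        ((volume.restrict (Set.Ioi 0)).prod (volume.restrict (Set.Ioc 0 (2 * π)))) :=
      Integrable.mul_prod (integrableOn_subDensity hy) (integrable_const 1)
    refine hb.mono' ?_ ?_
    · apply Measurable.aestronglyMeasurable
      unfold Function.uncurry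
      fun_prop
    · rw [Measure.prod_restrict]
      refine (ae_restrict_iff' (measurableSet_Ioi.prod measurableSet_Ioc)).2
        (Eventually.of_forall fun z hz => ?_)
      have h1 : 0 < z.1 := hz.1
      simp only [Function.uncurry, norm_mul, Real.norm_eq_abs,
        abs_of_nonneg (subDensity_nonneg hy.le h1.le)]
      refine mul_le_mul_of_nonneg_left ?_ (subDensity_nonneg hy.le h1.le)
      refine mul_le_one₀ ?_ (abs_nonneg _) (abs_cos_le_one _)
      rw [abs_of_pos (exp_pos _), exp_le_one_iff]
      have := mul_nonneg h1.le (sq_nonneg (lam z.2))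
      linarith

end DiscreteBesov

end

noncomputable section

namespace DiscreteBesov

open Real Filter Topology

/-! ### Convolution operators on functions of moderate growth -/

/-- The weight `1 / (1 + n²)`. -/
def wt (n : ℤ) : ℝ := (1 + (n : ℝ) ^ 2)⁻¹

lemma wt_pos (n : ℤ) : 0 < wt n := by unfold wt; positivity

lemma wt_neg (n : ℤ) : wt (-n) = wt n := by simp [wt]

lemma summable_wt : Summable wt := summable_inv_one_add_sq

lemma summabilityCondition_iff {f : ℤ → ℝ} :
    SummabilityCondition f ↔ Summable fun j => wt j * |f j| := by
  unfold SummabilityCondition wt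
  simp only [sq_abs, div_eq_inv_mul]

/-- After clearing denominators this is `2 (2 + n² + i²) - (1 + (n + i)²) = 3 + (n - i)² ≥ 0`. It
expresses that the convolution of the weight with itself is bounded by a multiple of the weight. -/
lemma wt_mul_wt_le (n i : ℤ) : wt n * wt i ≤ 2 * wt (n + i) * (wt n + wt i) := by
  unfold wt
  push_cast
  have h1 : (0 : ℝ) < 1 + (n : ℝ) ^ 2 := by positivity
  have h2 : (0 : ℝ) < 1 + (i : ℝ) ^ 2 := by positivity
  have h3 : (0 : ℝ) < 1 + ((n : ℝ) + i) ^ 2 := by positivity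
  rw [← sub_nonneg]
  have : 2 * (1 + ((n : ℝ) + i) ^ 2)⁻¹ * ((1 + (n : ℝ) ^ 2)⁻¹ + (1 + (i : ℝ) ^ 2)⁻¹) -
      (1 + (n : ℝ) ^ 2)⁻¹ * (1 + (i : ℝ) ^ 2)⁻¹ =
      (3 + ((n : ℝ) - i) ^ 2) / ((1 + ((n : ℝ) + i) ^ 2) * ((1 + (n : ℝ) ^ 2) * (1 + (i : ℝ) ^ 2))) := by
    field_simp
    ring
  rw [this]
  positivity

/-- Peetre's inequality: recentring the weight costs a factor depending on `n` only, so the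
summability condition is translation invariant. -/
lemma wt_sub_le (n j : ℤ) : wt (n - j) ≤ 2 * (1 + (n : ℝ) ^ 2) * wt j := by
  unfold wt
  push_cast
  rw [← div_eq_mul_inv, inv_eq_one_div, div_le_div_iff₀ (by positivity) (by positivity)]
  nlinarith [sq_nonneg ((n : ℝ) * (n - j)), sq_nonneg ((n : ℝ) + (n - j) - 0),
    sq_nonneg ((2 : ℝ) * n - j)]

lemma summable_wt_sub_mul {f : ℤ → ℝ} (hf : SummabilityCondition f) (n : ℤ) :
    Summable fun j => wt (n - j) * |f j| := by
  refine Summable.of_nonneg_of_le (fun j => mul_nonneg (wt_pos _).le (abs_nonneg _)) (fun j => ?_)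
    ((summabilityCondition_iff.1 hf).mul_left (2 * (1 + (n : ℝ) ^ 2)))
  rw [← mul_assoc]
  exact mul_le_mul_of_nonneg_right (wt_sub_le n j) (abs_nonneg _)

lemma summable_wt_mul_wt_mul {f : ℤ → ℝ} (hf : SummabilityCondition f) (n : ℤ) :
    Summable fun x : ℤ × ℤ => wt (n - x.1) * wt (x.1 - x.2) * |f x.2| := by
  have ha := summable_wt_sub_mul hf n
  have h0 : ∀ j, 0 ≤ wt (n - j) * |f j| := fun j => mul_nonneg (wt_pos _).le (abs_nonneg _)
  have hp : Summable fun x : ℤ × ℤ => wt x.1 * (wt (n - x.2) * |f x.2|) :=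
    summable_wt.mul_of_nonneg ha (fun _ => (wt_pos _).le) h0
  have h1 : Summable fun x : ℤ × ℤ => wt (n - x.1) * (wt (n - x.2) * |f x.2|) :=
    (((Equiv.subLeft n).prodCongr (Equiv.refl ℤ)).summable_iff (f := fun x : ℤ × ℤ =>
      wt x.1 * (wt (n - x.2) * |f x.2|))).2 hp
  let e : ℤ × ℤ ≃ ℤ × ℤ :=
    ⟨fun x => (x.1 - x.2, x.2), fun x => (x.1 + x.2, x.2), fun x => by simp, fun x => by simp⟩
  have h2 : Summable fun x : ℤ × ℤ => wt (x.1 - x.2) * (wt (n - x.2) * |f x.2|) :=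
    (e.summable_iff (f := fun x : ℤ × ℤ => wt x.1 * (wt (n - x.2) * |f x.2|))).2 hp
  refine Summable.of_nonneg_of_le (fun x => mul_nonneg (mul_pos (wt_pos _) (wt_pos _)).le
    (abs_nonneg _)) (fun x => ?_) ((h1.add h2).mul_left 2)
  have := mul_le_mul_of_nonneg_right (wt_mul_wt_le (n - x.1) (x.1 - x.2)) (abs_nonneg (f x.2))
  rw [sub_add_sub_cancel] at this
  linarith

/-- Convolution with the kernel `k`. -/
def op (k f : ℤ → ℝ) (n : ℤ) : ℝ := ∑' j : ℤ, k (n - j) * f j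

lemma HasDecay.bound {k : ℤ → ℝ} (h : HasDecay k) : ∃ C, 0 ≤ C ∧ ∀ j, |k j| ≤ C * wt j := h

lemma summable_op {k f : ℤ → ℝ} (hk : HasDecay k) (hf : SummabilityCondition f) (n : ℤ) :
    Summable fun j => k (n - j) * f j := by
  obtain ⟨C, -, hC⟩ := hk.bound
  refine Summable.of_norm_bounded ((summable_wt_sub_mul hf n).mul_left C) fun j => ?_
  rw [norm_mul, ← mul_assoc]
  exact mul_le_mul_of_nonneg_right (hC _) (abs_nonneg _)

/-- Associativity of convolution. The double series converges absolutely by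
`summable_wt_mul_wt_mul`, so the sums may be exchanged although `f` itself may grow. -/
lemma op_op {k₁ k₂ k₃ f : ℤ → ℝ} (h₁ : HasDecay k₁) (h₂ : HasDecay k₂)
    (h : ∀ n, HasSum (fun j => k₁ (n - j) * k₂ j) (k₃ n)) (hf : SummabilityCondition f) :
    op k₁ (op k₂ f) = op k₃ f := by
  funext n
  obtain ⟨C₁, hC₁0, hC₁⟩ := h₁.bound
  obtain ⟨C₂, hC₂0, hC₂⟩ := h₂.bound
  have hs : Summable (Function.uncurry fun i j : ℤ => k₁ (n - i) * (k₂ (i - j) * f j)) := by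
    refine Summable.of_norm_bounded ((summable_wt_mul_wt_mul hf n).mul_left (C₁ * C₂)) fun x => ?_
    simp only [Function.uncurry, norm_mul, Real.norm_eq_abs]
    calc |k₁ (n - x.1)| * (|k₂ (x.1 - x.2)| * |f x.2|)
        ≤ (C₁ * wt (n - x.1)) * ((C₂ * wt (x.1 - x.2)) * |f x.2|) := by
          gcongr
          · exact mul_nonneg hC₁0 (wt_pos _).le
          · exact hC₁ _
          · exact hC₂ _
      _ = _ := by ring
  unfold op
  simp only [← tsum_mul_left]
  rw [← hs.tsum_comm]
  refine tsum_congr fun j => ?_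
  simp only [← mul_assoc, tsum_mul_right]
  congr 1
  rw [← (h (n - j)).tsum_eq, ← (Equiv.addRight j).tsum_eq fun i => k₁ (n - i) * k₂ (i - j)]
  refine tsum_congr fun i => ?_
  simp only [Equiv.coe_addRight, add_sub_cancel_right]
  congr 2
  ring

lemma op_add {k f g : ℤ → ℝ} (hk : HasDecay k) (hf : SummabilityCondition f)
    (hg : SummabilityCondition g) : op k (f + g) = op k f + op k g := by
  funext n
  simp only [op, Pi.add_apply, mul_add]
  exact (summable_op hk hf n).tsum_add (summable_op hk hg n)

lemma op_const_mul (k f : ℤ → ℝ) (c : ℝ) : op (fun j => c * k j) f = fun n => c * op k f n := by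
  funext n
  simp only [op, mul_assoc, tsum_mul_left]

lemma SummabilityCondition.add {f g : ℤ → ℝ} (hf : SummabilityCondition f)
    (hg : SummabilityCondition g) : SummabilityCondition (f + g) := by
  rw [summabilityCondition_iff] at *
  refine Summable.of_nonneg_of_le (fun n => mul_nonneg (wt_pos _).le (abs_nonneg _)) (fun n => ?_)
    (hf.add hg)
  rw [← mul_add]
  exact mul_le_mul_of_nonneg_left (abs_add_le _ _) (wt_pos _).le

lemma SummabilityCondition.const_mul {f : ℤ → ℝ} (hf : SummabilityCondition f) (c : ℝ) :
    SummabilityCondition fun n => c * f n := by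
  rw [summabilityCondition_iff] at *
  refine (hf.mul_left |c|).congr fun n => ?_
  rw [abs_mul]; ring

lemma SummabilityCondition.shift {f : ℤ → ℝ} (hf : SummabilityCondition f) (a : ℤ) :
    SummabilityCondition fun n => f (n + a) := by
  rw [summabilityCondition_iff, ← (Equiv.subRight a).summable_iff]
  refine (summable_wt_sub_mul hf a).congr fun j => ?_
  simp only [Function.comp, Equiv.subRight_apply, sub_add_cancel]
  rw [← wt_neg, neg_sub]

end DiscreteBesov

end

noncomputable section

namespace DiscreteBesov

open Real Filter Topology

/-! ### Symbols of the form `g(λ) e^{-s μ(λ)}` -/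

/-- The symbol `g(λ) e^{-s μ(λ)}`. -/
def sym (g μ : ℝ → ℝ) (s x : ℝ) : ℝ := g x * exp (-(s * μ x))

section Sym

variable {g μ : ℝ → ℝ}

/-- The constant is uniform for `s` in a compact interval and so provides the dominating function
for differentiating in `s`. Negative `s` are included so that derivatives at `s = 0` are two-sided.
-/
lemma exists_abs_kern_sym_le (hg : ContDiff ℝ 2 g) (hμ : ContDiff ℝ 2 μ) (R : ℝ) :
    ∃ C, 0 ≤ C ∧ ∀ s ∈ Set.Icc (-R) R, (∀ j, |kern (sym g μ s) j| ≤ C * wt j) ∧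
      ∀ x ∈ Set.Icc (0 : ℝ) 2, |sym g μ s x| ≤ C := by
  have hg1 : ContDiff ℝ 1 (deriv g) := (contDiff_succ_iff_deriv (n := 1)).1 hg |>.2.2
  have hμ1 : ContDiff ℝ 1 (deriv μ) := (contDiff_succ_iff_deriv (n := 1)).1 hμ |>.2.2
  have dg : ∀ x, HasDerivAt g (deriv g x) x := fun x =>
    (hg.differentiable (by norm_num) x).hasDerivAt
  have dμ : ∀ x, HasDerivAt μ (deriv μ x) x := fun x =>
    (hμ.differentiable (by norm_num) x).hasDerivAt
  have dg1 : ∀ x, HasDerivAt (deriv g) (deriv (deriv g) x) x := fun x =>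
    (hg1.differentiable (by norm_num) x).hasDerivAt
  have dμ1 : ∀ x, HasDerivAt (deriv μ) (deriv (deriv μ) x) x := fun x =>
    (hμ1.differentiable (by norm_num) x).hasDerivAt
  have cg := hg.continuous
  have cμ := hμ.continuous
  have cg1 := hg1.continuous
  have cμ1 := hμ1.continuous
  have cg2 : Continuous (deriv (deriv g)) := hg1.continuous_deriv le_rfl
  have cμ2 : Continuous (deriv (deriv μ)) := hμ1.continuous_deriv le_rfl
  set F0 : ℝ → ℝ → ℝ := fun s x => g x * exp (-(s * μ x)) with hF0
  set F1 : ℝ → ℝ → ℝ := fun s x => (deriv g x - s * deriv μ x * g x) * exp (-(s * μ x)) with hF1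
  set F2 : ℝ → ℝ → ℝ := fun s x => (deriv (deriv g) x - s * deriv (deriv μ) x * g x -
    s * deriv μ x * deriv g x - s * deriv μ x * (deriv g x - s * deriv μ x * g x)) *
    exp (-(s * μ x)) with hF2
  have dE : ∀ s x, HasDerivAt (fun x => exp (-(s * μ x))) (exp (-(s * μ x)) * (-(s * deriv μ x))) x :=
    fun s x => (((dμ x).const_mul s).neg).exp
  have h1 : ∀ s x, HasDerivAt (F0 s) (F1 s x) x := fun s x =>
    ((dg x).mul (dE s x)).congr_deriv (by simp only [hF1]; ring)
  have h2 : ∀ s x, HasDerivAt (F1 s) (F2 s x) x := fun s x =>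
    (((dg1 x).sub (((dμ1 x).const_mul s).mul (dg x))).mul (dE s x)).congr_deriv
      (by simp only [hF2, Pi.mul_apply, Pi.sub_apply]; ring)
  have hK : IsCompact ((Set.Icc (-R) R) ×ˢ (Set.Icc (0 : ℝ) 2)) := isCompact_Icc.prod isCompact_Icc
  obtain ⟨M0, hM0⟩ := hK.exists_bound_of_continuousOn (f := fun z : ℝ × ℝ => F0 z.1 z.2)
    (Continuous.continuousOn (by fun_prop))
  obtain ⟨M1, hM1⟩ := hK.exists_bound_of_continuousOn (f := fun z : ℝ × ℝ => F1 z.1 z.2)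
    (Continuous.continuousOn (by fun_prop))
  obtain ⟨M2, hM2⟩ := hK.exists_bound_of_continuousOn (f := fun z : ℝ × ℝ => F2 z.1 z.2)
    (Continuous.continuousOn (by fun_prop))
  set M := max (max |M0| |M1|) |M2| with hM
  have hM0' : M0 ≤ M := (le_abs_self _).trans ((le_max_left _ _).trans (le_max_left _ _))
  have hM1' : M1 ≤ M := (le_abs_self _).trans ((le_max_right _ _).trans (le_max_left _ _))
  have hM2' : M2 ≤ M := (le_abs_self _).trans (le_max_right _ _)
  have hMpos : 0 ≤ M := (abs_nonneg _).trans (le_max_right _ _)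
  refine ⟨5 * M, by positivity, fun s hs => ⟨fun j => ?_, fun x hx => ?_⟩⟩
  · exact abs_kern_le_div (h1 s) (h2 s) (by fun_prop)
      (fun x hx => (hM0 (s, x) ⟨hs, hx⟩).trans hM0') (fun x hx => (hM1 (s, x) ⟨hs, hx⟩).trans hM1')
      (fun x hx => (hM2 (s, x) ⟨hs, hx⟩).trans hM2') j
  · have : |sym g μ s x| ≤ M := (hM0 (s, x) ⟨hs, hx⟩).trans hM0'
    linarith

lemma hasDecay_sym (hg : ContDiff ℝ 2 g) (hμ : ContDiff ℝ 2 μ) (s : ℝ) :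
    HasDecay (kern (sym g μ s)) := by
  obtain ⟨C, hC0, hC⟩ := exists_abs_kern_sym_le hg hμ |s|
  exact ⟨C, hC0, (hC s ⟨neg_abs_le s, le_abs_self s⟩).1⟩

lemma hasDecay_of_contDiff (hg : ContDiff ℝ 2 g) : HasDecay (kern g) := by
  have := hasDecay_sym (μ := fun _ => 0) hg contDiff_const 0
  have e : sym g (fun _ => 0) 0 = g := by funext x; simp [sym]
  rwa [e] at this

lemma hasDerivAt_kern_sym (hg : ContDiff ℝ 2 g) (hμ : ContDiff ℝ 2 μ) (j : ℤ) (s : ℝ) :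
    HasDerivAt (fun s => kern (sym g μ s) j) (kern (sym (fun x => -μ x * g x) μ s) j) s := by
  obtain ⟨C, hC0, hC⟩ := exists_abs_kern_sym_le (g := fun x => -μ x * g x) (hμ.neg.mul hg) hμ
    (|s| + 1)
  have cg := hg.continuous
  have cμ := hμ.continuous
  have cl := continuous_lam
  unfold kern
  refine HasDerivAt.const_mul (2 * π)⁻¹ ?_
  refine (intervalIntegral.hasDerivAt_integral_of_dominated_loc_of_deriv_le
    (F := fun s θ => sym g μ s (lam θ) * cos (j * θ))
    (F' := fun s θ => sym (fun x => -μ x * g x) μ s (lam θ) * cos (j * θ)) (s := Metric.ball s 1) (bound := fun _ => C) (Metric.ball_mem_nhds s one_pos)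
    ?_ ?_ ?_ ?_ ?_ ?_).2
  · exact Eventually.of_forall fun r => Continuous.aestronglyMeasurable (by unfold sym; fun_prop)
  · exact Continuous.intervalIntegrable (by unfold sym; fun_prop) _ _
  · exact Continuous.aestronglyMeasurable (by unfold sym; fun_prop)
  · refine Eventually.of_forall fun θ hθ r hr => ?_
    rw [Set.uIoc_of_le (by positivity)] at hθ
    refine (abs_mul_cos_le _ _).trans ((hC r ?_).2 _ (lam_mem ⟨hθ.1.le, hθ.2⟩))
    rw [Metric.mem_ball, dist_comm, Real.dist_eq] at hr
    have := abs_sub_abs_le_abs_sub r s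
    rw [abs_sub_comm] at this
    exact abs_le.1 (by linarith)
  · exact _root_.intervalIntegrable_const
  · refine Eventually.of_forall fun θ _ r _ => ?_
    have h := ((((hasDerivAt_id r).mul_const (μ (lam θ))).neg.exp.const_mul
      (g (lam θ))).mul_const (cos (j * θ)))
    exact h.congr_deriv (by simp only [sym, id, Pi.neg_apply]; ring)

/-- Differentiation of `s ↦ (g e^{-s μ})(√(-Δ_d)) f`. -/
lemma hasDerivAt_op_sym (hg : ContDiff ℝ 2 g) (hμ : ContDiff ℝ 2 μ) {f : ℤ → ℝ}
    (hf : SummabilityCondition f) (n : ℤ) (s : ℝ) :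
    HasDerivAt (fun s => op (kern (sym g μ s)) f n)
      (op (kern (sym (fun x => -μ x * g x) μ s)) f n) s := by
  obtain ⟨C, hC0, hC⟩ := exists_abs_kern_sym_le (g := fun x => -μ x * g x) (hμ.neg.mul hg) hμ
    (|s| + 1)
  unfold op
  refine hasDerivAt_tsum_of_isPreconnected (g := fun j s => kern (sym g μ s) (n - j) * f j)
    (g' := fun j s => kern (sym (fun x => -μ x * g x) μ s) (n - j) * f j) (u := fun j => C * (wt (n - j) * |f j|))
    (t := Metric.ball s 1) (y₀ := s) ((summable_wt_sub_mul hf n).mul_left C) Metric.isOpen_ball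
    (convex_ball s 1).isPreconnected ?_ ?_ (Metric.mem_ball_self one_pos)
    (summable_op (hasDecay_sym hg hμ s) hf n) (Metric.mem_ball_self one_pos)
  · intro j r _
    exact (hasDerivAt_kern_sym hg hμ (n - j) r).mul_const _
  · intro j r hr
    rw [norm_mul, ← mul_assoc]
    refine mul_le_mul_of_nonneg_right ((hC r ?_).1 _) (norm_nonneg _)
    rw [Metric.mem_ball, dist_comm, Real.dist_eq] at hr
    have := abs_sub_abs_le_abs_sub r s
    rw [abs_sub_comm] at this
    exact abs_le.1 (by linarith)

lemma continuous_op_sym (hg : ContDiff ℝ 2 g) (hμ : ContDiff ℝ 2 μ) {f : ℤ → ℝ}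
    (hf : SummabilityCondition f) (n : ℤ) : Continuous fun s => op (kern (sym g μ s)) f n :=
  continuous_iff_continuousAt.2 fun s => (hasDerivAt_op_sym hg hμ hf n s).continuousAt

end Sym

/-- The functional calculus on functions of moderate growth: semigroup laws and commutation with the
Laplacian become identities between symbols. -/
lemma op_kern_mul {σ τ : ℝ → ℝ} (hσ : ContDiff ℝ 2 σ) (hτ : ContDiff ℝ 2 τ) {f : ℤ → ℝ}
    (hf : SummabilityCondition f) :
    op (kern fun x => σ x * τ x) f = op (kern σ) (op (kern τ) f) :=
  (op_op (hasDecay_of_contDiff hσ) (hasDecay_of_contDiff hτ)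
    (hasSum_kern_mul hσ.continuous hτ.continuous (hasDecay_of_contDiff hτ)) hf).symm

lemma op_kern_one (f : ℤ → ℝ) : op (kern fun _ => 1) f = f := by
  funext n
  unfold op
  rw [tsum_eq_single n]
  · simp [kern_one]
  · intro j hj
    rw [kern_one, if_neg (sub_ne_zero.2 hj.symm), zero_mul]

/-- The discrete Laplacian. -/
def lapl (f : ℤ → ℝ) (n : ℤ) : ℝ := f (n + 1) - 2 * f n + f (n - 1)

lemma op_kern_neg_sq (f : ℤ → ℝ) : op (kern fun x => -x ^ 2) f = lapl f := by
  funext n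
  unfold op
  rw [tsum_eq_sum (s := {n - 1, n, n + 1})]
  · rw [Finset.sum_insert (by simp; omega), Finset.sum_insert (by simp), Finset.sum_singleton]
    simp only [kern_neg_sq, lapl]
    norm_num
    ring
  · intro j hj
    simp only [Finset.mem_insert, Finset.mem_singleton, not_or] at hj
    rw [kern_neg_sq, if_neg (by omega), if_neg (by omega), if_neg (by omega)]
    simp

end DiscreteBesov

end

noncomputable section

namespace DiscreteBesov

open Real Filter Topology

/-! ### Uniform `ℓ¹` bounds for dilated symbols -/

/-- The `ℓ¹(ℤ)` norm of a kernel. -/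
def ellOne (k : ℤ → ℝ) : ℝ≥0∞ := ∑' j, ENNReal.ofReal |k j|

lemma ellOne_eq {k : ℤ → ℝ} (hk : HasDecay k) : ellOne k = ENNReal.ofReal (∑' j, |k j|) :=
  (ENNReal.ofReal_tsum_of_nonneg (fun _ => abs_nonneg _) hk.summable.abs).symm

lemma integral_inv_one_add_sq_le {b : ℝ} (hb : 0 < b) (c : ℝ) :
    ∫ θ in (0 : ℝ)..c, (1 + (b * θ) ^ 2)⁻¹ ≤ π / (2 * b) := by
  rw [intervalIntegral.integral_comp_mul_left (fun x => (1 + x ^ 2)⁻¹) hb.ne',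
    integral_inv_one_add_sq, mul_zero, arctan_zero, sub_zero, smul_eq_mul]
  have := (arctan_lt_pi_div_two (b * c)).le
  calc b⁻¹ * arctan (b * c) ≤ b⁻¹ * (π / 2) := by gcongr
    _ = π / (2 * b) := by field_simp

lemma half_le_lam {θ : ℝ} (h0 : 0 ≤ θ) (h1 : θ ≤ π) : θ / 2 ≤ lam θ := by
  have := mul_le_sin (x := θ / 2) (by linarith) (by linarith)
  have h4 : θ / 2 ≤ 2 * (2 / π * (θ / 2)) := by
    have hp := pi_pos
    have hp4 := pi_le_four
    rw [show 2 * (2 / π * (θ / 2)) = (2 * θ) / π by field_simp, le_div_iff₀ hp]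
    nlinarith
  unfold lam
  linarith

/-- `lam` vanishes at both endpoints of `[0, 2π]` and is at least half the distance to the nearer
one; each endpoint contributes one term. -/
lemma inv_one_add_sq_lam_le {r θ : ℝ} (hr : 0 < r) (hθ : θ ∈ Set.Icc (0 : ℝ) (2 * π)) :
    (1 + (r * lam θ) ^ 2)⁻¹ ≤
      (1 + (r / 2 * θ) ^ 2)⁻¹ + (1 + (r / 2 * (2 * π - θ)) ^ 2)⁻¹ := by
  have key : ∀ u : ℝ, 0 ≤ u → u / 2 ≤ lam θ →
      (1 + (r * lam θ) ^ 2)⁻¹ ≤ (1 + (r / 2 * u) ^ 2)⁻¹ := by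
    intro u hu h
    refine inv_anti₀ (by positivity) ?_
    have : r / 2 * u ≤ r * lam θ := by nlinarith
    gcongr
  rcases le_total θ π with h | h
  · have := key θ hθ.1 (half_le_lam hθ.1 h)
    have h2 : 0 < (1 + (r / 2 * (2 * π - θ)) ^ 2)⁻¹ := by positivity
    linarith
  · have e : lam (2 * π - θ) = lam θ := by
      unfold lam
      rw [show (2 * π - θ) / 2 = π - θ / 2 by ring, sin_pi_sub]
    have := key (2 * π - θ) (by linarith [hθ.2]) (by
      rw [← e]; exact half_le_lam (by linarith [hθ.2]) (by linarith))
    have h2 : 0 < (1 + (r / 2 * θ) ^ 2)⁻¹ := by positivity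
    linarith

/-- The mean is at most `1 / r` by the arctangent integral and at most `1` trivially. Adding `r`
times the first bound to the second gives `2 / (1 + r)`, valid for small and large `r` alike. -/
lemma integral_inv_one_add_sq_lam_le {r : ℝ} (hr : 0 < r) :
    (2 * π)⁻¹ * ∫ θ in (0 : ℝ)..(2 * π), (1 + (r * lam θ) ^ 2)⁻¹ ≤ 2 / (1 + r) := by
  have hl := continuous_lam
  have c0 : Continuous fun θ => (1 + (r * lam θ) ^ 2)⁻¹ :=
    Continuous.inv₀ (by fun_prop) fun θ => by positivity
  have c1 : Continuous fun θ : ℝ => (1 + (r / 2 * θ) ^ 2)⁻¹ :=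
    Continuous.inv₀ (by fun_prop) fun θ => by positivity
  have c2 : Continuous fun θ : ℝ => (1 + (r / 2 * (2 * π - θ)) ^ 2)⁻¹ :=
    Continuous.inv₀ (by fun_prop) fun θ => by positivity
  have hp := pi_pos
  have h1 : ∫ θ in (0 : ℝ)..(2 * π), (1 + (r * lam θ) ^ 2)⁻¹ ≤ 2 * π / r := by
    calc _ ≤ ∫ θ in (0 : ℝ)..(2 * π), ((1 + (r / 2 * θ) ^ 2)⁻¹ +
          (1 + (r / 2 * (2 * π - θ)) ^ 2)⁻¹) :=
        intervalIntegral.integral_mono_on (by positivity) (c0.intervalIntegrable _ _)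
          ((c1.add c2).intervalIntegrable _ _) fun θ hθ => inv_one_add_sq_lam_le hr hθ
      _ = (∫ θ in (0 : ℝ)..(2 * π), (1 + (r / 2 * θ) ^ 2)⁻¹) +
          ∫ θ in (0 : ℝ)..(2 * π), (1 + (r / 2 * θ) ^ 2)⁻¹ := by
        rw [intervalIntegral.integral_add (c1.intervalIntegrable _ _) (c2.intervalIntegrable _ _),
          intervalIntegral.integral_comp_sub_left (fun θ => (1 + (r / 2 * θ) ^ 2)⁻¹) (2 * π)]
        simp
      _ ≤ π / (2 * (r / 2)) + π / (2 * (r / 2)) :=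
        add_le_add (integral_inv_one_add_sq_le (by positivity) _)
          (integral_inv_one_add_sq_le (by positivity) _)
      _ = 2 * π / r := by field_simp; ring
  have h2 : ∫ θ in (0 : ℝ)..(2 * π), (1 + (r * lam θ) ^ 2)⁻¹ ≤ 2 * π := by
    calc _ ≤ ∫ θ in (0 : ℝ)..(2 * π), (1 : ℝ) :=
        intervalIntegral.integral_mono_on (by positivity) (c0.intervalIntegrable _ _)
          (continuous_const.intervalIntegrable _ _) fun θ _ => inv_le_one_of_one_le₀ (by
            have := sq_nonneg (r * lam θ); linarith)
      _ = 2 * π := by simp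
  rw [inv_mul_le_iff₀ (by positivity), mul_div_assoc', le_div_iff₀ (by positivity)]
  rw [le_div_iff₀ hr] at h1
  linarith

/-- The kernel of a dilated symbol is dominated by a Cauchy kernel. -/
lemma abs_kern_dilate_le {χ χ' χ'' : ℝ → ℝ} {C : ℝ} (h1 : ∀ x, HasDerivAt χ (χ' x) x)
    (h2 : ∀ x, HasDerivAt χ' (χ'' x) x) (h3 : Continuous χ'')
    (b0 : ∀ x, 0 ≤ x → |χ x| ≤ C * (1 + x ^ 2)⁻¹)
    (b1 : ∀ x, 0 ≤ x → |χ' x| * x ≤ C * (1 + x ^ 2)⁻¹) (b1' : |χ' 0| ≤ C)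
    (b2 : ∀ x, 0 ≤ x → |χ'' x| ≤ C * (1 + x ^ 2)⁻¹) {r : ℝ} (hr : 0 < r) (j : ℤ) :
    |kern (fun x => χ (r * x)) j| ≤ 5 * C * ((1 + r) / ((1 + r) ^ 2 + (j : ℝ) ^ 2)) := by
  have c0 : Continuous χ := continuous_iff_continuousAt.2 fun θ => (h1 θ).continuousAt
  have c1 : Continuous χ' := continuous_iff_continuousAt.2 fun θ => (h2 θ).continuousAt
  have hl := continuous_lam
  have hC : 0 ≤ C := (abs_nonneg _).trans b1'
  have ci : Continuous fun θ => (1 + (r * lam θ) ^ 2)⁻¹ :=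
    Continuous.inv₀ (by fun_prop) fun θ => by positivity
  have hI := integral_inv_one_add_sq_lam_le hr
  set I := ∫ θ in (0 : ℝ)..(2 * π), (1 + (r * lam θ) ^ 2)⁻¹ with hIdef
  have k0 : |kern (fun x => χ (r * x)) j| ≤ (2 * π)⁻¹ * (C * I) := by
    refine abs_kern_le j ?_ (by fun_prop)
    rw [hIdef, ← intervalIntegral.integral_const_mul]
    refine intervalIntegral.integral_mono_on (by positivity) ?_ ?_ fun θ hθ => ?_
    · exact Continuous.intervalIntegrable (by fun_prop) _ _
    · exact (continuous_const.mul ci).intervalIntegrable _ _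
    · exact b0 _ (mul_nonneg hr.le (lam_mem hθ).1)
  have e : ∀ x : ℝ, HasDerivAt (fun x => r * x) r x := fun x => by
    simpa using (hasDerivAt_id x).const_mul r
  have k2 := sq_mul_abs_kern_le (σ := fun x => χ (r * x)) (σ' := fun x => χ' (r * x) * r)
    (σ'' := fun x => χ'' (r * x) * r * r) (fun x => (h1 _).comp x (e x))
    (fun x => ((h2 _).comp x (e x)).mul_const r) (by fun_prop) j
  have hI2 : ∫ θ in (0 : ℝ)..(2 * π), (|χ'' (r * lam θ) * r * r| + |χ' (r * lam θ) * r| * lam θ) ≤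
      (C * (r ^ 2 + 1)) * I := by
    rw [hIdef, ← intervalIntegral.integral_const_mul]
    refine intervalIntegral.integral_mono_on (by positivity) ?_ ?_ fun θ hθ => ?_
    · exact Continuous.intervalIntegrable (by fun_prop) _ _
    · exact (continuous_const.mul ci).intervalIntegrable _ _
    · have hx := mul_nonneg hr.le (lam_mem hθ).1
      have e2 := b2 _ hx
      have e1 := b1 _ hx
      rw [abs_mul, abs_mul, abs_mul, abs_of_pos hr]
      have := mul_le_mul_of_nonneg_right e2 (sq_nonneg r)
      nlinarith
  have hp := pi_gt_three
  have k0' : |kern (fun x => χ (r * x)) j| ≤ C * (2 / (1 + r)) := by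
    refine k0.trans ?_
    rw [mul_left_comm]
    exact mul_le_mul_of_nonneg_left hI hC
  have k2' : (j : ℝ) ^ 2 * |kern (fun x => χ (r * x)) j| ≤ C * (3 * (1 + r)) := by
    refine k2.trans ?_
    rw [mul_add]
    have a1 : (2 * π)⁻¹ * (2 * |χ' (r * 0) * r|) ≤ C * r := by
      rw [mul_zero, abs_mul, abs_of_pos hr, inv_mul_le_iff₀ (by positivity)]
      have := mul_le_mul_of_nonneg_right b1' hr.le
      have hCr : 0 ≤ C * r := by positivity
      nlinarith
    have a2 := mul_le_mul_of_nonneg_left hI2 (by positivity : 0 ≤ (2 * π)⁻¹)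
    have a3 := mul_le_mul_of_nonneg_left hI (by positivity : 0 ≤ C * (r ^ 2 + 1))
    have a4 : C * (r ^ 2 + 1) * (2 / (1 + r)) ≤ C * (2 * (1 + r)) := by
      rw [mul_assoc]
      refine mul_le_mul_of_nonneg_left ?_ hC
      rw [mul_div_assoc', div_le_iff₀ (by positivity)]
      nlinarith
    have a5 : (2 * π)⁻¹ * (C * (r ^ 2 + 1) * I) = C * (r ^ 2 + 1) * ((2 * π)⁻¹ * I) := by ring
    nlinarith
  -- The constant 5 is `2 + 3`: `(1 + r)²` times the kernel is at most `2 C (1 + r)`, and `j²` times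
  -- the kernel is at most `3 C (1 + r)`.
  rw [mul_div_assoc', le_div_iff₀ (by positivity), mul_comm, add_mul]
  have : (1 + r) ^ 2 * |kern (fun x => χ (r * x)) j| ≤ C * (2 * (1 + r)) := by
    have := mul_le_mul_of_nonneg_left k0' (by positivity : 0 ≤ (1 + r) ^ 2)
    refine this.trans_eq ?_
    field_simp
  linarith

/-- Comparison with the integral of the decreasing Cauchy density, an arctangent; the bound does not
depend on the scale `ρ`. -/
lemma tsum_cauchy_nat_le {ρ : ℝ} (hρ : 0 < ρ) :
    Summable (fun n : ℕ => ρ / (ρ ^ 2 + ((n : ℝ) + 1) ^ 2)) ∧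
    ∑' n : ℕ, ρ / (ρ ^ 2 + ((n : ℝ) + 1) ^ 2) ≤ π / 2 := by
  have hpos : ∀ n : ℕ, 0 ≤ ρ / (ρ ^ 2 + ((n : ℝ) + 1) ^ 2) := fun n => by positivity
  have hs : ∀ N : ℕ, ∑ n ∈ Finset.range N, ρ / (ρ ^ 2 + ((n : ℝ) + 1) ^ 2) ≤ π / 2 := by
    intro N
    have hanti : AntitoneOn (fun x : ℝ => ρ / (ρ ^ 2 + x ^ 2)) (Set.Icc 0 (0 + N)) := by
      intro x hx y hy hxy
      have := hx.1
      simp only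
      gcongr
    have h := hanti.sum_le_integral
    have e : ∫ x in (0 : ℝ)..0 + N, ρ / (ρ ^ 2 + x ^ 2) = arctan (ρ⁻¹ * N) := by
      have : ∀ x : ℝ, ρ / (ρ ^ 2 + x ^ 2) = ρ⁻¹ * (1 + (ρ⁻¹ * x) ^ 2)⁻¹ := by
        intro x; field_simp
      simp only [this]
      rw [intervalIntegral.integral_const_mul,
        intervalIntegral.integral_comp_mul_left (fun x => (1 + x ^ 2)⁻¹) (inv_ne_zero hρ.ne'),
        integral_inv_one_add_sq]
      simp [hρ.ne']
    rw [e] at h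
    refine le_trans (le_of_eq ?_) (h.trans (arctan_lt_pi_div_two _).le)
    refine Finset.sum_congr rfl fun n _ => ?_
    push_cast; ring_nf
  have hsum := summable_of_sum_range_le hpos hs
  exact ⟨hsum, hsum.tsum_le_of_sum_range_le hs⟩

/-- The two half-lines contribute at most `π / 2` each and `j = 0` contributes `ρ⁻¹ ≤ 1`; since `π ≤
4` the total is at most 5. -/
lemma ellOne_le_of_cauchy {k : ℤ → ℝ} {C ρ : ℝ} (hρ : 1 ≤ ρ) (hC : 0 ≤ C)
    (h : ∀ j, |k j| ≤ C * (ρ / (ρ ^ 2 + (j : ℝ) ^ 2))) : ellOne k ≤ ENNReal.ofReal (5 * C) := by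
  have hρ0 : 0 < ρ := by linarith
  obtain ⟨hs, ht⟩ := tsum_cauchy_nat_le hρ0
  have hpi := pi_le_four
  have h1 : HasSum (fun n : ℕ => ρ / (ρ ^ 2 + (((n : ℤ)) : ℝ) ^ 2))
      (∑' n : ℕ, ρ / (ρ ^ 2 + ((n : ℝ) + 1) ^ 2) + ρ⁻¹) := by
    have := (hasSum_nat_add_iff (f := fun n : ℕ => ρ / (ρ ^ 2 + (((n : ℤ)) : ℝ) ^ 2)) 1
      (g := ∑' n : ℕ, ρ / (ρ ^ 2 + ((n : ℝ) + 1) ^ 2))).1 (by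
        simpa using hs.hasSum)
    have e : ∑ i ∈ Finset.range 1, ρ / (ρ ^ 2 + (((i : ℕ) : ℤ) : ℝ) ^ 2) = ρ⁻¹ := by
      simp [sq]
    rwa [e] at this
  have h2 : HasSum (fun n : ℕ => ρ / (ρ ^ 2 + ((-((n : ℤ) + 1) : ℤ) : ℝ) ^ 2))
      (∑' n : ℕ, ρ / (ρ ^ 2 + ((n : ℝ) + 1) ^ 2)) := by
    refine hs.hasSum.congr_fun fun n => ?_
    push_cast; ring
  have h3 := (HasSum.of_nat_of_neg_add_one (f := fun j : ℤ => ρ / (ρ ^ 2 + (j : ℝ) ^ 2)) h1 h2).mul_left C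
  have hk : Summable fun j => |k j| :=
    Summable.of_nonneg_of_le (fun _ => abs_nonneg _) h h3.summable
  rw [ellOne, ← ENNReal.ofReal_tsum_of_nonneg (fun _ => abs_nonneg _) hk]
  refine ENNReal.ofReal_le_ofReal ((hk.tsum_le_tsum h h3.summable).trans ?_)
  rw [h3.tsum_eq, mul_comm]
  refine mul_le_mul_of_nonneg_right ?_ hC
  have := inv_le_one_of_one_le₀ hρ
  linarith

end DiscreteBesov

end

noncomputable section

namespace DiscreteBesov

open Real Filter Topology

/-! ### The heat and Poisson symbols -/

/-- The symbol `g(λ) e^{-tλ²}` of the heat semigroup composed with `g(√(-Δ_d))`. -/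
abbrev heatSym (g : ℝ → ℝ) (t : ℝ) : ℝ → ℝ := sym g (fun x => x ^ 2) t

/-- The symbol `g(λ) e^{-yλ}` of the Poisson semigroup composed with `g(√(-Δ_d))`. -/
abbrev poisSym (g : ℝ → ℝ) (y : ℝ) : ℝ → ℝ := sym g (fun x => x) y

lemma contDiff_sym {g μ : ℝ → ℝ} (hg : ContDiff ℝ 2 g) (hμ : ContDiff ℝ 2 μ) (s : ℝ) :
    ContDiff ℝ 2 (sym g μ s) := by unfold sym; fun_prop

lemma sym_one (μ : ℝ → ℝ) (s : ℝ) : sym (fun _ => 1) μ s = fun x => exp (-(s * μ x)) := by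
  funext x; simp [sym]

lemma heatKernel_eq (t : ℝ) : heatKernel t = kern (heatSym (fun _ => 1) t) := by
  funext j
  rw [heatKernel_eq_kern, heatSym, sym_one]

lemma heatSemigroup_eq (t : ℝ) (f : ℤ → ℝ) :
    heatSemigroup t f = op (kern (heatSym (fun _ => 1) t)) f := by
  funext n
  rw [← heatKernel_eq]; rfl

lemma continuous_heatKernel (j : ℤ) : Continuous fun t => heatKernel t j := by
  simp only [heatKernel_eq]
  exact continuous_iff_continuousAt.2 fun s =>
    (hasDerivAt_kern_sym contDiff_const (by fun_prop) j s).continuousAt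

lemma integral_subDensity_mul_heatKernel' {y : ℝ} (hy : 0 < y) (j : ℤ) :
    ∫ t in Set.Ioi (0 : ℝ), subDensity y t * heatKernel t j = kern (poisSym (fun _ => 1) y) j := by
  rw [integral_subDensity_mul_heatKernel hy, poisSym, sym_one]

/-- Positivity passes from the heat kernel through subordination. -/
lemma kern_poisSym_nonneg {y : ℝ} (hy : 0 < y) (j : ℤ) : 0 ≤ kern (poisSym (fun _ => 1) y) j := by
  rw [← integral_subDensity_mul_heatKernel' hy]
  exact setIntegral_nonneg measurableSet_Ioi fun t ht =>
    mul_nonneg (subDensity_nonneg hy.le (le_of_lt ht)) (heatKernel_nonneg (le_of_lt ht) j)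

lemma heatKernel_le_one {t : ℝ} (ht : 0 ≤ t) (j : ℤ) : heatKernel t j ≤ 1 := by
  rw [heatKernel_eq]
  refine (le_abs_self _).trans (abs_kern_le_of_bound (by unfold heatSym sym; fun_prop) (fun x _ => ?_) j)
  simp only [heatSym, sym, one_mul, abs_of_pos (exp_pos _), exp_le_one_iff]
  have := mul_nonneg ht (sq_nonneg x)
  linarith

/-- Sum and integral are exchanged. As density and heat kernel are nonnegative, the integrals of the
norms are exactly the Poisson kernel times `|f j|`, which is summable. -/
lemma poissonSemigroup_eq {y : ℝ} (hy : 0 < y) {f : ℤ → ℝ} (hf : SummabilityCondition f) :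
    poissonSemigroup y f = op (kern (poisSym (fun _ => 1) y)) f := by
  funext n
  have hint : ∀ j, IntegrableOn (fun t => subDensity y t * heatKernel t j) (Set.Ioi 0) := by
    intro j
    refine (integrableOn_subDensity hy).mono' ?_ ?_
    · exact ((measurable_subDensity y).mul (continuous_heatKernel j).measurable).aestronglyMeasurable
    · refine (ae_restrict_iff' measurableSet_Ioi).2 (Eventually.of_forall fun t ht => ?_)
      have h1 := subDensity_nonneg hy.le (le_of_lt ht)
      rw [norm_mul, Real.norm_eq_abs, Real.norm_eq_abs, abs_of_nonneg h1,
        abs_of_nonneg (heatKernel_nonneg (le_of_lt ht) j)]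
      exact mul_le_of_le_one_right h1 (heatKernel_le_one (le_of_lt ht) j)
  have hfa : SummabilityCondition fun j => |f j| := by
    rw [summabilityCondition_iff] at *
    simpa only [abs_abs] using hf
  have key := hasSum_integral_of_summable_integral_norm
    (F := fun (j : ℤ) (t : ℝ) => subDensity y t * heatKernel t (n - j) * f j)
    (μ := volume.restrict (Set.Ioi 0)) (fun j => (hint _).mul_const _) (by
      refine (summable_op (hasDecay_sym (g := fun _ => 1) (μ := fun x => x) contDiff_const
        (by fun_prop) y) hfa n).congr fun j => ?_
      rw [← integral_subDensity_mul_heatKernel' hy, ← MeasureTheory.integral_mul_const]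
      refine setIntegral_congr_fun measurableSet_Ioi fun t ht => ?_
      simp only [norm_mul, Real.norm_eq_abs]
      rw [abs_of_nonneg (subDensity_nonneg hy.le (le_of_lt ht)),
        abs_of_nonneg (heatKernel_nonneg (le_of_lt ht) _)])
  unfold poissonSemigroup op
  rw [← MeasureTheory.integral_const_mul]
  simp only [← integral_subDensity_mul_heatKernel' hy, ← MeasureTheory.integral_mul_const]
  rw [key.tsum_eq]
  refine setIntegral_congr_fun measurableSet_Ioi fun t _ => ?_
  simp only [mul_assoc, tsum_mul_left, subDensity, heatSemigroup]

lemma ellOne_of_nonneg {σ : ℝ → ℝ} (hσ : ContDiff ℝ 2 σ) (h : ∀ j, 0 ≤ kern σ j) :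
    ellOne (kern σ) = ENNReal.ofReal (σ 0) := by
  rw [ellOne_eq (hasDecay_of_contDiff hσ), ← tsum_kern hσ.continuous (hasDecay_of_contDiff hσ)]
  simp only [abs_of_nonneg (h _)]

lemma ellOne_heatSym_one {t : ℝ} (ht : 0 ≤ t) : ellOne (kern (heatSym (fun _ => 1) t)) = 1 := by
  rw [ellOne_of_nonneg (contDiff_sym contDiff_const (by fun_prop) t)]
  · simp [sym]
  · rw [← heatKernel_eq]; exact heatKernel_nonneg ht

lemma ellOne_poisSym_one {y : ℝ} (hy : 0 < y) : ellOne (kern (poisSym (fun _ => 1) y)) = 1 := by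
  rw [ellOne_of_nonneg (contDiff_sym contDiff_const (by fun_prop) y) (kern_poisSym_nonneg hy)]
  simp [sym]

/-- The sixth power of `1 + x ≤ 6 e^{x/6}`, with `46656 = 6⁶`. Four of the six powers absorb the
polynomial factors of the profiles below, the other two give the decay `(1 + x²)⁻¹`. -/
lemma exp_neg_le {x : ℝ} (hx : 0 ≤ x) : exp (-x) * (1 + x) ^ 6 ≤ 46656 := by
  have h1 : 1 + x ≤ 6 * exp (x / 6) := by
    have := add_one_le_exp (x / 6)
    linarith
  have h2 : (1 + x) ^ 6 ≤ (6 * exp (x / 6)) ^ 6 := by gcongr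
  rw [mul_pow, ← exp_nat_mul] at h2
  calc exp (-x) * (1 + x) ^ 6 ≤ exp (-x) * (6 ^ 6 * exp ((6 : ℕ) * (x / 6))) := by gcongr
    _ = 6 ^ 6 * (exp (-x) * exp x) := by
      rw [show ((6 : ℕ) : ℝ) * (x / 6) = x by push_cast; ring]; ring
    _ = 46656 := by rw [← exp_add]; norm_num

lemma exp_neg_sq_le {x : ℝ} (hx : 0 ≤ x) : exp (-x ^ 2) * (1 + x) ^ 6 ≤ 3 * 46656 := by
  have h : exp (-x ^ 2) ≤ 3 * exp (-x) := by
    calc exp (-x ^ 2) ≤ exp (1 + -x) := exp_le_exp.2 (by nlinarith [sq_nonneg (x - 1 / 2)])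
      _ = exp 1 * exp (-x) := exp_add _ _
      _ ≤ 3 * exp (-x) := by
        gcongr
        exact (exp_one_lt_d9.trans (by norm_num)).le
  calc _ ≤ 3 * exp (-x) * (1 + x) ^ 6 := by gcongr
    _ ≤ _ := by rw [mul_assoc]; linarith [exp_neg_le hx]

lemma abs_mul_le_of_poly {x E P : ℝ} (hx : 0 ≤ x) (hE0 : 0 ≤ E) (hE : E * (1 + x) ^ 6 ≤ 3 * 46656)
    (hP : |P| ≤ 20 * (1 + x) ^ 4) : |P * E| ≤ 20 * (3 * 46656) * (1 + x ^ 2)⁻¹ := by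
  rw [← div_eq_mul_inv, le_div_iff₀ (by positivity), abs_mul, abs_of_nonneg hE0]
  calc |P| * E * (1 + x ^ 2) ≤ (20 * (1 + x) ^ 4) * E * (1 + x) ^ 2 := by
        gcongr
        nlinarith
    _ = 20 * (E * (1 + x) ^ 6) := by ring
    _ ≤ _ := by linarith

/-- The kernel of `λ e^{-yλ}`. -/
lemma abs_kern_poisSym_id_le {y : ℝ} (hy : 0 < y) (j : ℤ) :
    |kern (poisSym (fun x => -x) y) j| ≤
      y⁻¹ * (5 * (20 * (3 * 46656)) * ((1 + y) / ((1 + y) ^ 2 + (j : ℝ) ^ 2))) := by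
  have e : poisSym (fun x => -x) y = fun x => -y⁻¹ * ((y * x) * exp (-(y * x))) := by
    funext x
    simp only [poisSym, sym]
    field_simp
  have dE : ∀ x : ℝ, HasDerivAt (fun x => exp (-x)) (exp (-x) * -1) x := fun x =>
    ((hasDerivAt_id x).neg).exp
  have hE : ∀ x : ℝ, 0 ≤ x → exp (-x) * (1 + x) ^ 6 ≤ 3 * 46656 := fun x hx => by
    linarith [exp_neg_le hx]
  rw [e, kern_const_mul, abs_mul, abs_neg, abs_of_pos (inv_pos.2 hy)]
  gcongr
  refine abs_kern_dilate_le (χ := fun x => x * exp (-x)) (χ' := fun x => (1 - x) * exp (-x))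
    (χ'' := fun x => (x - 2) * exp (-x)) (fun x => ?_) (fun x => ?_) (by fun_prop) ?_ ?_ ?_ ?_ hy j
  · exact ((hasDerivAt_id x).mul (dE x)).congr_deriv (by simp only [id]; ring)
  · exact (((hasDerivAt_id x).const_sub 1).mul (dE x)).congr_deriv (by simp only [id]; ring)
  · intro x hx
    refine abs_mul_le_of_poly hx (exp_pos _).le (hE x hx) ?_
    rw [abs_of_nonneg hx]; ring_nf; nlinarith [pow_nonneg hx 2, pow_nonneg hx 3, pow_nonneg hx 4]
  · intro x hx
    rw [← abs_of_nonneg hx, ← abs_mul, abs_of_nonneg hx, mul_right_comm]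
    refine abs_mul_le_of_poly hx (exp_pos _).le (hE x hx) (abs_le.2 ⟨?_, ?_⟩) <;>
    · ring_nf; nlinarith [pow_nonneg hx 2, pow_nonneg hx 3, pow_nonneg hx 4]
  · norm_num
  · intro x hx
    refine abs_mul_le_of_poly hx (exp_pos _).le (hE x hx) (abs_le.2 ⟨?_, ?_⟩) <;>
    · ring_nf; nlinarith [pow_nonneg hx 2, pow_nonneg hx 3, pow_nonneg hx 4]

/-- The symbol is `y⁻² χ(yλ)` with `χ(x) = x² e^{-x}`, so scaling produces the factor `y⁻²`. -/
lemma abs_kern_poisSym_sq_le {y : ℝ} (hy : 0 < y) (j : ℤ) :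
    |kern (poisSym (fun x => x ^ 2) y) j| ≤
      (y ^ 2)⁻¹ * (5 * (20 * (3 * 46656)) * ((1 + y) / ((1 + y) ^ 2 + (j : ℝ) ^ 2))) := by
  have e : poisSym (fun x => x ^ 2) y = fun x => (y ^ 2)⁻¹ * ((y * x) ^ 2 * exp (-(y * x))) := by
    funext x
    simp only [poisSym, sym]
    field_simp
  have dE : ∀ x : ℝ, HasDerivAt (fun x => exp (-x)) (exp (-x) * -1) x := fun x =>
    ((hasDerivAt_id x).neg).exp
  have hE : ∀ x : ℝ, 0 ≤ x → exp (-x) * (1 + x) ^ 6 ≤ 3 * 46656 := fun x hx => by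
    linarith [exp_neg_le hx]
  rw [e, kern_const_mul, abs_mul, abs_of_pos (inv_pos.2 (pow_pos hy 2))]
  gcongr
  refine abs_kern_dilate_le (χ := fun x => x ^ 2 * exp (-x))
    (χ' := fun x => (2 * x - x ^ 2) * exp (-x))
    (χ'' := fun x => (2 - 4 * x + x ^ 2) * exp (-x)) (fun x => ?_) (fun x => ?_) (by fun_prop)
    ?_ ?_ ?_ ?_ hy j
  · exact ((hasDerivAt_pow 2 x).mul (dE x)).congr_deriv (by push_cast; ring)
  · exact ((((hasDerivAt_id x).const_mul 2).sub (hasDerivAt_pow 2 x)).mul (dE x)).congr_deriv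
      (by simp only [id, Pi.sub_apply]; push_cast; ring)
  · intro x hx
    refine abs_mul_le_of_poly hx (exp_pos _).le (hE x hx) (abs_le.2 ⟨?_, ?_⟩) <;>
    · ring_nf; nlinarith [pow_nonneg hx 2, pow_nonneg hx 3, pow_nonneg hx 4]
  · intro x hx
    rw [← abs_of_nonneg hx, ← abs_mul, abs_of_nonneg hx, mul_right_comm]
    refine abs_mul_le_of_poly hx (exp_pos _).le (hE x hx) (abs_le.2 ⟨?_, ?_⟩) <;>
    · ring_nf; nlinarith [pow_nonneg hx 2, pow_nonneg hx 3, pow_nonneg hx 4]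
  · norm_num
  · intro x hx
    refine abs_mul_le_of_poly hx (exp_pos _).le (hE x hx) (abs_le.2 ⟨?_, ?_⟩) <;>
    · ring_nf; nlinarith [pow_nonneg hx 2, pow_nonneg hx 3, pow_nonneg hx 4]

/-- At time `y²` the heat symbol is the dilation by `y` of `x² e^{-x²}`, up to the factor `-y⁻²`. It
then obeys the same bound as the Poisson symbol, so one argument serves both semigroups. -/
lemma abs_kern_heatSym_sq_le {y : ℝ} (hy : 0 < y) (j : ℤ) :
    |kern (heatSym (fun x => -x ^ 2) (y ^ 2)) j| ≤
      (y ^ 2)⁻¹ * (5 * (20 * (3 * 46656)) * ((1 + y) / ((1 + y) ^ 2 + (j : ℝ) ^ 2))) := by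
  have e : heatSym (fun x => -x ^ 2) (y ^ 2) =
      fun x => -(y ^ 2)⁻¹ * ((y * x) ^ 2 * exp (-(y * x) ^ 2)) := by
    funext x
    simp only [heatSym, sym, mul_pow]
    field_simp
  have dE : ∀ x : ℝ, HasDerivAt (fun x => exp (-x ^ 2)) (exp (-x ^ 2) * -(2 * x)) x := fun x =>
    ((hasDerivAt_pow 2 x).neg.exp).congr_deriv (by simp)
  have hE : ∀ x : ℝ, 0 ≤ x → exp (-x ^ 2) * (1 + x) ^ 6 ≤ 3 * 46656 := fun x hx => exp_neg_sq_le hx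
  rw [e, kern_const_mul, abs_mul, abs_neg, abs_of_pos (inv_pos.2 (pow_pos hy 2))]
  gcongr
  refine abs_kern_dilate_le (χ := fun x => x ^ 2 * exp (-x ^ 2))
    (χ' := fun x => (2 * x - 2 * x ^ 3) * exp (-x ^ 2))
    (χ'' := fun x => (2 - 10 * x ^ 2 + 4 * x ^ 4) * exp (-x ^ 2)) (fun x => ?_) (fun x => ?_)
    (by fun_prop) ?_ ?_ ?_ ?_ hy j
  · exact ((hasDerivAt_pow 2 x).mul (dE x)).congr_deriv (by push_cast; ring)
  · exact ((((hasDerivAt_id x).const_mul 2).sub ((hasDerivAt_pow 3 x).const_mul 2)).mul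
      (dE x)).congr_deriv (by simp only [id, Pi.sub_apply]; push_cast; ring)
  · intro x hx
    refine abs_mul_le_of_poly hx (exp_pos _).le (hE x hx) (abs_le.2 ⟨?_, ?_⟩) <;>
    · ring_nf; nlinarith [pow_nonneg hx 2, pow_nonneg hx 3, pow_nonneg hx 4]
  · intro x hx
    rw [← abs_of_nonneg hx, ← abs_mul, abs_of_nonneg hx, mul_right_comm]
    refine abs_mul_le_of_poly hx (exp_pos _).le (hE x hx) (abs_le.2 ⟨?_, ?_⟩) <;>
    · ring_nf; nlinarith [pow_nonneg hx 2, pow_nonneg hx 3, pow_nonneg hx 4]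
  · norm_num
  · intro x hx
    refine abs_mul_le_of_poly hx (exp_pos _).le (hE x hx) (abs_le.2 ⟨?_, ?_⟩) <;>
    · ring_nf; nlinarith [pow_nonneg hx 2, pow_nonneg hx 3, pow_nonneg hx 4]

end DiscreteBesov

end

noncomputable section

namespace DiscreteBesov

open Filter Topology

/-! ### Schur's test, Young's and Minkowski's inequalities -/

section Schur

variable {X Y : Type*} [MeasurableSpace X] [MeasurableSpace Y]

/-- Jensen's inequality for a weighted integral. -/
lemma lintegral_mul_rpow_le {ν : Measure Y} {K B : Y → ℝ≥0∞} (hK : AEMeasurable K ν)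
    (hB : AEMeasurable B ν) {q : ℝ} (hq : 1 ≤ q) :
    (∫⁻ y, K y * B y ∂ν) ^ q ≤ (∫⁻ y, K y ∂ν) ^ (q - 1) * ∫⁻ y, K y * B y ^ q ∂ν := by
  have hq0 : 0 < q := by linarith
  have hB' : AEMeasurable B (ν.withDensity K) := hB.mono_ac (withDensity_absolutelyContinuous _ _)
  have h := eLpNorm_le_eLpNorm_mul_rpow_measure_univ (p := 1) (q := ENNReal.ofReal q) (f := B)
    (μ := ν.withDensity K) (by simpa using hq) hB'.aestronglyMeasurable
  have hqne : ENNReal.ofReal q ≠ 0 := by simpa using hq0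
  rw [eLpNorm_one_eq_lintegral_enorm, eLpNorm_eq_lintegral_rpow_enorm_toReal hqne
    ENNReal.ofReal_ne_top, ENNReal.toReal_ofReal hq0.le, withDensity_apply _ MeasurableSet.univ,
    Measure.restrict_univ] at h
  simp only [enorm_eq_self, ENNReal.toReal_one] at h
  rw [lintegral_withDensity_eq_lintegral_mul₀ hK hB,
    lintegral_withDensity_eq_lintegral_mul₀ hK (hB.pow_const q)] at h
  simp only [Pi.mul_apply] at h
  have h2 := ENNReal.rpow_le_rpow h hq0.le
  rw [ENNReal.mul_rpow_of_nonneg _ _ hq0.le, ← ENNReal.rpow_mul, ← ENNReal.rpow_mul,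
    one_div_mul_cancel hq0.ne', ENNReal.rpow_one, mul_comm] at h2
  refine h2.trans_eq ?_
  congr 2
  field_simp

/-- Schur's test. -/
lemma eLpNorm_lintegral_mul_le {μ : Measure X} {ν : Measure Y} [SFinite μ] [SFinite ν]
    {K : X → Y → ℝ≥0∞} {B : Y → ℝ≥0∞} {M q : ℝ≥0∞} (hK : Measurable (Function.uncurry K))
    (hB : AEMeasurable B ν) (hq : 1 ≤ q) (h1 : ∀ᵐ x ∂μ, ∫⁻ y, K x y ∂ν ≤ M)
    (h2 : ∀ᵐ y ∂ν, ∫⁻ x, K x y ∂μ ≤ M) :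
    eLpNorm (fun x => ∫⁻ y, K x y * B y ∂ν) q μ ≤ M * eLpNorm B q ν := by
  have hKx : ∀ x, Measurable (K x) := fun x => hK.comp measurable_prodMk_left
  rcases eq_or_ne q ∞ with rfl | hqt
  · simp only [eLpNorm_exponent_top]
    refine essSup_le_of_ae_le _ ?_
    filter_upwards [h1] with x hx
    calc ∫⁻ y, K x y * B y ∂ν ≤ ∫⁻ y, K x y * eLpNormEssSup B ν ∂ν := by
          refine lintegral_mono_ae ?_
          filter_upwards [enorm_ae_le_eLpNormEssSup B ν] with y hy
          exact mul_le_mul_right hy _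
      _ = (∫⁻ y, K x y ∂ν) * eLpNormEssSup B ν := lintegral_mul_const _ (hKx x)
      _ ≤ _ := mul_le_mul_left hx _
  · have hq0 : q ≠ 0 := (zero_lt_one.trans_le hq).ne'
    set r := q.toReal with hr
    have hr1 : 1 ≤ r := by
      rw [hr, ← ENNReal.toReal_one]; exact ENNReal.toReal_mono hqt hq
    have hr0 : 0 < r := by linarith
    rw [eLpNorm_eq_lintegral_rpow_enorm_toReal hq0 hqt, eLpNorm_eq_lintegral_rpow_enorm_toReal hq0 hqt]
    simp only [enorm_eq_self, ← hr]
    -- Jensen's inequality for the measure `K x y dν(y)`, of mass at most `M`, then Tonelli and the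
    -- bound on the other marginal.
    have key : ∫⁻ x, (∫⁻ y, K x y * B y ∂ν) ^ r ∂μ ≤ M ^ r * ∫⁻ y, B y ^ r ∂ν := by
      calc ∫⁻ x, (∫⁻ y, K x y * B y ∂ν) ^ r ∂μ
          ≤ ∫⁻ x, M ^ (r - 1) * ∫⁻ y, K x y * B y ^ r ∂ν ∂μ := by
            refine lintegral_mono_ae ?_
            filter_upwards [h1] with x hx
            refine (lintegral_mul_rpow_le (hKx x).aemeasurable hB hr1).trans ?_
            exact mul_le_mul_left (ENNReal.rpow_le_rpow hx (by linarith)) _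
        _ = M ^ (r - 1) * ∫⁻ x, ∫⁻ y, K x y * B y ^ r ∂ν ∂μ := by
            have hm : AEMeasurable (Function.uncurry fun x y => K x y * B y ^ r) (μ.prod ν) :=
              hK.aemeasurable.mul ((hB.comp_snd).pow_const r)
            exact lintegral_const_mul'' _ hm.lintegral_prod_right'
        _ = M ^ (r - 1) * ∫⁻ y, ∫⁻ x, K x y * B y ^ r ∂μ ∂ν := by
            rw [lintegral_lintegral_swap]
            exact hK.aemeasurable.mul ((hB.comp_snd).pow_const r)
        _ ≤ M ^ (r - 1) * ∫⁻ y, M * B y ^ r ∂ν := by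
            refine mul_le_mul_right (lintegral_mono_ae ?_) _
            filter_upwards [h2] with y hy
            rw [lintegral_mul_const _ (f := fun x => K x y) (hK.comp measurable_prodMk_right)]
            exact mul_le_mul_left hy _
        _ = M ^ r * ∫⁻ y, B y ^ r ∂ν := by
            rw [lintegral_const_mul'' _ (hB.pow_const r), ← mul_assoc]
            congr 1
            nth_rewrite 2 [← ENNReal.rpow_one M]
            rw [← ENNReal.rpow_add_of_nonneg _ _ (by linarith) zero_le_one, sub_add_cancel]
    refine (ENNReal.rpow_le_rpow key (by positivity)).trans_eq ?_
    rw [ENNReal.mul_rpow_of_nonneg _ _ (by positivity), ← ENNReal.rpow_mul,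
      mul_one_div_cancel hr0.ne', ENNReal.rpow_one]

/-- Minkowski's integral inequality. -/
lemma eLpNorm_count_lintegral_le {μ : Measure Y} [SFinite μ] {F : Y → ℤ → ℝ≥0∞}
    (hF : ∀ n, Measurable fun s => F s n) {p : ℝ≥0∞} (hp : 1 ≤ p) :
    eLpNorm (fun n => ∫⁻ s, F s n ∂μ) p Measure.count ≤
      ∫⁻ s, eLpNorm (F s) p Measure.count ∂μ := by
  rcases eq_or_ne p ∞ with rfl | hpt
  · simp only [eLpNorm_exponent_top, eLpNormEssSup_count, enorm_eq_self]
    exact iSup_le fun n => lintegral_mono fun s => le_iSup (fun n => F s n) n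
  have hp0 : p ≠ 0 := (zero_lt_one.trans_le hp).ne'
  set r := p.toReal with hr
  have hr1 : 1 ≤ r := by
    rw [hr, ← ENNReal.toReal_one]; exact ENNReal.toReal_mono hpt hp
  have hr0 : 0 < r := by linarith
  set A : Y → ℝ≥0∞ := fun s => eLpNorm (F s) p Measure.count with hA
  have hAe : ∀ s, A s = (∑' n, F s n ^ r) ^ (1 / r) := fun s => by
    simp only [hA, eLpNorm_eq_lintegral_rpow_enorm_toReal hp0 hpt, lintegral_count,
      enorm_eq_self, ← hr]
  have hAm : Measurable A := by
    have : A = fun s => (∑' n, F s n ^ r) ^ (1 / r) := funext hAe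
    rw [this]
    exact (Measurable.tsum fun n => (hF n).pow_const r).pow_const _
  set I := ∫⁻ s, A s ∂μ with hI
  rcases eq_or_ne I ∞ with hIt | hIt
  · rw [hIt]; exact le_top
  have hAfin : ∀ᵐ s ∂μ, A s < ∞ := ae_lt_top hAm hIt
  have hAr : ∀ s, A s ^ r = ∑' n, F s n ^ r := fun s => by
    rw [hAe, ← ENNReal.rpow_mul, one_div_mul_cancel hr0.ne', ENNReal.rpow_one]
  have hle : ∀ s n, F s n ≤ A s := by
    intro s n
    have : F s n ^ r ≤ A s ^ r := by
      rw [hAr]; exact ENNReal.le_tsum n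
    exact (ENNReal.rpow_le_rpow_iff hr0).1 this
  -- Instead of duality: `F = A · (F / A)`, Jensen's inequality for the measure `A dμ` of mass `I`,
  -- and summation over `n`, where the `r`-th powers of `F / A` sum to at most one.
  have hfac : ∀ n, ∫⁻ s, F s n ∂μ = ∫⁻ s, A s * (F s n / A s) ∂μ := by
    intro n
    refine lintegral_congr_ae ?_
    filter_upwards [hAfin] with s hs
    rcases eq_or_ne (A s) 0 with h0 | h0
    · have := hle s n
      rw [h0] at this ⊢
      rw [zero_mul]; exact le_antisymm this zero_le
    · exact (ENNReal.mul_div_cancel h0 hs.ne).symm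
  have hq : ∀ n, (∫⁻ s, F s n ∂μ) ^ r ≤ I ^ (r - 1) * ∫⁻ s, A s * (F s n / A s) ^ r ∂μ := by
    intro n
    rw [hfac n]
    exact lintegral_mul_rpow_le hAm.aemeasurable ((hF n).div hAm).aemeasurable hr1
  have hone : ∀ᵐ s ∂μ, ∑' n, A s * (F s n / A s) ^ r ≤ A s := by
    filter_upwards [hAfin] with s hs
    rw [ENNReal.tsum_mul_left]
    rcases eq_or_ne (A s) 0 with h0 | h0
    · simp [h0]
    · simp only [ENNReal.div_rpow_of_nonneg _ _ hr0.le]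
      simp only [div_eq_mul_inv]
      rw [ENNReal.tsum_mul_right, ← hAr, ENNReal.mul_inv_cancel, mul_one]
      · simp [ENNReal.rpow_eq_zero_iff, h0, hr0.not_gt]
      · exact ENNReal.rpow_ne_top_of_nonneg hr0.le hs.ne
  have hfinal : ∑' n, (∫⁻ s, F s n ∂μ) ^ r ≤ I ^ r := by
    calc ∑' n, (∫⁻ s, F s n ∂μ) ^ r
        ≤ ∑' n, I ^ (r - 1) * ∫⁻ s, A s * (F s n / A s) ^ r ∂μ := ENNReal.tsum_le_tsum hq
      _ = I ^ (r - 1) * ∫⁻ s, ∑' n, A s * (F s n / A s) ^ r ∂μ := by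
          rw [ENNReal.tsum_mul_left, lintegral_tsum]
          exact fun n => (hAm.mul (((hF n).div hAm).pow_const r)).aemeasurable
      _ ≤ I ^ (r - 1) * I := mul_le_mul_right (lintegral_mono_ae hone) _
      _ = I ^ r := by
          nth_rewrite 2 [← ENNReal.rpow_one I]
          rw [← ENNReal.rpow_add_of_nonneg _ _ (by linarith) zero_le_one, sub_add_cancel]
  rw [eLpNorm_eq_lintegral_rpow_enorm_toReal hp0 hpt]
  simp only [enorm_eq_self, ← hr, lintegral_count]
  refine (ENNReal.rpow_le_rpow hfinal (by positivity)).trans_eq ?_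
  rw [← ENNReal.rpow_mul, mul_one_div_cancel hr0.ne', ENNReal.rpow_one]

end Schur

lemma tsum_ofReal_abs_sub (k : ℤ → ℝ) (n : ℤ) :
    ∑' j, ENNReal.ofReal |k (n - j)| = ellOne k :=
  (Equiv.subLeft n).tsum_eq fun j => ENNReal.ofReal |k j|

lemma tsum_ofReal_abs_sub' (k : ℤ → ℝ) (j : ℤ) :
    ∑' n, ENNReal.ofReal |k (n - j)| = ellOne k :=
  (Equiv.subRight j).tsum_eq fun j => ENNReal.ofReal |k j|

/-- Young's inequality. -/
lemma ellNorm_op_le {p : ℝ≥0∞} (hp : 1 ≤ p) (k f : ℤ → ℝ) :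
    ellNorm p (op k f) ≤ ellOne k * ellNorm p f := by
  have h := eLpNorm_lintegral_mul_le (μ := (Measure.count : Measure ℤ))
    (ν := (Measure.count : Measure ℤ)) (K := fun n j => ENNReal.ofReal |k (n - j)|)
    (B := fun j => ‖f j‖ₑ) (M := ellOne k) (q := p) Measurable.of_discrete
    Measurable.of_discrete.aemeasurable hp
    (Eventually.of_forall fun n => by rw [lintegral_count, tsum_ofReal_abs_sub])
    (Eventually.of_forall fun j => by rw [lintegral_count, tsum_ofReal_abs_sub'])
  rw [eLpNorm_enorm] at h
  refine le_trans (eLpNorm_mono_enorm fun n => ?_) h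
  simp only [lintegral_count, enorm_eq_self]
  unfold op
  refine (enorm_tsum_le_tsum_enorm).trans (ENNReal.tsum_le_tsum fun j => ?_)
  rw [enorm_mul, Real.enorm_eq_ofReal_abs (k (n - j))]

end DiscreteBesov

end

noncomputable section

namespace DiscreteBesov

open Filter Topology

/-! ### Second differences -/

/-- The symmetric second difference with step `j`. -/
def sdiff (j : ℤ) (f : ℤ → ℝ) (n : ℤ) : ℝ := f (n - j) - 2 * f n + f (n + j)

lemma aesm {f : ℤ → ℝ} : AEStronglyMeasurable f (Measure.count : Measure ℤ) :=
  Measurable.of_discrete.aestronglyMeasurable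

lemma ellNorm_add_le {p : ℝ≥0∞} (hp : 1 ≤ p) (f g : ℤ → ℝ) :
    ellNorm p (f + g) ≤ ellNorm p f + ellNorm p g := eLpNorm_add_le aesm aesm hp

lemma ellNorm_sum_le {p : ℝ≥0∞} (hp : 1 ≤ p) {ι : Type*} (s : Finset ι) (F : ι → ℤ → ℝ) :
    ellNorm p (∑ i ∈ s, F i) ≤ ∑ i ∈ s, ellNorm p (F i) := eLpNorm_sum_le (fun _ _ => aesm) hp

lemma ellNorm_const_mul (p : ℝ≥0∞) (c : ℝ) (f : ℤ → ℝ) :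
    ellNorm p (fun n => c * f n) = ENNReal.ofReal |c| * ellNorm p f := by
  rw [← Real.enorm_eq_ofReal_abs]
  exact eLpNorm_const_smul c f p _

lemma ellNorm_shift (p : ℝ≥0∞) (a : ℤ) (f : ℤ → ℝ) :
    ellNorm p (fun n => f (n + a)) = ellNorm p f := by
  unfold ellNorm
  rcases eq_or_ne p 0 with rfl | h0
  · simp
  rcases eq_or_ne p ∞ with rfl | ht
  · simp only [eLpNorm_exponent_top, eLpNormEssSup_count]
    exact (Equiv.addRight a).iSup_comp (g := fun n => ‖f n‖ₑ)
  · rw [eLpNorm_eq_lintegral_rpow_enorm_toReal h0 ht, eLpNorm_eq_lintegral_rpow_enorm_toReal h0 ht,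
      lintegral_count, lintegral_count]
    congr 1
    exact (Equiv.addRight a).tsum_eq fun n => ‖f n‖ₑ ^ p.toReal

lemma ellNorm_neg (p : ℝ≥0∞) (f : ℤ → ℝ) : ellNorm p (fun n => -f n) = ellNorm p f := by
  have := ellNorm_const_mul p (-1) f
  simpa using this

lemma ellNorm_mono {p : ℝ≥0∞} {f : ℤ → ℝ} {g : ℤ → ℝ≥0∞} (h : ∀ n, ‖f n‖ₑ ≤ g n) :
    ellNorm p f ≤ eLpNorm g p Measure.count := eLpNorm_mono_enorm h

lemma sdiff_zero (f : ℤ → ℝ) : sdiff 0 f = 0 := by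
  funext n; simp [sdiff]; ring

lemma sdiff_neg (j : ℤ) (f : ℤ → ℝ) : sdiff (-j) f = sdiff j f := by
  funext n; simp only [sdiff, sub_neg_eq_add, ← sub_eq_add_neg]; ring

lemma sdiff_add (j : ℤ) (f g : ℤ → ℝ) : sdiff j (f + g) = sdiff j f + sdiff j g := by
  funext n; simp only [sdiff, Pi.add_apply]; ring

lemma ellNorm_sdiff_le {p : ℝ≥0∞} (hp : 1 ≤ p) (j : ℤ) (f : ℤ → ℝ) :
    ellNorm p (sdiff j f) ≤ 4 * ellNorm p f := by
  have e : sdiff j f = (fun n => f (n + -j)) + ((fun n => (-2) * f n) + fun n => f (n + j)) := by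
    funext n; simp only [sdiff, Pi.add_apply, sub_eq_add_neg]; ring
  rw [e]
  refine (ellNorm_add_le hp _ _).trans ((add_le_add_right (ellNorm_add_le hp _ _) _).trans_eq ?_)
  rw [ellNorm_shift, ellNorm_shift, ellNorm_const_mul]
  norm_num
  ring

lemma sum_range_lapl (g : ℤ → ℝ) (m : ℤ) (J : ℕ) :
    ∑ a ∈ Finset.range J, lapl g (m + a) = (g (m + J) - g (m + J - 1)) - (g m - g (m - 1)) := by
  induction J with
  | zero => simp
  | succ J ih =>
    rw [Finset.sum_range_succ, ih]
    simp only [lapl]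
    push_cast
    rw [show m + ((J : ℤ) + 1) - 1 = m + J by ring, ← add_assoc]
    ring_nf

lemma sum_range_sub_pred (g : ℤ → ℝ) (m : ℤ) (J : ℕ) :
    ∑ b ∈ Finset.range J, (g (m - b) - g (m - b - 1)) = g m - g (m - J) := by
  induction J with
  | zero => simp
  | succ J ih =>
    rw [Finset.sum_range_succ, ih]
    push_cast
    rw [show m - ((J : ℤ) + 1) = m - J - 1 by ring]
    ring

/-- Double telescoping, the discrete form of writing a second difference as a double integral of the
second derivative. It bounds `sdiff J` by `J²` Laplacians and also computes the Laplacian of the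
Steklov average. -/
lemma sdiff_eq_sum_lapl (g : ℤ → ℝ) (J : ℕ) (n : ℤ) :
    sdiff J g n = ∑ b ∈ Finset.range J, ∑ a ∈ Finset.range J, lapl g (n + ((a : ℤ) - b)) := by
  have h1 : ∀ b : ℕ, ∑ a ∈ Finset.range J, lapl g (n + ((a : ℤ) - b)) =
      (g (n + J - b) - g (n + J - b - 1)) - (g (n - b) - g (n - b - 1)) := by
    intro b
    rw [show n + (J : ℤ) - b = n - b + J by ring, ← sum_range_lapl]
    refine Finset.sum_congr rfl fun a _ => ?_
    congr 1; ring
  simp only [h1, Finset.sum_sub_distrib (f := fun b : ℕ => g (n + J - b) - g (n + J - b - 1)),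
    sum_range_sub_pred, sdiff]
  rw [add_sub_cancel_right]
  ring

/-- A second difference is controlled by the discrete Laplacian. -/
lemma ellNorm_sdiff_le_lapl {p : ℝ≥0∞} (hp : 1 ≤ p) (J : ℕ) (g : ℤ → ℝ) :
    ellNorm p (sdiff J g) ≤ (J : ℝ≥0∞) ^ 2 * ellNorm p (lapl g) := by
  have e : sdiff J g = ∑ b ∈ Finset.range J, ∑ a ∈ Finset.range J,
      fun n => lapl g (n + ((a : ℤ) - b)) := by
    funext n
    simp only [Finset.sum_apply, sdiff_eq_sum_lapl]
  rw [e]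
  refine (ellNorm_sum_le hp _ _).trans ((Finset.sum_le_sum fun b _ => ellNorm_sum_le hp _ _).trans_eq ?_)
  simp only [ellNorm_shift, Finset.sum_const, Finset.card_range, nsmul_eq_mul]
  ring

/-- The Steklov average of `f` at scale `J`. -/
def steklov (J : ℕ) (f : ℤ → ℝ) (n : ℤ) : ℝ :=
  ((J : ℝ) ^ 2)⁻¹ * ∑ b ∈ Finset.range J, ∑ a ∈ Finset.range J, f (n + ((a : ℤ) - b))

lemma lapl_steklov (J : ℕ) (f : ℤ → ℝ) :
    lapl (steklov J f) = fun n => ((J : ℝ) ^ 2)⁻¹ * sdiff J f n := by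
  funext n
  rw [sdiff_eq_sum_lapl]
  simp only [lapl, steklov, Finset.sum_add_distrib, Finset.sum_sub_distrib, ← Finset.mul_sum]
  simp only [show ∀ a b : ℕ, n + 1 + ((a : ℤ) - b) = n + ((a : ℤ) - b) + 1 from fun a b => by ring]
  simp only [show ∀ a b : ℕ, n - 1 + ((a : ℤ) - b) = n + ((a : ℤ) - b) - 1 from fun a b => by ring]
  ring_nf

/-- The set of pairs `(a, b)` is symmetric, so `f (n + (a - b))` may be averaged with `f (n - (a -
b))`; this turns the deviation from the mean into second differences and produces the factor one
half. -/
lemma sub_steklov {J : ℕ} (hJ : J ≠ 0) (f : ℤ → ℝ) :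
    (fun n => f n - steklov J f n) = ∑ b ∈ Finset.range J, ∑ a ∈ Finset.range J,
      fun n => -(((J : ℝ) ^ 2)⁻¹ / 2) * sdiff ((a : ℤ) - b) f n := by
  funext n
  have hJ' : (J : ℝ) ≠ 0 := by exact_mod_cast hJ
  have h1 : ∑ b ∈ Finset.range J, ∑ a ∈ Finset.range J, f (n - ((a : ℤ) - b)) =
      ∑ b ∈ Finset.range J, ∑ a ∈ Finset.range J, f (n + ((a : ℤ) - b)) := by
    rw [Finset.sum_comm]
    refine Finset.sum_congr rfl fun b _ => Finset.sum_congr rfl fun a _ => ?_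
    congr 1; ring
  simp only [Finset.sum_apply, sdiff, ← Finset.mul_sum, Finset.sum_add_distrib,
    Finset.sum_sub_distrib, h1, Finset.sum_const, Finset.card_range, nsmul_eq_mul, steklov]
  field_simp
  ring

lemma SummabilityCondition.steklov {f : ℤ → ℝ} (hf : SummabilityCondition f) (J : ℕ) :
    SummabilityCondition (steklov J f) := by
  refine SummabilityCondition.const_mul (f := fun n => ∑ b ∈ Finset.range J,
    ∑ a ∈ Finset.range J, f (n + ((a : ℤ) - b))) ?_ _
  have hz : SummabilityCondition 0 := by simp [summabilityCondition_iff, summable_zero]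
  have hsum : ∀ (F : ℕ → ℤ → ℝ), (∀ i, SummabilityCondition (F i)) →
      ∀ s : Finset ℕ, SummabilityCondition fun n => ∑ i ∈ s, F i n := by
    intro F hF s
    induction s using Finset.induction_on with
    | empty => exact hz
    | insert i s hi ih =>
      simp only [Finset.sum_insert hi]
      exact (hF i).add ih
  exact hsum _ (fun b => hsum _ (fun a => hf.shift _) _) _

/-- Smoothing estimate through the decomposition into a Steklov average and a remainder. -/
lemma ellNorm_op_lapl_le {p : ℝ≥0∞} (hp : 1 ≤ p) {σ : ℝ → ℝ} (hσ : ContDiff ℝ 2 σ) {f : ℤ → ℝ}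
    (hf : SummabilityCondition f) {J : ℕ} (hJ : J ≠ 0) :
    ellNorm p (op (kern fun x => σ x * -x ^ 2) f) ≤
      ellOne (kern σ) * (ENNReal.ofReal (((J : ℝ) ^ 2)⁻¹) * ellNorm p (sdiff J f)) +
      ellOne (kern fun x => σ x * -x ^ 2) * (ENNReal.ofReal (((J : ℝ) ^ 2)⁻¹) *
        ∑ b ∈ Finset.range J, ∑ a ∈ Finset.range J, ellNorm p (sdiff ((a : ℤ) - b) f)) := by
  have hd : HasDecay (kern fun x => σ x * -x ^ 2) := hasDecay_of_contDiff (by fun_prop)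
  have hS := hf.steklov J
  have hR : SummabilityCondition fun n => f n - steklov J f n := by
    have := hf.add (hS.const_mul (-1))
    refine Eq.mp ?_ this
    congr 1; funext n; simp [sub_eq_add_neg]
  have e : f = steklov J f + fun n => f n - steklov J f n := by
    funext n; simp
  conv_lhs => rw [e]
  rw [op_add hd hS hR]
  refine (ellNorm_add_le hp _ _).trans (add_le_add ?_ ?_)
  · rw [op_kern_mul hσ (by fun_prop) hS, op_kern_neg_sq, lapl_steklov]
    refine (ellNorm_op_le hp _ _).trans_eq ?_
    rw [ellNorm_const_mul, abs_of_nonneg (by positivity)]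
  · refine (ellNorm_op_le hp _ _).trans (mul_le_mul_right ?_ _)
    rw [sub_steklov hJ]
    refine (ellNorm_sum_le hp _ _).trans ?_
    rw [Finset.mul_sum]
    refine Finset.sum_le_sum fun b _ => (ellNorm_sum_le hp _ _).trans ?_
    rw [Finset.mul_sum]
    refine Finset.sum_le_sum fun a _ => ?_
    rw [ellNorm_const_mul]
    refine mul_le_mul_left (ENNReal.ofReal_le_ofReal ?_) _
    rw [abs_neg, abs_of_nonneg (by positivity)]
    exact half_le_self (by positivity)

lemma sum_range_pred_le {N : ℕ → ℝ≥0∞} (h0 : N 0 = 0) (J : ℕ) :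
    ∑ b ∈ Finset.range J, N (b - 1) ≤ ∑ b ∈ Finset.range J, N b := by
  cases J with
  | zero => simp
  | succ J =>
    rw [Finset.sum_range_succ', Finset.sum_range_succ]
    simp [h0]

/-- Subtraction in `ℕ` is truncated: the indices `b ≤ a` contribute `N 0 = 0`, the others are a
shifted part of the right-hand sum. -/
lemma sum_range_tsub_le {N : ℕ → ℝ≥0∞} (h0 : N 0 = 0) (J a : ℕ) :
    ∑ b ∈ Finset.range J, N (b - a) ≤ ∑ b ∈ Finset.range J, N b := by
  induction a with
  | zero => simp
  | succ a ih =>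
    refine le_trans ?_ ih
    have := sum_range_pred_le (N := fun b => N (b - a)) (by simpa using h0) J
    simpa only [Nat.sub_sub, add_comm 1 a] using this

/-- `sdiff` is even in its step, and a given distance `|a - b|` occurs at most `2 J` times. One of
the truncated differences `a - b` and `b - a` is always `0`. -/
lemma sum_sum_sdiff_le (p : ℝ≥0∞) (f : ℤ → ℝ) (J : ℕ) :
    ∑ b ∈ Finset.range J, ∑ a ∈ Finset.range J, ellNorm p (sdiff ((a : ℤ) - b) f) ≤
      2 * J * ∑ i ∈ Finset.range J, ellNorm p (sdiff i f) := by
  set N : ℕ → ℝ≥0∞ := fun i => ellNorm p (sdiff i f) with hN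
  have h0 : N 0 = 0 := by simp [hN, sdiff_zero, ellNorm]
  have h1 : ∀ a b : ℕ, ellNorm p (sdiff ((a : ℤ) - b) f) ≤ N (a - b) + N (b - a) := by
    intro a b
    rcases le_total a b with h | h
    · have e : (a : ℤ) - b = -((b - a : ℕ) : ℤ) := by push_cast [h]; ring
      rw [e, sdiff_neg]; exact le_add_self
    · have e : (a : ℤ) - b = ((a - b : ℕ) : ℤ) := by push_cast [h]; ring
      rw [e]; exact le_self_add
  calc _ ≤ ∑ b ∈ Finset.range J, ∑ a ∈ Finset.range J, (N (a - b) + N (b - a)) :=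
        Finset.sum_le_sum fun b _ => Finset.sum_le_sum fun a _ => h1 a b
    _ = ∑ b ∈ Finset.range J, ∑ a ∈ Finset.range J, N (a - b) +
        ∑ a ∈ Finset.range J, ∑ b ∈ Finset.range J, N (b - a) := by
        simp only [Finset.sum_add_distrib]
        congr 1
        exact Finset.sum_comm
    _ ≤ J * ∑ i ∈ Finset.range J, N i + J * ∑ i ∈ Finset.range J, N i := by
        have : ∑ b ∈ Finset.range J, ∑ a ∈ Finset.range J, N (a - b) ≤
            J * ∑ i ∈ Finset.range J, N i :=
          (Finset.sum_le_sum fun b _ => sum_range_tsub_le h0 J b).trans_eq (by simp)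
        exact add_le_add this this
    _ = _ := by ring

end DiscreteBesov

end

noncomputable section

namespace DiscreteBesov

open Filter Topology Set

/-! ### The measures `dt / t` and `∑ 1 / n` -/

lemma measurable_ofReal_one_div : Measurable fun t : ℝ => ENNReal.ofReal (1 / t) := by fun_prop

lemma lintegral_haarPos (g : ℝ → ℝ≥0∞) :
    ∫⁻ t, g t ∂haarPos = ∫⁻ t in Ioi (0 : ℝ), ENNReal.ofReal (1 / t) * g t := by
  unfold haarPos
  rw [lintegral_withDensity_eq_lintegral_mul_non_measurable _ measurable_ofReal_one_div
    (Eventually.of_forall fun _ => ENNReal.ofReal_lt_top)]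
  rfl

lemma haarPos_ac : haarPos ≪ volume.restrict (Ioi (0 : ℝ)) := withDensity_absolutelyContinuous _ _

lemma ae_haarPos_pos : ∀ᵐ t ∂haarPos, 0 < t :=
  haarPos_ac.ae_le (ae_restrict_mem measurableSet_Ioi)

instance : SFinite haarPos := by unfold haarPos; infer_instance

lemma aemeasurable_haarPos_of_antitoneOn {a : ℝ → ℝ≥0∞} (ha : AntitoneOn a (Ioi 0)) :
    AEMeasurable a haarPos :=
  (aemeasurable_restrict_of_antitoneOn measurableSet_Ioi ha).mono_ac haarPos_ac

/-- Change of variables `t = c y^β` in `dt / t`. -/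
lemma map_haarPos {c β : ℝ} (hc : 0 < c) (hβ : 0 < β) :
    haarPos = ENNReal.ofReal β • haarPos.map (fun y => c * y ^ β) := by
  have hm : Measurable fun y : ℝ => c * y ^ β := by fun_prop
  refine Measure.ext fun s hs => ?_
  rw [Measure.smul_apply, Measure.map_apply hm hs, ← lintegral_indicator_one hs,
    ← lintegral_indicator_one (hm hs), lintegral_haarPos, lintegral_haarPos, smul_eq_mul]
  have himg : (fun y : ℝ => c * y ^ β) '' Ioi 0 = Ioi 0 := by
    ext x
    constructor
    · rintro ⟨y, hy, rfl⟩
      exact mul_pos hc (Real.rpow_pos_of_pos hy _)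
    · intro hx
      have hx' : 0 < x / c := div_pos hx hc
      refine ⟨(x / c) ^ β⁻¹, Real.rpow_pos_of_pos hx' _, ?_⟩
      simp only
      rw [← Real.rpow_mul hx'.le, inv_mul_cancel₀ hβ.ne', Real.rpow_one]
      field_simp
  have hinj : InjOn (fun y : ℝ => c * y ^ β) (Ioi 0) := by
    intro x hx y hy h
    have h' := mul_left_cancel₀ hc.ne' h
    exact (Real.rpow_left_inj (le_of_lt hx) (le_of_lt hy) hβ.ne').1 h'
  have hder : ∀ x ∈ Ioi (0 : ℝ),
      HasDerivWithinAt (fun y : ℝ => c * y ^ β) (c * (β * x ^ (β - 1))) (Ioi 0) x := fun x hx =>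
    ((Real.hasDerivAt_rpow_const (Or.inl (ne_of_gt hx))).const_mul c).hasDerivWithinAt
  have key := lintegral_image_eq_lintegral_abs_deriv_mul measurableSet_Ioi hder hinj
    (fun t => ENNReal.ofReal (1 / t) * s.indicator 1 t)
  rw [himg] at key
  rw [key, ← lintegral_const_mul' _ _ ENNReal.ofReal_ne_top]
  refine setLIntegral_congr_fun measurableSet_Ioi fun y hy => ?_
  have hy : 0 < y := hy
  have hyb := Real.rpow_pos_of_pos hy β
  change _ * (_ * s.indicator 1 (c * y ^ β)) = _ * (_ * s.indicator 1 (c * y ^ β))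
  rw [← mul_assoc (ENNReal.ofReal |_|), ← mul_assoc (ENNReal.ofReal β),
    ← ENNReal.ofReal_mul (abs_nonneg _), ← ENNReal.ofReal_mul hβ.le]
  congr 2
  rw [abs_of_pos (by positivity), Real.rpow_sub hy, Real.rpow_one]
  field_simp

/-- Used with `t = y²` for the heat semigroup and with `2 * y` for the Poisson semigroup. -/
lemma eLpNorm_haarPos_comp_lt_top_iff {B : ℝ → ℝ≥0∞} (hB : AEMeasurable B haarPos) {c β : ℝ}
    (hc : 0 < c) (hβ : 0 < β) (q : ℝ≥0∞) :
    eLpNorm (fun y => B (c * y ^ β)) q haarPos < ∞ ↔ eLpNorm B q haarPos < ∞ := by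
  have hm : Measurable fun y : ℝ => c * y ^ β := by fun_prop
  have hβ' : ENNReal.ofReal β ≠ 0 := by simpa using hβ
  have hB' : AEMeasurable B (haarPos.map fun y => c * y ^ β) := by
    refine hB.mono_ac ?_
    conv_rhs => rw [map_haarPos hc hβ]
    exact Measure.absolutelyContinuous_smul hβ'
  have h := eLpNorm_map_measure (p := q) hB'.aestronglyMeasurable hm.aemeasurable
  have h2 : eLpNorm B q haarPos =
      ENNReal.ofReal β ^ (1 / q).toReal * eLpNorm B q (haarPos.map fun y => c * y ^ β) := by
    conv_lhs => rw [map_haarPos hc hβ]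
    rw [eLpNorm_smul_measure_of_ne_zero hβ', smul_eq_mul]
  rw [h2, h]
  have p1 : ENNReal.ofReal β ^ (1 / q).toReal ≠ 0 := by
    simp [ENNReal.rpow_eq_zero_iff, hβ.not_ge]
  have p2 : ENNReal.ofReal β ^ (1 / q).toReal ≠ ∞ :=
    ENNReal.rpow_ne_top_of_nonneg ENNReal.toReal_nonneg ENNReal.ofReal_ne_top
  exact ⟨fun h => ENNReal.mul_lt_top p2.lt_top h,
    fun h => ENNReal.lt_top_of_mul_ne_top_right h.ne p1⟩

/-- `∫_0^b (y / b)^c dy / y ≤ 1 / c`. -/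
lemma lintegral_haarPos_le {b c : ℝ} (hb : 0 < b) (hc : 0 < c) :
    ∫⁻ y, (if y ≤ b then ENNReal.ofReal ((y / b) ^ c) else 0) ∂haarPos ≤ ENNReal.ofReal (1 / c) := by
  have hi : IntegrableOn (fun y : ℝ => (b ^ c)⁻¹ * y ^ (c - 1)) (Ioc 0 b) := by
    have h := intervalIntegral.intervalIntegrable_rpow' (a := 0) (b := b) (r := c - 1) (by linarith)
    rw [intervalIntegrable_iff_integrableOn_Ioc_of_le hb.le] at h
    exact h.const_mul _
  calc ∫⁻ y, (if y ≤ b then ENNReal.ofReal ((y / b) ^ c) else 0) ∂haarPos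
      = ∫⁻ y in Ioi 0, (Iic b).indicator
          (fun y => ENNReal.ofReal ((b ^ c)⁻¹ * y ^ (c - 1))) y := by
        rw [lintegral_haarPos]
        refine setLIntegral_congr_fun measurableSet_Ioi fun y hy => ?_
        have hy : 0 < y := hy
        by_cases h : y ≤ b
        · rw [indicator_of_mem (mem_Iic.2 h)]
          simp only [h, if_true]
          rw [← ENNReal.ofReal_mul (by positivity), Real.div_rpow hy.le hb.le,
            Real.rpow_sub hy, Real.rpow_one]
          congr 1
          field_simp
        · rw [indicator_of_notMem (by simpa using h)]
          simp [h]
    _ = ∫⁻ y in Ioc 0 b, ENNReal.ofReal ((b ^ c)⁻¹ * y ^ (c - 1)) := by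
        rw [setLIntegral_indicator measurableSet_Iic, inter_comm, Ioi_inter_Iic]
    _ = ENNReal.ofReal (∫ y in Ioc 0 b, (b ^ c)⁻¹ * y ^ (c - 1)) := by
        rw [ofReal_integral_eq_lintegral_ofReal hi]
        refine (ae_restrict_iff' measurableSet_Ioc).2 (Eventually.of_forall fun y hy => ?_)
        exact mul_nonneg (by positivity) (Real.rpow_nonneg hy.1.le _)
    _ = ENNReal.ofReal (1 / c) := by
        rw [← intervalIntegral.integral_of_le hb.le, intervalIntegral.integral_const_mul,
          integral_rpow (Or.inl (by linarith)), sub_add_cancel, Real.zero_rpow hc.ne', sub_zero]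
        have := Real.rpow_pos_of_pos hb c
        congr 1
        field_simp
    _ ≤ _ := le_rfl

/-- `∫_b^∞ (b / y)^c dy / y ≤ 1 / c`. -/
lemma lintegral_haarPos_ge {b c : ℝ} (hb : 0 < b) (hc : 0 < c) :
    ∫⁻ y, (if b ≤ y then ENNReal.ofReal ((b / y) ^ c) else 0) ∂haarPos ≤ ENNReal.ofReal (1 / c) := by
  have hi : IntegrableOn (fun y : ℝ => b ^ c * y ^ (-c - 1)) (Ioi b) :=
    (integrableOn_Ioi_rpow_of_lt (by linarith) hb).const_mul _
  calc ∫⁻ y, (if b ≤ y then ENNReal.ofReal ((b / y) ^ c) else 0) ∂haarPos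
      = ∫⁻ y in Ioi 0, (Ici b).indicator
          (fun y => ENNReal.ofReal (b ^ c * y ^ (-c - 1))) y := by
        rw [lintegral_haarPos]
        refine setLIntegral_congr_fun measurableSet_Ioi fun y hy => ?_
        have hy : 0 < y := hy
        by_cases h : b ≤ y
        · rw [indicator_of_mem (mem_Ici.2 h)]
          simp only [h, if_true]
          rw [← ENNReal.ofReal_mul (by positivity), Real.div_rpow hb.le hy.le,
            Real.rpow_sub hy, Real.rpow_neg hy.le, Real.rpow_one]
          congr 1
          field_simp
        · rw [indicator_of_notMem (by simpa using h)]
          simp [h]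
    _ = ∫⁻ y in Ioi b, ENNReal.ofReal (b ^ c * y ^ (-c - 1)) := by
        rw [setLIntegral_indicator measurableSet_Ici, inter_eq_left.2 (Ici_subset_Ioi.2 hb)]
        exact setLIntegral_congr Ioi_ae_eq_Ici.symm
    _ = ENNReal.ofReal (∫ y in Ioi b, b ^ c * y ^ (-c - 1)) := by
        rw [ofReal_integral_eq_lintegral_ofReal hi]
        refine (ae_restrict_iff' measurableSet_Ioi).2 (Eventually.of_forall fun y hy => ?_)
        exact mul_nonneg (by positivity) (Real.rpow_nonneg (hb.le.trans (le_of_lt hy)) _)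
    _ = ENNReal.ofReal (1 / c) := by
        rw [MeasureTheory.integral_const_mul, integral_Ioi_rpow_of_lt (by linarith) hb,
          sub_add_cancel, Real.rpow_neg hb.le]
        have := Real.rpow_pos_of_pos hb c
        congr 1
        field_simp
    _ ≤ _ := le_rfl

/-- The measure `∑ₙ 1 / (n + 1) δₙ` on `ℕ`. -/
def logMeas : Measure ℕ := Measure.count.withDensity fun n => ENNReal.ofReal (1 / ((n : ℝ) + 1))

instance : SFinite logMeas := by unfold logMeas; infer_instance

lemma lintegral_logMeas (g : ℕ → ℝ≥0∞) :
    ∫⁻ n, g n ∂logMeas = ∑' n : ℕ, ENNReal.ofReal (1 / ((n : ℝ) + 1)) * g n := by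
  unfold logMeas
  rw [lintegral_withDensity_eq_lintegral_mul _ Measurable.of_discrete Measurable.of_discrete,
    lintegral_count]
  rfl

lemma eLpNormEssSup_logMeas (g : ℕ → ℝ≥0∞) : eLpNormEssSup g logMeas = ⨆ n, g n := by
  have h1 : logMeas ≪ Measure.count := withDensity_absolutelyContinuous _ _
  have h2 : Measure.count ≪ logMeas := withDensity_absolutelyContinuous'
    Measurable.of_discrete.aemeasurable (Eventually.of_forall fun n => by
      simp only [ne_eq, ENNReal.ofReal_eq_zero, not_le]; positivity)
  have h3 : eLpNormEssSup g (Measure.count : Measure ℕ) = ⨆ n, g n := by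
    simp [eLpNormEssSup_count]
  rw [← h3]
  exact le_antisymm (essSup_mono_measure h1) (essSup_mono_measure h2)

/-- At most one interval `[n + 1, n + 2)` contains a given point. -/
lemma tsum_ite_Ico_le (y : ℝ) (v : ℝ≥0∞) :
    ∑' n : ℕ, (if (n : ℝ) + 1 ≤ y ∧ y < n + 2 then v else 0) ≤ v := by
  rw [tsum_eq_single (⌊y⌋₊ - 1)]
  · split_ifs <;> simp
  · intro n hn
    rw [if_neg]
    rintro ⟨h1, h2⟩
    have : ⌊y⌋₊ = n + 1 := by
      rw [Nat.floor_eq_iff (by linarith [(Nat.cast_nonneg n : (0 : ℝ) ≤ n)])]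
      push_cast
      constructor <;> linarith
    omega

end DiscreteBesov

end

noncomputable section

namespace DiscreteBesov

open Filter Topology Set

/-! ### Hardy-type inequalities -/

lemma lintegral_haarPos_Ico_le (n : ℕ) :
    ∫⁻ y, (if (n : ℝ) + 1 ≤ y ∧ y < n + 2 then ENNReal.ofReal (4 * ((n : ℝ) + 1)) else 0) ∂haarPos
      ≤ 4 := by
  rw [lintegral_haarPos]
  calc ∫⁻ y in Ioi (0 : ℝ), ENNReal.ofReal (1 / y) *
        (if (n : ℝ) + 1 ≤ y ∧ y < n + 2 then ENNReal.ofReal (4 * ((n : ℝ) + 1)) else 0)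
      ≤ ∫⁻ y in Ioi (0 : ℝ), (Ico ((n : ℝ) + 1) (n + 2)).indicator (fun _ => 4) y := by
        refine setLIntegral_mono' measurableSet_Ioi fun y hy => ?_
        have hy : 0 < y := hy
        by_cases h : (n : ℝ) + 1 ≤ y ∧ y < n + 2
        · rw [indicator_of_mem (mem_Ico.2 h)]
          simp only [h, and_self, if_true]
          rw [← ENNReal.ofReal_mul (by positivity), ← ENNReal.ofReal_ofNat 4]
          refine ENNReal.ofReal_le_ofReal ?_
          rw [one_div, inv_mul_le_iff₀ hy]
          linarith [h.1]
        · simp [h]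
    _ ≤ ∫⁻ y, (Ico ((n : ℝ) + 1) (n + 2)).indicator (fun _ => 4) y := setLIntegral_le_lintegral _ _
    _ = 4 := by
        rw [lintegral_indicator_const measurableSet_Ico, Real.volume_Ico]
        norm_num

/-- There are `⌊y⌋` nonzero terms, and each is at most `1 / y`. -/
lemma tsum_rpow_le {α y : ℝ} (hα : 0 < α) (hy : 0 < y) :
    ∑' n : ℕ, ENNReal.ofReal (1 / ((n : ℝ) + 1)) *
      (if (n : ℝ) + 1 ≤ y then ENNReal.ofReal ((((n : ℝ) + 1) / y) ^ (α + 1)) else 0) ≤ 1 := by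
  have hfl : ∀ n : ℕ, (n : ℝ) + 1 ≤ y ↔ n < ⌊y⌋₊ := fun n => by
    rw [← Nat.add_one_le_iff, Nat.le_floor_iff hy.le]; push_cast; rfl
  rw [tsum_eq_sum (s := Finset.range ⌊y⌋₊)]
  · calc _ ≤ ∑ n ∈ Finset.range ⌊y⌋₊, ENNReal.ofReal (1 / y) := by
          refine Finset.sum_le_sum fun n hn => ?_
          have h := (hfl n).2 (Finset.mem_range.1 hn)
          rw [if_pos h, ← ENNReal.ofReal_mul (by positivity)]
          refine ENNReal.ofReal_le_ofReal ?_
          have hn0 : (0 : ℝ) < (n : ℝ) + 1 := by positivity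
          have h1 : (((n : ℝ) + 1) / y) ^ α ≤ 1 :=
            Real.rpow_le_one (by positivity) ((div_le_one hy).2 h) hα.le
          rw [Real.rpow_add (by positivity), Real.rpow_one]
          calc 1 / ((n : ℝ) + 1) * ((((n : ℝ) + 1) / y) ^ α * (((n : ℝ) + 1) / y))
              = (((n : ℝ) + 1) / y) ^ α * (1 / y) := by field_simp
            _ ≤ 1 * (1 / y) := by gcongr
            _ = 1 / y := one_mul _
      _ ≤ 1 := by
          rw [Finset.sum_const, Finset.card_range, nsmul_eq_mul, ← ENNReal.ofReal_natCast,
            ← ENNReal.ofReal_mul (by positivity), ← ENNReal.ofReal_one]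
          refine ENNReal.ofReal_le_ofReal ?_
          rw [mul_one_div, div_le_one hy]
          exact Nat.floor_le hy.le
  · intro n hn
    rw [if_neg, mul_zero]
    rwa [hfl, ← Finset.mem_range]

/-- From the discrete to the continuous mixed norm. -/
lemma eLpNorm_haarPos_lt_top_of_logMeas {α : ℝ} (hα0 : 0 < α) (hα2 : α < 2) {q : ℝ≥0∞} (hq : 1 ≤ q)
    {a : ℝ → ℝ≥0∞} {N : ℕ → ℝ≥0∞} {C : ℝ≥0∞} (hC : C ≠ ∞) (hN0 : N 0 = 0)
    (h : ∀ y : ℝ, 0 < y → ∀ J : ℕ, J ≠ 0 → a y ≤ C * (ENNReal.ofReal ((J : ℝ) ^ 2)⁻¹ * N J +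
      ENNReal.ofReal ((y ^ 2)⁻¹ * (J : ℝ)⁻¹) * ∑ i ∈ Finset.range J, N i))
    (hD : eLpNorm (fun n : ℕ => ENNReal.ofReal (((n : ℝ) + 1) ^ α)⁻¹ * N (n + 1)) q logMeas < ∞) :
    eLpNorm (fun y => ENNReal.ofReal (y ^ (2 - α)) * a y) q haarPos < ∞ := by
  set D : ℕ → ℝ≥0∞ := fun n => ENNReal.ofReal (((n : ℝ) + 1) ^ α)⁻¹ * N (n + 1) with hDdef
  have hND : ∀ n : ℕ, N (n + 1) = ENNReal.ofReal (((n : ℝ) + 1) ^ α) * D n := by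
    intro n
    have : 0 < ((n : ℝ) + 1) ^ α := by positivity
    rw [hDdef, ← mul_assoc, ← ENNReal.ofReal_mul this.le, mul_inv_cancel₀ this.ne',
      ENNReal.ofReal_one, one_mul]
  clear_value D
  -- The hypothesis `h` is applied with `J = ⌊y⌋` if `y ≥ 1` and with `J = 1` otherwise. `K1`
  -- carries the term `N J`: its factor `n + 1` undoes the weight of `logMeas`, and 4 bounds `(y /
  -- J)^(2 - α)`. `K2` carries the sum over `i < J`. `K3` treats `y < 1`, where that sum reduces to
  -- `N 0 = 0`.
  set K1 : ℝ → ℕ → ℝ≥0∞ := fun y n =>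
    if (n : ℝ) + 1 ≤ y ∧ y < n + 2 then ENNReal.ofReal (4 * ((n : ℝ) + 1)) else 0 with hK1
  set K2 : ℝ → ℕ → ℝ≥0∞ := fun y n =>
    if (n : ℝ) + 1 ≤ y then ENNReal.ofReal ((((n : ℝ) + 1) / y) ^ (α + 1)) else 0 with hK2
  set K3 : ℝ → ℕ → ℝ≥0∞ := fun y n =>
    if n = 0 then (if y ≤ 1 then ENNReal.ofReal ((y / 1) ^ (2 - α)) else 0) else 0 with hK3
  have m1 : ∀ n, Measurable fun y => K1 y n := fun n =>
    Measurable.ite ((measurableSet_Ici (a := (n : ℝ) + 1)).inter measurableSet_Iio)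
      measurable_const measurable_const
  have m2 : ∀ n, Measurable fun y => K2 y n := fun n =>
    Measurable.ite measurableSet_Ici (by fun_prop) measurable_const
  have m3 : ∀ n, Measurable fun y => K3 y n := by
    intro n
    by_cases hn : n = 0
    · simp only [hK3, hn, if_true]
      exact Measurable.ite measurableSet_Iic (by fun_prop) measurable_const
    · simp only [hK3, hn, if_false]; exact measurable_const
  set K : ℝ → ℕ → ℝ≥0∞ := fun y n => C * (K1 y n + (2 * K2 y n + K3 y n)) with hK
  have mK : ∀ n, Measurable fun y => K y n := fun n =>
    ((m1 n).add (((m2 n).const_mul 2).add (m3 n))).const_mul C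
  have hKm : Measurable (Function.uncurry K) := measurable_from_prod_countable_left mK
  -- A common bound for both marginals: 4 for `K1`, 1 for `K2`, and for `K3` either 1 (sum over `n`)
  -- or `1 / (2 - α)` (integral over `y`).
  set M : ℝ≥0∞ := C * (4 + (2 * 1 + (1 + ENNReal.ofReal (1 / (2 - α))))) with hM
  have hMt : M ≠ ∞ := ENNReal.mul_ne_top hC (by simp [ENNReal.add_eq_top])
  have hS := eLpNorm_lintegral_mul_le (μ := haarPos) (ν := logMeas) (K := K) (B := D) (M := M) hKm
    Measurable.of_discrete.aemeasurable hq ?_ ?_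
  · refine lt_of_le_of_lt (eLpNorm_mono_enorm_ae ?_) (hS.trans_lt (ENNReal.mul_lt_top hMt.lt_top hD))
    filter_upwards [ae_haarPos_pos] with y hy
    simp only [enorm_eq_self]
    have hexp : ∫⁻ n, K y n * D n ∂logMeas =
        C * (∑' n : ℕ, ENNReal.ofReal (1 / ((n : ℝ) + 1)) * (K1 y n * D n) +
          (2 * ∑' n : ℕ, ENNReal.ofReal (1 / ((n : ℝ) + 1)) * (K2 y n * D n) +
            ∑' n : ℕ, ENNReal.ofReal (1 / ((n : ℝ) + 1)) * (K3 y n * D n))) := by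
      rw [lintegral_logMeas, ← ENNReal.tsum_mul_left, ← ENNReal.tsum_add, ← ENNReal.tsum_add,
        ← ENNReal.tsum_mul_left]
      refine tsum_congr fun n => ?_
      simp only [hK]; ring
    rw [hexp]
    rcases lt_or_ge y 1 with hy1 | hy1
    · have h1 := h y hy 1 one_ne_zero
      simp only [Finset.range_one, Finset.sum_singleton, hN0, mul_zero, add_zero, Nat.cast_one,
        one_pow, inv_one, ENNReal.ofReal_one, one_mul] at h1
      calc ENNReal.ofReal (y ^ (2 - α)) * a y ≤ ENNReal.ofReal (y ^ (2 - α)) * (C * N 1) := by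
            gcongr
        _ = C * (ENNReal.ofReal (1 / (((0 : ℕ) : ℝ) + 1)) * (K3 y 0 * D 0)) := by
            rw [show N 1 = N (0 + 1) from rfl, hND]
            simp only [hK3, if_true, hy1.le, div_one, Nat.cast_zero, zero_add, Real.one_rpow,
              ENNReal.ofReal_one, one_mul]
            ring
        _ ≤ _ := by
            gcongr
            refine le_add_left (le_add_left ?_)
            exact ENNReal.le_tsum (f := fun n : ℕ =>
              ENNReal.ofReal (1 / ((n : ℝ) + 1)) * (K3 y n * D n)) 0
    · obtain ⟨m, hm⟩ : ∃ m, ⌊y⌋₊ = m + 1 :=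
        Nat.exists_eq_succ_of_ne_zero (by have := Nat.floor_pos.2 hy1; omega)
      have hy2 : (m : ℝ) + 1 ≤ y := by
        have := Nat.floor_le hy.le; rw [hm] at this; exact_mod_cast this
      have hy3 : y < m + 2 := by
        have := Nat.lt_floor_add_one y; rw [hm] at this; push_cast at this; linarith
      have hm0 : (0 : ℝ) ≤ m := Nat.cast_nonneg m
      have h1 := h y hy (m + 1) (Nat.succ_ne_zero m)
      have t1 : ENNReal.ofReal (y ^ (2 - α)) * (ENNReal.ofReal (((m + 1 : ℕ) : ℝ) ^ 2)⁻¹ * N (m + 1)) ≤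
          ∑' n : ℕ, ENNReal.ofReal (1 / ((n : ℝ) + 1)) * (K1 y n * D n) := by
        refine le_trans ?_ (ENNReal.le_tsum m)
        simp only [hK1, hy2, hy3, and_self, if_true]
        rw [hND, ← mul_assoc, ← mul_assoc, ← mul_assoc, ← ENNReal.ofReal_mul (by positivity),
          ← ENNReal.ofReal_mul (by positivity), ← ENNReal.ofReal_mul (by positivity)]
        refine mul_le_mul_left (ENNReal.ofReal_le_ofReal ?_) _
        push_cast
        have hmp : (0 : ℝ) < m + 1 := by positivity
        have e1 : (((m : ℝ) + 1) ^ 2)⁻¹ * ((m : ℝ) + 1) ^ α = (((m : ℝ) + 1) ^ (2 - α))⁻¹ := by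
          rw [Real.rpow_sub hmp, Real.rpow_two]; field_simp
        have e2 : y ^ (2 - α) ≤ 4 * ((m : ℝ) + 1) ^ (2 - α) := by
          calc y ^ (2 - α) ≤ (2 * ((m : ℝ) + 1)) ^ (2 - α) :=
                Real.rpow_le_rpow hy.le (by linarith) (by linarith)
            _ = 2 ^ (2 - α) * ((m : ℝ) + 1) ^ (2 - α) := Real.mul_rpow (by norm_num) hmp.le
            _ ≤ 2 ^ (2 : ℝ) * ((m : ℝ) + 1) ^ (2 - α) := by
                gcongr
                · norm_num
                · linarith
            _ = _ := by norm_num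
        rw [mul_assoc, e1, ← div_eq_mul_inv, div_le_iff₀ (by positivity)]
        calc _ ≤ _ := e2
          _ = _ := by field_simp
      have t2 : ENNReal.ofReal (y ^ (2 - α)) * (ENNReal.ofReal ((y ^ 2)⁻¹ * ((m + 1 : ℕ) : ℝ)⁻¹) *
          ∑ i ∈ Finset.range (m + 1), N i) ≤
          2 * ∑' n : ℕ, ENNReal.ofReal (1 / ((n : ℝ) + 1)) * (K2 y n * D n) := by
        rw [Finset.sum_range_succ', hN0, add_zero, Finset.mul_sum, Finset.mul_sum,
          ← ENNReal.tsum_mul_left]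
        refine le_trans (Finset.sum_le_sum fun n hn => ?_) (ENNReal.sum_le_tsum (Finset.range m))
        have hn : n < m := Finset.mem_range.1 hn
        have hny : (n : ℝ) + 1 ≤ y := by
          have : (n : ℝ) + 1 ≤ m := by exact_mod_cast hn
          linarith
        simp only [hK2, hny, if_true]
        rw [hND, ← mul_assoc, ← mul_assoc, ← mul_assoc, ← mul_assoc,
          ← ENNReal.ofReal_mul (by positivity),
          ← ENNReal.ofReal_mul (by positivity), ← ENNReal.ofReal_ofNat 2,
          ← ENNReal.ofReal_mul (by positivity), ← ENNReal.ofReal_mul (by positivity)]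
        refine mul_le_mul_left (ENNReal.ofReal_le_ofReal ?_) _
        push_cast
        have hmp : (0 : ℝ) < m + 1 := by positivity
        have hnp : (0 : ℝ) < (n : ℝ) + 1 := by positivity
        have hya : 0 < y ^ α := by positivity
        have hna : 0 < ((n : ℝ) + 1) ^ α := by positivity
        rw [Real.rpow_sub hy, Real.rpow_two, Real.div_rpow hnp.le hy.le, Real.rpow_add hnp,
          Real.rpow_add hy, Real.rpow_one, Real.rpow_one]
        have e1 : y ^ 2 / y ^ α * ((y ^ 2)⁻¹ * ((m : ℝ) + 1)⁻¹) * ((n : ℝ) + 1) ^ α =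
            ((n : ℝ) + 1) ^ α / y ^ α * ((m : ℝ) + 1)⁻¹ := by field_simp
        have e2 : 2 * (1 / ((n : ℝ) + 1)) * (((n : ℝ) + 1) ^ α * ((n : ℝ) + 1) / (y ^ α * y)) =
            ((n : ℝ) + 1) ^ α / y ^ α * (2 / y) := by field_simp
        rw [e1, e2]
        gcongr
        rw [inv_eq_one_div, div_le_div_iff₀ hmp hy]
        linarith
      calc ENNReal.ofReal (y ^ (2 - α)) * a y
          ≤ ENNReal.ofReal (y ^ (2 - α)) * (C * (ENNReal.ofReal (((m + 1 : ℕ) : ℝ) ^ 2)⁻¹ * N (m + 1) +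
            ENNReal.ofReal ((y ^ 2)⁻¹ * ((m + 1 : ℕ) : ℝ)⁻¹) * ∑ i ∈ Finset.range (m + 1), N i)) := by
            gcongr
        _ = C * (ENNReal.ofReal (y ^ (2 - α)) * (ENNReal.ofReal (((m + 1 : ℕ) : ℝ) ^ 2)⁻¹ * N (m + 1)) +
            ENNReal.ofReal (y ^ (2 - α)) * (ENNReal.ofReal ((y ^ 2)⁻¹ * ((m + 1 : ℕ) : ℝ)⁻¹) *
              ∑ i ∈ Finset.range (m + 1), N i)) := by ring
        _ ≤ _ := by
            gcongr
            exact t2.trans le_self_add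
  · filter_upwards [ae_haarPos_pos] with y hy
    have hexp : ∫⁻ n, K y n ∂logMeas =
        C * (∑' n : ℕ, ENNReal.ofReal (1 / ((n : ℝ) + 1)) * K1 y n +
          (2 * ∑' n : ℕ, ENNReal.ofReal (1 / ((n : ℝ) + 1)) * K2 y n +
            ∑' n : ℕ, ENNReal.ofReal (1 / ((n : ℝ) + 1)) * K3 y n)) := by
      rw [lintegral_logMeas, ← ENNReal.tsum_mul_left, ← ENNReal.tsum_add, ← ENNReal.tsum_add,
        ← ENNReal.tsum_mul_left]
      refine tsum_congr fun n => ?_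
      simp only [hK]; ring
    rw [hexp, hM]
    gcongr
    · refine le_trans (le_of_eq ?_) (tsum_ite_Ico_le y 4)
      refine tsum_congr fun n => ?_
      simp only [hK1]
      split_ifs
      · rw [← ENNReal.ofReal_mul (by positivity), ← ENNReal.ofReal_ofNat 4]
        congr 1
        field_simp
      · simp
    · exact tsum_rpow_le hα0 hy
    · refine le_add_right ?_
      rw [tsum_eq_single 0 (fun n hn => by simp [hK3, hn])]
      simp only [hK3, if_true, Nat.cast_zero, zero_add, div_one, ENNReal.ofReal_one, one_mul]
      split_ifs with hy1
      · rw [← ENNReal.ofReal_one]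
        exact ENNReal.ofReal_le_ofReal (Real.rpow_le_one hy.le hy1 (by linarith))
      · exact zero_le
  · refine Eventually.of_forall fun n => ?_
    simp only [hK]
    rw [lintegral_const_mul _ (f := fun y => K1 y n + (2 * K2 y n + K3 y n)) ((m1 n).add (((m2 n).const_mul 2).add (m3 n))),
      lintegral_add_left (f := fun y => K1 y n) (m1 n),
      lintegral_add_left (f := fun y => 2 * K2 y n) ((m2 n).const_mul 2),
      lintegral_const_mul _ (f := fun y => K2 y n) (m2 n), hM]
    gcongr
    · exact lintegral_haarPos_Ico_le n
    · refine (lintegral_haarPos_ge (by positivity) (by linarith)).trans ?_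
      rw [← ENNReal.ofReal_one]
      refine ENNReal.ofReal_le_ofReal ?_
      rw [div_le_one (by linarith)]; linarith
    · refine le_add_left ?_
      by_cases hn : n = 0
      · simp only [hK3, hn, if_true]
        exact lintegral_haarPos_le one_pos (by linarith)
      · simp [hK3, hn]

end DiscreteBesov

end

/-! ### The converse Hardy inequalities and the second difference condition over `ℕ`. -/

noncomputable section

namespace DiscreteBesov

open Filter Topology Set

/-- The term of index `n` is compared with the integral over `[n + 1, n + 2)`, where `x ≤ 2 (n +
1)`; replacing `n + 1` by `x` costs `2^(α + 1)`. -/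
lemma tsum_div_rpow_le {α b : ℝ} (hα : 0 < α) (hb : 0 < b) :
    ∑' n : ℕ, ENNReal.ofReal (1 / ((n : ℝ) + 1)) *
      (if b ≤ (n : ℝ) + 1 then ENNReal.ofReal ((b / ((n : ℝ) + 1)) ^ α) else 0) ≤
    ENNReal.ofReal (2 ^ (α + 1)) * ENNReal.ofReal (1 / α) := by
  set G : ℝ → ℝ≥0∞ := fun x => ENNReal.ofReal (2 ^ (α + 1)) * (ENNReal.ofReal (1 / x) *
    (if b ≤ x then ENNReal.ofReal ((b / x) ^ α) else 0)) with hG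
  have mI : Measurable fun x : ℝ => if b ≤ x then ENNReal.ofReal ((b / x) ^ α) else 0 :=
    Measurable.ite measurableSet_Ici (by fun_prop) measurable_const
  have mG : Measurable G := (measurable_ofReal_one_div.mul mI).const_mul _
  have key : ∀ n : ℕ, ENNReal.ofReal (1 / ((n : ℝ) + 1)) *
      (if b ≤ (n : ℝ) + 1 then ENNReal.ofReal ((b / ((n : ℝ) + 1)) ^ α) else 0) ≤
      ∫⁻ x in Ioi (0 : ℝ), (if (n : ℝ) + 1 ≤ x ∧ x < n + 2 then G x else 0) := by
    intro n
    have hn : (0 : ℝ) ≤ n := Nat.cast_nonneg n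
    split_ifs with h
    · have e : ∫⁻ x in Ioi (0 : ℝ), (if (n : ℝ) + 1 ≤ x ∧ x < n + 2 then G x else 0) =
          ∫⁻ x in Ico ((n : ℝ) + 1) (n + 2), G x := by
        calc _ = ∫⁻ x in Ioi (0 : ℝ), (Ico ((n : ℝ) + 1) (n + 2)).indicator G x :=
              lintegral_congr fun x => by simp [indicator, mem_Ico]
          _ = _ := by
              rw [setLIntegral_indicator measurableSet_Ico, inter_eq_left.2]
              exact fun x hx => lt_of_lt_of_le (by linarith) hx.1
      rw [e]
      calc _ = ∫⁻ x in Ico ((n : ℝ) + 1) (n + 2), ENNReal.ofReal (1 / ((n : ℝ) + 1)) *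
            ENNReal.ofReal ((b / ((n : ℝ) + 1)) ^ α) := by
            rw [setLIntegral_const, Real.volume_Ico]; norm_num
        _ ≤ _ := by
            refine setLIntegral_mono' measurableSet_Ico fun x hx => ?_
            have hx0 : 0 < x := by linarith [hx.1]
            have hn1 : (0 : ℝ) < n + 1 := by linarith
            simp only [hG, h.trans hx.1, if_true]
            rw [← ENNReal.ofReal_mul (by positivity), ← ENNReal.ofReal_mul (by positivity),
              ← ENNReal.ofReal_mul (by positivity)]
            refine ENNReal.ofReal_le_ofReal ?_
            calc 1 / ((n : ℝ) + 1) * (b / ((n : ℝ) + 1)) ^ α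
                ≤ 2 / x * (2 * (b / x)) ^ α := by
                  have h1 : 1 / ((n : ℝ) + 1) ≤ 2 / x := by
                    rw [div_le_div_iff₀ hn1 hx0]; linarith [hx.2]
                  gcongr
                  calc b / ((n : ℝ) + 1) = b * (1 / ((n : ℝ) + 1)) := by ring
                    _ ≤ b * (2 / x) := by gcongr
                    _ = _ := by ring
              _ = _ := by
                  rw [Real.mul_rpow (by norm_num) (by positivity), Real.rpow_add (by norm_num),
                    Real.rpow_one]
                  ring
    · simp
  calc _ ≤ ∑' n : ℕ, ∫⁻ x in Ioi (0 : ℝ), (if (n : ℝ) + 1 ≤ x ∧ x < n + 2 then G x else 0) :=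
        ENNReal.tsum_le_tsum key
    _ = ∫⁻ x in Ioi (0 : ℝ), ∑' n : ℕ, (if (n : ℝ) + 1 ≤ x ∧ x < n + 2 then G x else 0) := by
        rw [lintegral_tsum]
        exact fun n => (Measurable.ite ((measurableSet_Ici (a := (n : ℝ) + 1)).inter
          measurableSet_Iio) mG measurable_const).aemeasurable
    _ ≤ ∫⁻ x in Ioi (0 : ℝ), G x := lintegral_mono fun x => tsum_ite_Ico_le x (G x)
    _ ≤ _ := by
        simp only [hG]
        rw [lintegral_const_mul' _ _ ENNReal.ofReal_ne_top]
        refine mul_le_mul_right ?_ _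
        rw [← lintegral_haarPos fun x => if b ≤ x then ENNReal.ofReal ((b / x) ^ α) else 0]
        exact lintegral_haarPos_ge hb hα

lemma aemeasurable_rpow_mul_of_antitoneOn {a : ℝ → ℝ≥0∞} (ha : AntitoneOn a (Ioi 0)) (c : ℝ) :
    AEMeasurable (fun y => ENNReal.ofReal (y ^ c) * a y) haarPos :=
  Measurable.aemeasurable (by fun_prop) |>.mul (aemeasurable_haarPos_of_antitoneOn ha)

/-- From the continuous to the discrete mixed norm. -/
lemma eLpNorm_logMeas_lt_top_of_haarPos {α : ℝ} (hα : 0 < α) {q : ℝ≥0∞} (hq : 1 ≤ q)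
    {a : ℝ → ℝ≥0∞} (ha : AntitoneOn a (Ioi 0)) {N : ℕ → ℝ≥0∞} {C : ℝ≥0∞} (hC : C ≠ ∞)
    (h : ∀ n : ℕ, N n ≤ C * ∫⁻ s in Ioc 0 (2 * ((n : ℝ) + 1)), ENNReal.ofReal s * a s)
    (hB : eLpNorm (fun y => ENNReal.ofReal (y ^ (2 - α)) * a y) q haarPos < ∞) :
    eLpNorm (fun n : ℕ => ENNReal.ofReal (((n : ℝ) + 1) ^ α)⁻¹ * N n) q logMeas < ∞ := by
  -- Since `s a(s) ds = s^α · (s^{2-α} a(s)) ds / s`, the kernel is `(s / (n + 1))^α` cut off at `2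
  -- (n + 1)`. Normalising it by the cut-off accounts for the factor `2^α` in `C'`.
  set K0 : ℕ → ℝ → ℝ≥0∞ := fun n s => if s ≤ 2 * ((n : ℝ) + 1) then
    ENNReal.ofReal ((s / (2 * ((n : ℝ) + 1))) ^ α) else 0 with hK0
  have m0 : ∀ n, Measurable (K0 n) := fun n =>
    Measurable.ite measurableSet_Iic (by fun_prop) measurable_const
  set C' : ℝ≥0∞ := C * ENNReal.ofReal (2 ^ α) with hC'
  have hC't : C' ≠ ∞ := ENNReal.mul_ne_top hC ENNReal.ofReal_ne_top
  set M : ℝ≥0∞ := C' * (ENNReal.ofReal (1 / α) +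
    ENNReal.ofReal (2 ^ (α + 1)) * ENNReal.ofReal (1 / α)) with hM
  have hMt : M ≠ ∞ := ENNReal.mul_ne_top hC't (by
    simp [ENNReal.add_eq_top, ENNReal.mul_eq_top])
  have hS := eLpNorm_lintegral_mul_le (μ := logMeas) (ν := haarPos) (K := fun n s => C' * K0 n s)
    (B := fun y => ENNReal.ofReal (y ^ (2 - α)) * a y) (M := M)
    (measurable_from_prod_countable_right fun n => (m0 n).const_mul _)
    (aemeasurable_rpow_mul_of_antitoneOn ha _) hq ?_ ?_
  · refine lt_of_le_of_lt (eLpNorm_mono_enorm fun n => ?_) (hS.trans_lt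
      (ENNReal.mul_lt_top hMt.lt_top hB))
    simp only [enorm_eq_self]
    have hn : (0 : ℝ) < (n : ℝ) + 1 := by positivity
    refine (mul_le_mul_right (h n) _).trans (le_of_eq ?_)
    rw [lintegral_haarPos, ← mul_assoc, ← lintegral_const_mul' _ _ (ENNReal.mul_ne_top
      ENNReal.ofReal_ne_top hC), ← Ioi_inter_Iic, inter_comm, ← setLIntegral_indicator
      measurableSet_Iic]
    refine setLIntegral_congr_fun measurableSet_Ioi fun s hs => ?_
    have hs : 0 < s := hs
    by_cases hsn : s ≤ 2 * ((n : ℝ) + 1)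
    · rw [indicator_of_mem (mem_Iic.2 hsn)]
      simp only [hK0, hsn, if_true, hC']
      have e : ENNReal.ofReal (((n : ℝ) + 1) ^ α)⁻¹ * ENNReal.ofReal s =
          ENNReal.ofReal (1 / s) * ENNReal.ofReal (2 ^ α) *
            ENNReal.ofReal ((s / (2 * ((n : ℝ) + 1))) ^ α) * ENNReal.ofReal (s ^ (2 - α)) := by
        rw [← ENNReal.ofReal_mul (by positivity), ← ENNReal.ofReal_mul (by positivity),
          ← ENNReal.ofReal_mul (by positivity), ← ENNReal.ofReal_mul (by positivity),
          Real.div_rpow hs.le (by positivity), Real.mul_rpow (by norm_num) hn.le,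
          Real.rpow_sub hs, Real.rpow_two]
        have : 0 < s ^ α := by positivity
        have : 0 < ((n : ℝ) + 1) ^ α := by positivity
        congr 1
        field_simp
      calc _ = C * (ENNReal.ofReal (((n : ℝ) + 1) ^ α)⁻¹ * ENNReal.ofReal s) * a s := by ring
        _ = _ := by rw [e]; ring
    · rw [indicator_of_notMem (by simpa using hsn)]
      simp [hK0, hsn]
  · refine Eventually.of_forall fun n => ?_
    rw [lintegral_const_mul _ (m0 n), hM]
    refine mul_le_mul_right (le_add_right ?_) _
    exact lintegral_haarPos_le (by positivity) hα
  · filter_upwards [ae_haarPos_pos] with s hs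
    rw [lintegral_const_mul _ Measurable.of_discrete, hM, lintegral_logMeas]
    refine mul_le_mul_right (le_add_left ?_) _
    refine (le_of_eq (tsum_congr fun n => ?_)).trans (tsum_div_rpow_le hα (half_pos hs))
    simp only [hK0, div_le_iff₀ (two_pos : (0 : ℝ) < 2), div_div, mul_comm (2 : ℝ)]

/-- Hardy's inequality for a tail integral. -/
lemma eLpNorm_haarPos_tail_lt_top {α : ℝ} (hα : α < 1) {q : ℝ≥0∞} (hq : 1 ≤ q)
    {a D : ℝ → ℝ≥0∞} (ha : AntitoneOn a (Ioi 0)) (h : ∀ y, 0 < y → D y ≤ ∫⁻ s in Ioi y, a s)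
    (hB : eLpNorm (fun y => ENNReal.ofReal (y ^ (2 - α)) * a y) q haarPos < ∞) :
    eLpNorm (fun y => ENNReal.ofReal (y ^ (1 - α)) * D y) q haarPos < ∞ := by
  -- Here `y^{1-α} a(s) ds = (y / s)^{1-α} · (s^{2-α} a(s)) ds / s`; both marginals are finite
  -- because `α < 1`.
  set K : ℝ → ℝ → ℝ≥0∞ := fun y s => if y ≤ s then ENNReal.ofReal ((y / s) ^ (1 - α)) else 0
    with hK
  have mK : Measurable (Function.uncurry K) :=
    Measurable.ite (measurableSet_le measurable_fst measurable_snd) (by fun_prop) measurable_const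
  have hS := eLpNorm_lintegral_mul_le (μ := haarPos) (ν := haarPos) (K := K)
    (B := fun y => ENNReal.ofReal (y ^ (2 - α)) * a y) (M := ENNReal.ofReal (1 / (1 - α)))
    mK (aemeasurable_rpow_mul_of_antitoneOn ha _) hq ?_ ?_
  · refine lt_of_le_of_lt (eLpNorm_mono_enorm_ae ?_) (hS.trans_lt
      (ENNReal.mul_lt_top ENNReal.ofReal_lt_top hB))
    filter_upwards [ae_haarPos_pos] with y hy
    simp only [enorm_eq_self]
    refine (mul_le_mul_right (h y hy) _).trans ?_
    rw [lintegral_haarPos, ← lintegral_const_mul' _ _ ENNReal.ofReal_ne_top]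
    refine le_trans (le_of_eq ?_) (lintegral_mono_set (Ioi_subset_Ioi hy.le))
    refine setLIntegral_congr_fun measurableSet_Ioi fun s hs => ?_
    have hys : y ≤ s := le_of_lt hs
    have hs : 0 < s := hy.trans_le hys
    simp only [hK, hys, if_true]
    rw [← mul_assoc, ← mul_assoc, ← ENNReal.ofReal_mul (by positivity),
      mul_assoc (ENNReal.ofReal _), ← mul_assoc, ← ENNReal.ofReal_mul (by positivity),
      Real.div_rpow hy.le hs.le, show (2 : ℝ) - α = (1 - α) + 1 by ring, Real.rpow_add hs,
      Real.rpow_one]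
    have : 0 < s ^ (1 - α) := by positivity
    congr 2
    field_simp
  · filter_upwards [ae_haarPos_pos] with y hy
    exact lintegral_haarPos_ge hy (by linarith)
  · filter_upwards [ae_haarPos_pos] with s hs
    exact lintegral_haarPos_le hs (by linarith)

lemma secondDiffNorm_eq (α : ℝ) (p : ℝ≥0∞) (f : ℤ → ℝ) (j : ℤ) :
    secondDiffNorm α p f j = ENNReal.ofReal (|(j : ℝ)| ^ α)⁻¹ * ellNorm p (sdiff j f) := by
  have h0 : 0 ≤ (|(j : ℝ)| ^ α)⁻¹ := by positivity
  rw [← abs_of_nonneg h0, ← ellNorm_const_mul]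
  unfold secondDiffNorm sdiff
  congr 1
  funext n
  rw [div_eq_inv_mul]

lemma secondDiffNorm_natCast (α : ℝ) (p : ℝ≥0∞) (f : ℤ → ℝ) (n : ℕ) :
    secondDiffNorm α p f ((n : ℤ) + 1) =
      ENNReal.ofReal (((n : ℝ) + 1) ^ α)⁻¹ * ellNorm p (sdiff ((n : ℤ) + 1) f) := by
  rw [secondDiffNorm_eq]
  push_cast
  rw [abs_of_pos (by positivity)]

lemma secondDiffNorm_neg (α : ℝ) (p : ℝ≥0∞) (f : ℤ → ℝ) (j : ℤ) :
    secondDiffNorm α p f (-j) = secondDiffNorm α p f j := by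
  rw [secondDiffNorm_eq, secondDiffNorm_eq, sdiff_neg]
  push_cast
  rw [abs_neg]

/-- Second differences are even in the step, so the sum over `j ≠ 0` is twice the sum over positive
`j`, and the suprema agree. Index `n` stands for step `n + 1`. -/
lemma secondDiffCondition_iff (α : ℝ) (p : ℝ≥0∞) {q : ℝ≥0∞} (hq : 1 ≤ q) (f : ℤ → ℝ) :
    SecondDiffCondition α p q f ↔
      eLpNorm (fun n : ℕ => ENNReal.ofReal (((n : ℝ) + 1) ^ α)⁻¹ *
        ellNorm p (sdiff ((n : ℤ) + 1) f)) q logMeas < ∞ := by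
  simp only [← secondDiffNorm_natCast]
  unfold SecondDiffCondition
  rcases eq_or_ne q ∞ with rfl | hqt
  · simp only [ne_eq, not_true_eq_false, false_imp_iff, true_and, forall_const,
      eLpNorm_exponent_top, eLpNormEssSup_logMeas]
    have e : (⨆ j : {j : ℤ // j ≠ 0}, secondDiffNorm α p f j) =
        ⨆ n : ℕ, secondDiffNorm α p f ((n : ℤ) + 1) := by
      refine le_antisymm (iSup_le fun j => ?_)
        (iSup_le fun n => le_iSup_of_le ⟨(n : ℤ) + 1, by positivity⟩ le_rfl)
      obtain ⟨j, hj⟩ := j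
      have hn : ∃ n : ℕ, j = (n : ℤ) + 1 ∨ j = -((n : ℤ) + 1) := ⟨j.natAbs - 1, by omega⟩
      obtain ⟨n, rfl | rfl⟩ := hn
      · exact le_iSup (fun n : ℕ => secondDiffNorm α p f ((n : ℤ) + 1)) n
      · simp only [secondDiffNorm_neg]
        exact le_iSup (fun n : ℕ => secondDiffNorm α p f ((n : ℤ) + 1)) n
    rw [e]
  · simp only [ne_eq, hqt, not_false_eq_true, forall_const, false_imp_iff, and_true]
    have hq0 : q ≠ 0 := (zero_lt_one.trans_le hq).ne'
    have hqr : 0 < q.toReal := ENNReal.toReal_pos hq0 hqt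
    rw [eLpNorm_lt_top_iff_lintegral_rpow_enorm_lt_top hq0 hqt, lintegral_logMeas]
    simp only [enorm_eq_self]
    set g : ℤ → ℝ≥0∞ := fun j => if j = 0 then 0 else
      secondDiffNorm α p f j ^ q.toReal * ENNReal.ofReal (1 / |(j : ℝ)|) with hg
    have e1 : (∑' j : {j : ℤ // j ≠ 0},
        secondDiffNorm α p f j ^ q.toReal * ENNReal.ofReal (1 / |((j : ℤ) : ℝ)|)) =
        ∑' j : ℤ, g j := by
      have : ∀ j : {j : ℤ // j ≠ 0}, secondDiffNorm α p f j ^ q.toReal *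
          ENNReal.ofReal (1 / |((j : ℤ) : ℝ)|) = g j := fun j => by simp [hg, j.2]
      rw [tsum_congr this]
      refine tsum_subtype_eq_of_support_subset (s := {j : ℤ | j ≠ 0}) fun j hj hj0 => hj ?_
      simp [hg, hj0]
    set T := ∑' n : ℕ, ENNReal.ofReal (1 / ((n : ℝ) + 1)) *
      secondDiffNorm α p f ((n : ℤ) + 1) ^ q.toReal with hT
    have hp : ∀ n : ℕ, g ((n : ℤ) + 1) = ENNReal.ofReal (1 / ((n : ℝ) + 1)) *
      secondDiffNorm α p f ((n : ℤ) + 1) ^ q.toReal := fun n => by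
      have : (n : ℤ) + 1 ≠ 0 := by positivity
      simp only [hg, this, if_false, mul_comm]
      push_cast
      rw [abs_of_pos (by positivity)]
    have hm : ∀ n : ℕ, g (-((n : ℤ) + 1)) = ENNReal.ofReal (1 / ((n : ℝ) + 1)) *
      secondDiffNorm α p f ((n : ℤ) + 1) ^ q.toReal := fun n => by
      rw [← hp]
      simp only [hg, neg_eq_zero, secondDiffNorm_neg]
      push_cast
      rw [abs_neg]
    have e2 : ∑' j : ℤ, g j = T + T := by
      rw [tsum_of_nat_of_neg_add_one ENNReal.summable ENNReal.summable,
        tsum_eq_zero_add' ENNReal.summable]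
      simp only [Nat.cast_add, Nat.cast_one, hp, hm]
      simp [hg, hT]
    rw [e1, e2, ENNReal.add_lt_top, and_self]

end DiscreteBesov

end

noncomputable section

namespace DiscreteBesov

open Filter Topology Set

/-! ### Semigroup estimates -/

lemma mixedNorm_eq {p q : ℝ≥0∞} {c : ℝ} {F U : ℝ → ℤ → ℝ}
    (h : ∀ t, 0 < t → ∀ n, F t n = t ^ c * U t n) :
    mixedNorm p q F = eLpNorm (fun t => ENNReal.ofReal (t ^ c) * ellNorm p (U t)) q haarPos := by
  refine eLpNorm_congr_ae ?_
  filter_upwards [ae_haarPos_pos] with t ht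
  rw [show F t = fun n => t ^ c * U t n from funext (h t ht), ellNorm_const_mul,
    abs_of_pos (Real.rpow_pos_of_pos ht c)]

lemma sym_add (g μ : ℝ → ℝ) (s t : ℝ) :
    sym g μ (s + t) = fun x => sym (fun _ => 1) μ s x * sym g μ t x := by
  funext x
  simp only [sym, one_mul, add_mul, neg_add, Real.exp_add]
  ring

/-- For `t < r` the symbol at `r` is the one at `t` times `e^{-(r - t)μ}`, the symbol of a
contraction. Monotonicity supplies both measurability in the parameter and the comparison of scales.
-/
lemma antitone_ellNorm_op_sym {p : ℝ≥0∞} (hp : 1 ≤ p) {g μ : ℝ → ℝ} (hg : ContDiff ℝ 2 g)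
    (hμ : ContDiff ℝ 2 μ) (h1 : ∀ s, 0 < s → ellOne (kern (sym (fun _ => 1) μ s)) ≤ 1) {f : ℤ → ℝ}
    (hf : SummabilityCondition f) : Antitone fun t => ellNorm p (op (kern (sym g μ t)) f) := by
  intro t r htr
  rcases htr.eq_or_lt with rfl | htr
  · exact le_rfl
  have e : sym g μ r = fun x => sym (fun _ => 1) μ (r - t) x * sym g μ t x := by
    rw [← sym_add, sub_add_cancel]
  simp only [e, op_kern_mul (contDiff_sym contDiff_const hμ _) (contDiff_sym hg hμ _) hf]
  calc _ ≤ _ := ellNorm_op_le hp _ _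
    _ ≤ 1 * _ := mul_le_mul_left (h1 _ (sub_pos.2 htr)) _
    _ = _ := one_mul _

lemma ellNorm_le_lintegral {p : ℝ≥0∞} (hp : 1 ≤ p) {U : ℝ → ℤ → ℝ}
    (hU : ∀ n, Continuous fun s => U s n) {s : Set ℝ} {w : ℝ → ℝ} (hw : Continuous w) {F : ℤ → ℝ}
    (h : ∀ n, ‖F n‖ₑ ≤ ∫⁻ x in s, ‖w x * U x n‖ₑ) :
    ellNorm p F ≤ ∫⁻ x in s, ENNReal.ofReal |w x| * ellNorm p (U x) := by
  refine (ellNorm_mono h).trans ((eLpNorm_count_lintegral_le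
    (fun n => (hw.mul (hU n)).measurable.enorm) hp).trans_eq ?_)
  refine lintegral_congr fun x => ?_
  rw [← ellNorm_const_mul, eLpNorm_enorm]
  rfl

lemma enorm_intervalIntegral_le {g : ℝ → ℝ} {a b : ℝ} (hab : a ≤ b) :
    ‖∫ x in a..b, g x‖ₑ ≤ ∫⁻ x in Ioc a b, ‖g x‖ₑ := by
  rw [intervalIntegral.integral_of_le hab]
  exact enorm_integral_le_lintegral_enorm _

/-- `f - T_{y²} f`, for the heat semigroup, is controlled by an integral of `∂_t T_t f`. -/
lemma ellNorm_heat_sub_le {p : ℝ≥0∞} (hp : 1 ≤ p) {f : ℤ → ℝ} (hf : SummabilityCondition f)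
    {y : ℝ} (hy : 0 < y) :
    ellNorm p (f - op (kern (heatSym (fun _ => 1) (y ^ 2))) f) ≤
      2 * ∫⁻ s in Ioc 0 y, ENNReal.ofReal s *
        ellNorm p (op (kern (heatSym (fun x => -x ^ 2) (s ^ 2))) f) := by
  have hμ : ContDiff ℝ 2 fun x : ℝ => x ^ 2 := by fun_prop
  have hg : ContDiff ℝ 2 fun x : ℝ => -x ^ 2 := by fun_prop
  have hc : ∀ n, Continuous fun s : ℝ => op (kern (heatSym (fun x => -x ^ 2) (s ^ 2))) f n :=
    fun n => (continuous_op_sym hg hμ hf n).comp (continuous_pow 2)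
  have hd : ∀ n s, HasDerivAt (fun s : ℝ => op (kern (heatSym (fun _ => 1) (s ^ 2))) f n)
      (2 * s * op (kern (heatSym (fun x => -x ^ 2) (s ^ 2))) f n) s := by
    intro n s
    have h := (hasDerivAt_op_sym (contDiff_const (c := (1 : ℝ))) hμ hf n (s ^ 2)).comp s
      (hasDerivAt_pow 2 s)
    refine h.congr_deriv ?_
    simp only [mul_one]
    norm_num
    ring
  have key : ∀ n, (f - op (kern (heatSym (fun _ => 1) (y ^ 2))) f) n =
      ∫ s in (0 : ℝ)..y, (-2 * s) * op (kern (heatSym (fun x => -x ^ 2) (s ^ 2))) f n := by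
    intro n
    have h0 : op (kern (heatSym (fun _ => 1) (0 ^ 2))) f = f := by
      rw [show heatSym (fun _ => 1) (0 ^ 2) = fun _ => 1 by funext x; simp [sym], op_kern_one]
    have h := intervalIntegral.integral_eq_sub_of_hasDerivAt (fun s _ => hd n s)
      (((continuous_const.mul continuous_id).mul (hc n)).intervalIntegrable 0 y)
    rw [h0] at h
    simp only [Pi.sub_apply, neg_mul, intervalIntegral.integral_neg]
    rw [h]; ring
  refine (ellNorm_le_lintegral hp hc (s := Ioc 0 y) (w := fun s => -2 * s) (by fun_prop)
    fun n => ?_).trans_eq ?_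
  · rw [key]; exact enorm_intervalIntegral_le hy.le
  · rw [← lintegral_const_mul' _ _ (by simp)]
    refine setLIntegral_congr_fun measurableSet_Ioc fun s hs => ?_
    rw [← mul_assoc, abs_mul, abs_neg, abs_two, abs_of_pos hs.1, ENNReal.ofReal_mul (by norm_num),
      ENNReal.ofReal_ofNat]

lemma hasDerivAt_op_poisSym_one {f : ℤ → ℝ} (hf : SummabilityCondition f) (n : ℤ) (s : ℝ) :
    HasDerivAt (fun s => op (kern (poisSym (fun _ => 1) s)) f n)
      (op (kern (poisSym (fun x => -x) s)) f n) s := by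
  have h := hasDerivAt_op_sym (contDiff_const (c := (1 : ℝ))) (μ := fun x => x) contDiff_id hf n s
  simp only [mul_one] at h
  exact h

lemma hasDerivAt_op_poisSym_id {f : ℤ → ℝ} (hf : SummabilityCondition f) (n : ℤ) (s : ℝ) :
    HasDerivAt (fun s => op (kern (poisSym (fun x => -x) s)) f n)
      (op (kern (poisSym (fun x => x ^ 2) s)) f n) s := by
  have h := hasDerivAt_op_sym (g := fun x => -x) (μ := fun x => x) contDiff_id.neg contDiff_id hf n s
  simp only [← pow_two, neg_sq] at h
  exact h

/-- The second difference in `y` of the Poisson semigroup at `y = 0` is controlled by an integral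
of `∂_y² P_y f`. -/
lemma ellNorm_pois_sub_le {p : ℝ≥0∞} (hp : 1 ≤ p) {f : ℤ → ℝ} (hf : SummabilityCondition f)
    {y : ℝ} (hy : 0 < y) :
    ellNorm p (f - fun n => 2 * op (kern (poisSym (fun _ => 1) y)) f n -
        op (kern (poisSym (fun _ => 1) (2 * y))) f n) ≤
      ∫⁻ s in Ioc 0 (2 * y), ENNReal.ofReal s *
        ellNorm p (op (kern (poisSym (fun x => x ^ 2) s)) f) := by
  have hμ : ContDiff ℝ 2 fun x : ℝ => x := by fun_prop
  have hg : ContDiff ℝ 2 fun x : ℝ => x ^ 2 := by fun_prop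
  set u := fun s n => op (kern (poisSym (fun _ => 1) s)) f n with hu
  set u' := fun s n => op (kern (poisSym (fun x => -x) s)) f n with hu'
  set U := fun s n => op (kern (poisSym (fun x => x ^ 2) s)) f n with hU
  have hc : ∀ n, Continuous fun s => U s n := fun n => continuous_op_sym hg hμ hf n
  have d1 : ∀ n s, HasDerivAt (fun s => u s n) (u' s n) s := hasDerivAt_op_poisSym_one hf
  have d2 : ∀ n s, HasDerivAt (fun s => u' s n) (U s n) s := hasDerivAt_op_poisSym_id hf
  -- The triangle function is the Peano kernel of the second difference at `0`, `y`, `2 y`. Using `2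
  -- P_y - P_{2y}` instead of `P_y` removes the first-order term in `y`, which would only serve `α <
  -- 1`.
  have hw : Continuous fun s : ℝ => min s (2 * y - s) := by fun_prop
  have key : ∀ n, (f - fun n => 2 * u y n - u (2 * y) n) n =
      ∫ s in (0 : ℝ)..(2 * y), min s (2 * y - s) * U s n := by
    intro n
    have h0 : u 0 n = f n := by
      simp only [hu]
      rw [show poisSym (fun _ => 1) 0 = fun _ => 1 by funext x; simp [sym], op_kern_one]
    have i1 : ∫ s in (0 : ℝ)..y, min s (2 * y - s) * U s n = y * u' y n - u y n + f n := by
      have e : ∫ s in (0 : ℝ)..y, min s (2 * y - s) * U s n = ∫ s in (0 : ℝ)..y, s * U s n := by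
        refine intervalIntegral.integral_congr fun s hs => ?_
        rw [uIcc_of_le hy.le] at hs
        rw [min_eq_left (by linarith [hs.2])]
      have hd : ∀ s, HasDerivAt (fun s => s * u' s n - u s n) (s * U s n) s := fun s =>
        (((hasDerivAt_id s).mul (d2 n s)).sub (d1 n s)).congr_deriv (by simp)
      rw [e, intervalIntegral.integral_eq_sub_of_hasDerivAt (fun s _ => hd s)
        ((continuous_id.mul (hc n)).intervalIntegrable 0 y), h0]
      ring
    have i2 : ∫ s in y..(2 * y), min s (2 * y - s) * U s n = u (2 * y) n - y * u' y n - u y n := by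
      have e : ∫ s in y..(2 * y), min s (2 * y - s) * U s n =
          ∫ s in y..(2 * y), (2 * y - s) * U s n := by
        refine intervalIntegral.integral_congr fun s hs => ?_
        rw [uIcc_of_le (by linarith)] at hs
        rw [min_eq_right (by linarith [hs.1])]
      have hd : ∀ s, HasDerivAt (fun s => (2 * y - s) * u' s n + u s n) ((2 * y - s) * U s n) s :=
        fun s => ((((hasDerivAt_id s).const_sub (2 * y)).mul (d2 n s)).add (d1 n s)).congr_deriv
          (by simp)
      rw [e, intervalIntegral.integral_eq_sub_of_hasDerivAt (fun s _ => hd s)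
        (((continuous_const.sub continuous_id).mul (hc n)).intervalIntegrable y (2 * y))]
      ring
    have hwU : Continuous fun s => min s (2 * y - s) * U s n := hw.mul (hc n)
    rw [← intervalIntegral.integral_add_adjacent_intervals
      (hwU.intervalIntegrable 0 y) (hwU.intervalIntegrable y (2 * y)),
      i1, i2]
    simp only [Pi.sub_apply]
    ring
  refine (ellNorm_le_lintegral hp hc (s := Ioc 0 (2 * y)) hw fun n => ?_).trans ?_
  · rw [key]; exact enorm_intervalIntegral_le (by linarith)
  · refine setLIntegral_mono' measurableSet_Ioc fun s hs => ?_
    refine mul_le_mul_left (ENNReal.ofReal_le_ofReal ?_) _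
    rw [abs_of_nonneg (le_min hs.1.le (by linarith [hs.2]))]
    exact min_le_left _ _

/-- On `(0, r]` the decreasing function `a` is at least `a r`, and `s` integrates to `r² / 2`. -/
lemma sq_mul_le_lintegral {a : ℝ → ℝ≥0∞} (ha : AntitoneOn a (Ioi 0)) {r : ℝ} (hr : 0 < r) :
    ENNReal.ofReal (r ^ 2) * a r ≤ 2 * ∫⁻ s in Ioc 0 r, ENNReal.ofReal s * a s := by
  have e : ∫⁻ s in Ioc 0 r, ENNReal.ofReal s = ENNReal.ofReal (r ^ 2 / 2) := by
    rw [← ofReal_integral_eq_lintegral_ofReal, ← intervalIntegral.integral_of_le hr.le]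
    · simp
    · exact (continuous_id.integrableOn_Icc).mono_set Ioc_subset_Icc_self
    · exact (ae_restrict_iff' measurableSet_Ioc).2 (Eventually.of_forall fun s hs => hs.1.le)
  calc ENNReal.ofReal (r ^ 2) * a r = 2 * ∫⁻ s in Ioc 0 r, ENNReal.ofReal s * a r := by
        rw [lintegral_mul_const _ (by fun_prop), e, ← mul_assoc, ← ENNReal.ofReal_ofNat 2,
          ← ENNReal.ofReal_mul (by norm_num)]
        congr 2
        ring
    _ ≤ _ := by
        refine mul_le_mul_right (setLIntegral_mono' measurableSet_Ioc fun s hs => ?_) _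
        exact mul_le_mul_right (ha hs.1 hr hs.2) _

/-- The part `f - g` is estimated trivially and `g` through its Laplacian, which gives `14 = 4 · 2 +
3 · 2`. The constants in `h1` and `h2` are wide enough for both semigroups: heat needs 2 and 1,
Poisson 1 and 3. -/
lemma ellNorm_sdiff_le_lintegral {p : ℝ≥0∞} (hp : 1 ≤ p) {a : ℝ → ℝ≥0∞} (ha : AntitoneOn a (Ioi 0))
    {f g : ℤ → ℝ} {J : ℕ} (hJ : 0 < J)
    (h1 : ellNorm p (f - g) ≤ 2 * ∫⁻ s in Ioc 0 (2 * (J : ℝ)), ENNReal.ofReal s * a s)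
    (h2 : ellNorm p (lapl g) ≤ 3 * a J) :
    ellNorm p (sdiff J f) ≤ 14 * ∫⁻ s in Ioc 0 (2 * (J : ℝ)), ENNReal.ofReal s * a s := by
  have hJ' : (0 : ℝ) < J := by exact_mod_cast hJ
  set I := ∫⁻ s in Ioc 0 (2 * (J : ℝ)), ENNReal.ofReal s * a s with hI
  have e : sdiff J f = sdiff J (f - g) + sdiff J g := by rw [← sdiff_add, sub_add_cancel]
  have h3 : (J : ℝ≥0∞) ^ 2 * a J ≤ 2 * I := by
    have := sq_mul_le_lintegral ha hJ'
    rw [ENNReal.ofReal_pow hJ'.le, ENNReal.ofReal_natCast] at this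
    refine this.trans (mul_le_mul_right (lintegral_mono_set (Ioc_subset_Ioc_right ?_)) _)
    linarith
  calc ellNorm p (sdiff J f) ≤ ellNorm p (sdiff J (f - g)) + ellNorm p (sdiff J g) := by
        rw [e]; exact ellNorm_add_le hp _ _
    _ ≤ 4 * (2 * I) + (J : ℝ≥0∞) ^ 2 * (3 * a J) := by
        refine add_le_add ((ellNorm_sdiff_le hp _ _).trans (mul_le_mul_right h1 _)) ?_
        exact (ellNorm_sdiff_le_lapl hp J g).trans (mul_le_mul_right h2 _)
    _ = 8 * I + 3 * ((J : ℝ≥0∞) ^ 2 * a J) := by ring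
    _ ≤ 8 * I + 3 * (2 * I) := by gcongr
    _ = 14 * I := by ring

lemma ellNorm_op_le_sum_sdiff {p : ℝ≥0∞} (hp : 1 ≤ p) {σ : ℝ → ℝ} (hσ : ContDiff ℝ 2 σ) {f : ℤ → ℝ}
    (hf : SummabilityCondition f) {c y : ℝ} (hc : 0 ≤ c) (h1 : ellOne (kern σ) ≤ 1)
    (h2 : ellOne (kern fun x => σ x * -x ^ 2) ≤ ENNReal.ofReal (c * (y ^ 2)⁻¹)) {J : ℕ}
    (hJ : J ≠ 0) :
    ellNorm p (op (kern fun x => σ x * -x ^ 2) f) ≤ ENNReal.ofReal (1 + 2 * c) *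
      (ENNReal.ofReal ((J : ℝ) ^ 2)⁻¹ * ellNorm p (sdiff J f) +
        ENNReal.ofReal ((y ^ 2)⁻¹ * (J : ℝ)⁻¹) * ∑ i ∈ Finset.range J, ellNorm p (sdiff i f)) := by
  have hJ' : (J : ℝ) ≠ 0 := by exact_mod_cast hJ
  refine (ellNorm_op_lapl_le hp hσ hf hJ).trans ?_
  rw [mul_add]
  refine add_le_add ?_ ?_
  · refine mul_le_mul_left (h1.trans ?_) _
    rw [← ENNReal.ofReal_one]
    exact ENNReal.ofReal_le_ofReal (by linarith)
  · calc _ ≤ ENNReal.ofReal (c * (y ^ 2)⁻¹) * (ENNReal.ofReal ((J : ℝ) ^ 2)⁻¹ *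
          (2 * J * ∑ i ∈ Finset.range J, ellNorm p (sdiff i f))) := by
          gcongr
          exact sum_sum_sdiff_le p f J
      _ = ENNReal.ofReal (2 * c) * (ENNReal.ofReal ((y ^ 2)⁻¹ * (J : ℝ)⁻¹) *
          ∑ i ∈ Finset.range J, ellNorm p (sdiff i f)) := by
          simp only [← mul_assoc]
          rw [← ENNReal.ofReal_mul (by positivity), ← ENNReal.ofReal_ofNat 2,
            ← ENNReal.ofReal_mul (by positivity), ← ENNReal.ofReal_natCast,
            ← ENNReal.ofReal_mul (by positivity), ← ENNReal.ofReal_mul (by positivity)]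
          congr 2
          field_simp
      _ ≤ _ := mul_le_mul_left (ENNReal.ofReal_le_ofReal (by linarith)) _

end DiscreteBesov

end

/-! ### The equivalences for the heat and Poisson semigroups. -/

noncomputable section

namespace DiscreteBesov

open Filter Topology Set

lemma ellOne_le_inv_mul {k : ℤ → ℝ} {y r K : ℝ} (hy : 0 < y) (hr : 0 ≤ r) (hK : 0 ≤ K)
    (h : ∀ j, |k j| ≤ r * (K * ((1 + y) / ((1 + y) ^ 2 + (j : ℝ) ^ 2)))) :
    ellOne k ≤ ENNReal.ofReal (5 * K * r) := by
  rw [show 5 * K * r = 5 * (r * K) by ring]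
  refine ellOne_le_of_cauchy (ρ := 1 + y) (by linarith) (by positivity) fun j => ?_
  rw [mul_assoc]
  exact h j

lemma ellNorm_op_neg {p : ℝ≥0∞} {σ τ : ℝ → ℝ} (h : ∀ x, σ x = -τ x) (f : ℤ → ℝ) :
    ellNorm p (op (kern σ) f) = ellNorm p (op (kern τ) f) := by
  have e : kern σ = fun j => -1 * kern τ j := by
    funext j
    rw [← kern_const_mul]
    congr 1
    funext x
    rw [h, neg_one_mul]
  rw [e, op_const_mul, ellNorm_const_mul]
  simp

lemma ellOne_neg {σ τ : ℝ → ℝ} (h : ∀ x, σ x = -τ x) : ellOne (kern σ) = ellOne (kern τ) := by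
  have e : kern σ = fun j => -1 * kern τ j := by
    funext j
    rw [← kern_const_mul]
    congr 1
    funext x
    rw [h, neg_one_mul]
  simp [e, ellOne]

/-- The common core for both semigroups: monotonicity of `a` and the two inequalities between `a`
and the second differences are all that is needed. -/
lemma secondDiffCondition_iff_eLpNorm {α : ℝ} (hα0 : 0 < α) (hα2 : α < 2) (p : ℝ≥0∞) {q : ℝ≥0∞}
    (hq : 1 ≤ q) {f : ℤ → ℝ} {a : ℝ → ℝ≥0∞} (ha : AntitoneOn a (Ioi 0)) {c : ℝ}
    (h1 : ∀ y : ℝ, 0 < y → ∀ J : ℕ, J ≠ 0 → a y ≤ ENNReal.ofReal (1 + 2 * c) *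
      (ENNReal.ofReal ((J : ℝ) ^ 2)⁻¹ * ellNorm p (sdiff J f) +
        ENNReal.ofReal ((y ^ 2)⁻¹ * (J : ℝ)⁻¹) * ∑ i ∈ Finset.range J, ellNorm p (sdiff i f)))
    (h2 : ∀ J : ℕ, 0 < J →
      ellNorm p (sdiff J f) ≤ 14 * ∫⁻ s in Ioc 0 (2 * (J : ℝ)), ENNReal.ofReal s * a s) :
    SecondDiffCondition α p q f ↔
      eLpNorm (fun y => ENNReal.ofReal (y ^ (2 - α)) * a y) q haarPos < ∞ := by
  rw [secondDiffCondition_iff α p hq f]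
  constructor
  · intro h
    refine eLpNorm_haarPos_lt_top_of_logMeas hα0 hα2 hq (N := fun n => ellNorm p (sdiff n f))
      ENNReal.ofReal_ne_top ?_ h1 ?_
    · simp [sdiff_zero, ellNorm]
    · exact_mod_cast h
  · intro h
    refine eLpNorm_logMeas_lt_top_of_haarPos hα0 hq ha (C := 14) (by simp) (fun n => ?_) h
    have := h2 (n + 1) n.succ_pos
    push_cast at this
    exact this

lemma secondDiffCondition_iff_heat {α : ℝ} (hα0 : 0 < α) (hα2 : α < 2) {p q : ℝ≥0∞} (hp : 1 ≤ p)
    (hq : 1 ≤ q) {f : ℤ → ℝ} (hf : SummabilityCondition f) :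
    SecondDiffCondition α p q f ↔ eLpNorm (fun y => ENNReal.ofReal (y ^ (2 - α)) *
      ellNorm p (op (kern (heatSym (fun x => -x ^ 2) (y ^ 2))) f)) q haarPos < ∞ := by
  have hμ : ContDiff ℝ 2 fun x : ℝ => x ^ 2 := by fun_prop
  have hA := antitone_ellNorm_op_sym hp (g := fun x => -x ^ 2) (by fun_prop) hμ
    (fun s hs => (ellOne_heatSym_one hs.le).le) hf
  have ha : AntitoneOn (fun y => ellNorm p (op (kern (heatSym (fun x => -x ^ 2) (y ^ 2))) f))
      (Ioi 0) := fun x hx y _ hxy => hA (pow_le_pow_left₀ (le_of_lt hx) hxy 2)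
  have e : ∀ t, (heatSym (fun x => -x ^ 2) t) = fun x => heatSym (fun _ => 1) t x * -x ^ 2 :=
    fun t => by funext x; simp only [heatSym, sym]; ring
  refine secondDiffCondition_iff_eLpNorm hα0 hα2 p hq ha
    (c := 5 * (5 * (20 * (3 * 46656)))) ?_ ?_
  · intro y hy J hJ
    simp only [e]
    refine ellNorm_op_le_sum_sdiff hp (contDiff_sym contDiff_const hμ _) hf (by norm_num)
      (ellOne_heatSym_one (by positivity)).le ?_ hJ
    rw [← e]
    exact ellOne_le_inv_mul hy (by positivity) (by norm_num) (abs_kern_heatSym_sq_le hy)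
  · intro J hJ
    have hJ' : (0 : ℝ) < J := by exact_mod_cast hJ
    refine ellNorm_sdiff_le_lintegral hp ha hJ ((ellNorm_heat_sub_le hp hf hJ').trans ?_) ?_
    · refine mul_le_mul_right (lintegral_mono_set (Ioc_subset_Ioc_right ?_)) _
      linarith
    · rw [← op_kern_neg_sq, ← op_kern_mul (by fun_prop) (contDiff_sym contDiff_const hμ _) hf]
      simp only [e, mul_comm]
      exact le_mul_of_one_le_left zero_le (by norm_num)

lemma secondDiffCondition_iff_pois {α : ℝ} (hα0 : 0 < α) (hα2 : α < 2) {p q : ℝ≥0∞} (hp : 1 ≤ p)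
    (hq : 1 ≤ q) {f : ℤ → ℝ} (hf : SummabilityCondition f) :
    SecondDiffCondition α p q f ↔ eLpNorm (fun y => ENNReal.ofReal (y ^ (2 - α)) *
      ellNorm p (op (kern (poisSym (fun x => x ^ 2) y)) f)) q haarPos < ∞ := by
  have hμ : ContDiff ℝ 2 fun x : ℝ => x := by fun_prop
  have hA := antitone_ellNorm_op_sym hp (g := fun x => x ^ 2) (by fun_prop) hμ
    (fun s hs => (ellOne_poisSym_one hs).le) hf
  have e : ∀ t x, poisSym (fun _ => 1) t x * -x ^ 2 = -poisSym (fun x => x ^ 2) t x :=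
    fun t x => by simp only [poisSym, sym]; ring
  refine secondDiffCondition_iff_eLpNorm hα0 hα2 p hq (hA.antitoneOn _)
    (c := 5 * (5 * (20 * (3 * 46656)))) ?_ ?_
  · intro y hy J hJ
    rw [← ellNorm_op_neg (e y)]
    refine ellNorm_op_le_sum_sdiff hp (contDiff_sym contDiff_const hμ _) hf (by norm_num)
      (ellOne_poisSym_one hy).le ?_ hJ
    rw [ellOne_neg (e y)]
    exact ellOne_le_inv_mul hy (by positivity) (by norm_num) (abs_kern_poisSym_sq_le hy)
  · intro J hJ
    have hJ' : (0 : ℝ) < J := by exact_mod_cast hJ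
    refine ellNorm_sdiff_le_lintegral hp (hA.antitoneOn _) hJ ((ellNorm_pois_sub_le hp hf hJ').trans
      (le_mul_of_one_le_left zero_le (by norm_num))) ?_
    have hl : ∀ y, ellNorm p (lapl (op (kern (poisSym (fun _ => 1) y)) f)) =
        ellNorm p (op (kern (poisSym (fun x => x ^ 2) y)) f) := by
      intro y
      rw [← op_kern_neg_sq, ← op_kern_mul (by fun_prop) (contDiff_sym contDiff_const hμ _) hf]
      exact ellNorm_op_neg (fun x => by rw [← e, mul_comm]) f
    set u := fun y => op (kern (poisSym (fun _ => 1) y)) f with hu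
    have hlin : lapl (fun n => 2 * u J n - u (2 * J) n) =
        (fun n => 2 * lapl (u J) n) + fun n => -lapl (u (2 * J)) n := by
      funext n; simp only [lapl, Pi.add_apply]; ring
    -- The value at `2 J` is bounded by the value at `J` through monotonicity, whence the constant
    -- `3 = 2 + 1`.
    calc ellNorm p (lapl (fun n => 2 * u J n - u (2 * J) n))
        ≤ 2 * ellNorm p (lapl (u J)) + ellNorm p (lapl (u (2 * J))) := by
          rw [hlin]
          refine (ellNorm_add_le hp _ _).trans_eq ?_
          rw [ellNorm_const_mul, ellNorm_neg, abs_two, ENNReal.ofReal_ofNat]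
      _ ≤ 2 * ellNorm p (op (kern (poisSym (fun x => x ^ 2) J)) f) +
          ellNorm p (op (kern (poisSym (fun x => x ^ 2) J)) f) := by
          simp only [hu, hl]
          exact add_le_add_right (hA (by linarith)) _
      _ = 3 * ellNorm p (op (kern (poisSym (fun x => x ^ 2) J)) f) := by ring

/-- As `α / 2 < 1` there is a single time derivative, and `t = y²` turns `t^{1 - α/2}` into `y^{2 -
α}`. -/
lemma heatBesov_iff {α : ℝ} (hα2 : α < 2) {p q : ℝ≥0∞} (hp : 1 ≤ p) {f : ℤ → ℝ}
    (hs : SizeCondition α q f) (hf : SummabilityCondition f) :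
    f ∈ heatBesov α p q ↔ eLpNorm (fun y => ENNReal.ofReal (y ^ (2 - α)) *
      ellNorm p (op (kern (heatSym (fun x => -x ^ 2) (y ^ 2))) f)) q haarPos < ∞ := by
  have hμ : ContDiff ℝ 2 fun x : ℝ => x ^ 2 := by fun_prop
  have hk : ⌊α / 2⌋₊ = 0 := Nat.floor_eq_zero.2 (by linarith)
  have hA := antitone_ellNorm_op_sym hp (g := fun x => -x ^ 2) (by fun_prop) hμ
    (fun s hs => (ellOne_heatSym_one hs.le).le) hf
  have hB := aemeasurable_rpow_mul_of_antitoneOn (hA.antitoneOn (Ioi 0)) (1 - α / 2)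
  have hcomp := eLpNorm_haarPos_comp_lt_top_iff hB one_pos two_pos q
  unfold heatBesov
  simp only [mem_ofPred_eq, hs, true_and]
  rw [mixedNorm_eq (c := 1 - α / 2) (U := fun t => op (kern (heatSym (fun x => -x ^ 2) t)) f)]
  · rw [← hcomp]
    refine iff_of_eq (congrArg (· < ∞) (eLpNorm_congr_ae ?_))
    filter_upwards [ae_haarPos_pos] with y hy
    rw [one_mul, Real.rpow_two, ← Real.rpow_two y, ← Real.rpow_mul hy.le]
    congr 3
    ring_nf
  · intro t ht n
    have hd := hasDerivAt_op_sym (contDiff_const (c := (1 : ℝ))) hμ hf n t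
    simp only [mul_one] at hd
    simp only [hk, zero_add, Nat.cast_one, iteratedDeriv_one, heatSemigroup_eq]
    rw [hd.deriv]

lemma deriv_poissonSemigroup {f : ℤ → ℝ} (hf : SummabilityCondition f) {y : ℝ} (hy : 0 < y)
    (n : ℤ) : deriv (fun s => poissonSemigroup s f n) y =
      op (kern (poisSym (fun x => -x) y)) f n := by
  have h : (fun s => poissonSemigroup s f n) =ᶠ[𝓝 y]
      fun s => op (kern (poisSym (fun _ => 1) s)) f n := by
    filter_upwards [lt_mem_nhds hy] with s hs
    rw [poissonSemigroup_eq hs hf]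
  rw [h.deriv_eq, (hasDerivAt_op_poisSym_one hf n y).deriv]

lemma deriv_deriv_poissonSemigroup {f : ℤ → ℝ} (hf : SummabilityCondition f) {y : ℝ} (hy : 0 < y)
    (n : ℤ) : deriv (deriv fun s => poissonSemigroup s f n) y =
      op (kern (poisSym (fun x => x ^ 2) y)) f n := by
  have h : deriv (fun s => poissonSemigroup s f n) =ᶠ[𝓝 y]
      fun s => op (kern (poisSym (fun x => -x) s)) f n := by
    filter_upwards [lt_mem_nhds hy] with s hs
    rw [deriv_poissonSemigroup hf hs]
  rw [h.deriv_eq, (hasDerivAt_op_poisSym_id hf n y).deriv]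

/-- The kernel is pointwise `O(1 / y)` and, for `y ≥ 1`, dominated by a multiple of `wt`. Thus no
constant of integration appears at infinity when the first derivative is recovered from the second.
-/
lemma tendsto_op_poisSym_id {f : ℤ → ℝ} (hf : SummabilityCondition f) (n : ℤ) :
    Tendsto (fun y => op (kern (poisSym (fun x => -x) y)) f n) atTop (𝓝 0) := by
  set K : ℝ := 5 * (20 * (3 * 46656)) with hK
  have hb : ∀ y : ℝ, 1 ≤ y → ∀ j : ℤ, |kern (poisSym (fun x => -x) y) j| ≤
      y⁻¹ * (K * ((1 + y) / ((1 + y) ^ 2 + (j : ℝ) ^ 2))) := fun y hy j =>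
    abs_kern_poisSym_id_le (by linarith) j
  have hK0 : 0 < K := by rw [hK]; norm_num
  clear_value K
  have h0 : (0 : ℝ) = ∑' _ : ℤ, (0 : ℝ) := by simp
  rw [h0]
  unfold op
  refine tendsto_tsum_of_dominated_convergence (bound := fun j => 2 * K * (wt (n - j) * |f j|))
    ((summable_wt_sub_mul hf n).mul_left _) (fun j => ?_) ?_
  · have h1 : Tendsto (fun y => kern (poisSym (fun x => -x) y) (n - j)) atTop (𝓝 0) := by
      have hlim : Tendsto (fun y : ℝ => y⁻¹ * K) atTop (𝓝 0) := by
        simpa using (tendsto_inv_atTop_zero (𝕜 := ℝ)).mul_const K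
      refine squeeze_zero_norm' ?_ hlim
      filter_upwards [eventually_ge_atTop 1] with y hy
      refine (hb y hy _).trans ?_
      have : (1 + y) / ((1 + y) ^ 2 + ((n - j : ℤ) : ℝ) ^ 2) ≤ 1 := by
        rw [div_le_one (by positivity)]; nlinarith [sq_nonneg ((n - j : ℤ) : ℝ)]
      calc _ ≤ y⁻¹ * (K * 1) := by gcongr
        _ = _ := by ring
    simpa using h1.mul_const (f j)
  · filter_upwards [eventually_ge_atTop 1] with y hy j
    rw [norm_mul, ← mul_assoc]
    refine mul_le_mul_of_nonneg_right ((hb y hy _).trans ?_) (abs_nonneg _)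
    unfold wt
    set x := ((n - j : ℤ) : ℝ)
    have h1 : y⁻¹ * ((1 + y) / ((1 + y) ^ 2 + x ^ 2)) ≤ 2 * (1 + x ^ 2)⁻¹ := by
      have hy0 : 0 < y := by linarith
      rw [inv_mul_eq_div, div_div, ← div_eq_mul_inv, div_le_div_iff₀ (by positivity) (by positivity)]
      nlinarith [sq_nonneg x, mul_nonneg (sub_nonneg.2 hy) (sq_nonneg x), pow_pos hy0 2, pow_pos hy0 3]
    calc _ = K * (y⁻¹ * ((1 + y) / ((1 + y) ^ 2 + x ^ 2))) := by ring
      _ ≤ K * (2 * (1 + x ^ 2)⁻¹) := by gcongr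
      _ = _ := by ring

/-- The `y`-derivative of the Poisson semigroup is the tail integral of the second derivative. -/
lemma ellNorm_pois_deriv_le {p : ℝ≥0∞} (hp : 1 ≤ p) {f : ℤ → ℝ} (hf : SummabilityCondition f)
    (y : ℝ) : ellNorm p (op (kern (poisSym (fun x => -x) y)) f) ≤
      ∫⁻ s in Ioi y, ellNorm p (op (kern (poisSym (fun x => x ^ 2) s)) f) := by
  have hμ : ContDiff ℝ 2 fun x : ℝ => x := by fun_prop
  have hg : ContDiff ℝ 2 fun x : ℝ => x ^ 2 := by fun_prop
  have hc : ∀ n, Continuous fun s : ℝ => op (kern (poisSym (fun x => x ^ 2) s)) f n :=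
    fun n => continuous_op_sym hg hμ hf n
  have h := ellNorm_le_lintegral hp (F := op (kern (poisSym (fun x => -x) y)) f) hc (s := Ioi y)
    (w := fun _ => 1) continuous_const fun n => ?_
  · simpa using h
  simp only [one_mul]
  have hlim := ((continuous_enorm.tendsto (0 : ℝ)).comp (tendsto_op_poisSym_id hf n)).add_const
    (∫⁻ s in Ioi y, ‖op (kern (poisSym (fun x => x ^ 2) s)) f n‖ₑ)
  rw [enorm_zero, zero_add] at hlim
  refine ge_of_tendsto hlim ?_
  filter_upwards [eventually_ge_atTop y] with Y hY
  have hi := intervalIntegral.integral_eq_sub_of_hasDerivAt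
    (fun s _ => hasDerivAt_op_poisSym_id hf n s) ((hc n).intervalIntegrable y Y)
  calc ‖op (kern (poisSym (fun x => -x) y)) f n‖ₑ
      = ‖op (kern (poisSym (fun x => -x) Y)) f n -
          ∫ s in y..Y, op (kern (poisSym (fun x => x ^ 2) s)) f n‖ₑ := by
        rw [hi, sub_sub_cancel]
    _ ≤ _ := enorm_sub_le
    _ ≤ _ := by
        refine add_le_add_right ((enorm_intervalIntegral_le hY).trans ?_) _
        exact lintegral_mono_set Ioc_subset_Ioi_self

/-- The factorisation `λ² e^{-2yλ} = (λ e^{-yλ})²`: one factor acts on `f`, the other has `ℓ¹` norm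
`O(1 / y)`. -/
lemma ellNorm_pois_second_le {p : ℝ≥0∞} (hp : 1 ≤ p) {f : ℤ → ℝ} (hf : SummabilityCondition f)
    {y : ℝ} (hy : 0 < y) : ellNorm p (op (kern (poisSym (fun x => x ^ 2) (2 * y))) f) ≤
      ENNReal.ofReal (5 * (5 * (20 * (3 * 46656))) * y⁻¹) *
        ellNorm p (op (kern (poisSym (fun x => -x) y)) f) := by
  have hg : ContDiff ℝ 2 (poisSym (fun x => -x) y) := contDiff_sym contDiff_neg contDiff_id y
  have e : poisSym (fun x => x ^ 2) (2 * y) =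
      fun x => poisSym (fun x => -x) y x * poisSym (fun x => -x) y x := by
    funext x
    simp only [poisSym, sym, two_mul, add_mul, neg_add, Real.exp_add]
    ring
  rw [e, op_kern_mul hg hg hf]
  refine (ellNorm_op_le hp _ _).trans (mul_le_mul_left ?_ _)
  exact ellOne_le_inv_mul hy (by positivity) (by norm_num) (abs_kern_poisSym_id_le hy)

/-- The second derivative at `2 y` costs `1 / y` times the first at `y`; conversely the first is a
tail integral of the second, and Hardy's inequality applies because `α < 1`. -/
lemma eLpNorm_pois_first_iff {α : ℝ} (hα1 : α < 1) {p q : ℝ≥0∞} (hp : 1 ≤ p)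
    (hq : 1 ≤ q) {f : ℤ → ℝ} (hf : SummabilityCondition f) :
    eLpNorm (fun y => ENNReal.ofReal (y ^ (1 - α)) *
      ellNorm p (op (kern (poisSym (fun x => -x) y)) f)) q haarPos < ∞ ↔
    eLpNorm (fun y => ENNReal.ofReal (y ^ (2 - α)) *
      ellNorm p (op (kern (poisSym (fun x => x ^ 2) y)) f)) q haarPos < ∞ := by
  have hμ : ContDiff ℝ 2 fun x : ℝ => x := by fun_prop
  have hA := antitone_ellNorm_op_sym hp (g := fun x => x ^ 2) (by fun_prop) hμ
    (fun s hs => (ellOne_poisSym_one hs).le) hf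
  constructor
  · intro h
    have hB := aemeasurable_rpow_mul_of_antitoneOn (hA.antitoneOn (Ioi 0)) (2 - α)
    rw [← eLpNorm_haarPos_comp_lt_top_iff hB two_pos one_pos q]
    set c : ℝ := 2 ^ (2 - α) * (5 * (5 * (20 * (3 * 46656)))) with hc
    refine (eLpNorm_le_mul_eLpNorm_of_ae_le_mul' (c := c.toNNReal) ?_ q).trans_lt
      (ENNReal.mul_lt_top ENNReal.ofReal_lt_top h)
    filter_upwards [ae_haarPos_pos] with y hy
    simp only [enorm_eq_self, Real.rpow_one]
    refine (mul_le_mul_right (ellNorm_pois_second_le hp hf hy) _).trans_eq ?_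
    change _ = ENNReal.ofReal c * _
    have hc0 : 0 ≤ c := by rw [hc]; positivity
    have h2y : 0 ≤ (2 * y) ^ (2 - α) := by positivity
    rw [← mul_assoc (ENNReal.ofReal ((2 * y) ^ _)), ← mul_assoc (ENNReal.ofReal c),
      ← ENNReal.ofReal_mul h2y, ← ENNReal.ofReal_mul hc0, Real.mul_rpow two_pos.le hy.le,
      show y ^ (2 - α) = y ^ (1 - α) * y by
        rw [show 2 - α = (1 - α) + 1 by ring, Real.rpow_add hy, Real.rpow_one], hc]
    congr 2
    field_simp
  · exact eLpNorm_haarPos_tail_lt_top hα1 hq (hA.antitoneOn _) fun y _ => ellNorm_pois_deriv_le hp hf y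

lemma poissonBesov_iff {α : ℝ} (hα0 : 0 < α) (hα2 : α < 2) {p q : ℝ≥0∞} (hp : 1 ≤ p) (hq : 1 ≤ q)
    {f : ℤ → ℝ} (hf : SummabilityCondition f) :
    f ∈ poissonBesov α p q ↔ eLpNorm (fun y => ENNReal.ofReal (y ^ (2 - α)) *
      ellNorm p (op (kern (poisSym (fun x => x ^ 2) y)) f)) q haarPos < ∞ := by
  unfold poissonBesov
  simp only [mem_ofPred_eq, hf, true_and]
  rcases lt_or_ge α 1 with h1 | h1
  · have hl : ⌊α⌋₊ = 0 := Nat.floor_eq_zero.2 h1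
    rw [← eLpNorm_pois_first_iff h1 hp hq hf,
      mixedNorm_eq (c := 1 - α) (U := fun y => op (kern (poisSym (fun x => -x) y)) f)]
    intro y hy n
    simp only [hl, zero_add, Nat.cast_one, iteratedDeriv_one, deriv_poissonSemigroup hf hy]
  · have hl : ⌊α⌋₊ = 1 := (Nat.floor_eq_iff hα0.le).2 (by norm_num; constructor <;> linarith)
    rw [mixedNorm_eq (c := 2 - α) (U := fun y => op (kern (poisSym (fun x => x ^ 2) y)) f)]
    intro y hy n
    simp only [hl, iteratedDeriv_succ, iteratedDeriv_zero, deriv_deriv_poissonSemigroup hf hy]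
    norm_num

end DiscreteBesov

theorem theorem3p7 (α : ℝ) (hα0 : 0 < α) (hα2 : α < 2)
    (p q : ℝ≥0∞) (hp : 1 ≤ p) (hq : 1 ≤ q) (f : ℤ → ℝ)
    (hsize : DiscreteBesov.SizeCondition α q f)
    (hsum : DiscreteBesov.SummabilityCondition f) :
    List.TFAE
      [f ∈ DiscreteBesov.heatBesov α p q,
       f ∈ DiscreteBesov.poissonBesov α p q,
       DiscreteBesov.SecondDiffCondition α p q f] := by
  have h1 := (DiscreteBesov.heatBesov_iff hα2 hp hsize hsum).trans
    (DiscreteBesov.secondDiffCondition_iff_heat hα0 hα2 hp hq hsum).symm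
  have h2 := (DiscreteBesov.poissonBesov_iff hα0 hα2 hp hq hsum).trans
    (DiscreteBesov.secondDiffCondition_iff_pois hα0 hα2 hp hq hsum).symm
  tfae_have 1 ↔ 3 := h1
  tfae_have 2 ↔ 3 := h2
  tfae_finish

end
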